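/- An approval profile consists of $n$ voters $v_1,\dots,v_n$ and $m$ alternatives, where each voter $v_i$ has a set of approved alternatives. It is single-crossing if there is a linear order of the voters in which, for every alternative, the voters approving of it form an interval. The approval misrepresentation is $\rho(v,a)=0$ if $v$ approves of $a$ and $\rho(v,a)=1$ otherwise. For an integer $k\ge 1$, a proportional $k$-assignment is a map $\sigma$ from the voters to the alternatives whose image has exactly $k$ elements and which satisfies $\lfloor n/k\rfloor\le|\sigma^{-1}(a)|\le\lceil n/k\rceil$ for every $a$ in the image. The problem Approval-Monroe-MW$^{+}$ (resp. Approval-Monroe-MW$^{\max}$) is, given an approval profile and $k\ge 1$, to find a proportional $k$-assignment $\sigma$ that minimizes $\sum_{v}\rho(v,\sigma(v))$ (resp. $\max_{v}\rho(v,\sigma(v))$) among all proportional $k$-assignments, or to report that no proportional $k$-assignment exists. Theorem. On single-crossing approval profiles (without a single-crossing order being given), each of the problems Approval-Monroe-MW$^{+}$ and Approval-Monroe-MW$^{\max}$ can be solved in polynomial time. More precisely, for each of the two problems there is a program for a unit-cost random access machine (with addition and truncated subtraction, but no multiplication, as its arithmetic) which, started on the numbers $n,m,k$ and the $n\times m$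 approval matrix of any single-crossing approval profile, halts with a correct output after a number of steps that is bounded by a polynomial in $n+m$ and is also at most $C\,(n^{11}m^{5}k+1)$ for a constant $C$. -/

import Mathlib

/-! ## Approval profiles and the Monroe rule -/

/-- An approval profile with `n` voters and `m` alternatives: each voter has a set of approved
alternatives. -/
structure ApprovalProfile (n m : ℕ) where
  approved : Fin n → Finset (Fin m)

namespace ApprovalProfile

variable {n m : ℕ}

/-- `A(x)`, the set of voters who approve of the alternative `x`. -/
def approvers (P : ApprovalProfile n m) (x : Fin m) : Set (Fin n) :=
  {v | x ∈ P.approved v}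

/-- `P` is single-crossing with respect to the (strict) order `r` of the voters: for each
alternative, the voters approving of it form an interval. -/
def IsSingleCrossingWrt (P : ApprovalProfile n m) (r : Fin n → Fin n → Prop) : Prop :=
  ∀ (x : Fin m) (u v w : Fin n), r u v → r v w →
    u ∈ P.approvers x → w ∈ P.approvers x → v ∈ P.approvers x

/-- `P` is single-crossing: it is so with respect to some linear order of the voters. -/
def IsSingleCrossing (P : ApprovalProfile n m) : Prop :=
  ∃ r : Fin n → Fin n → Prop, IsStrictTotalOrder (Fin n) r ∧ P.IsSingleCrossingWrt r

/-- The approval misrepresentation function. -/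
def misrep (P : ApprovalProfile n m) (v : Fin n) (a : Fin m) : ℕ :=
  if a ∈ P.approved v then 0 else 1

/-- The sum of the misrepresentations of all voters under the assignment `σ`. -/
def sumMisrep (P : ApprovalProfile n m) (σ : Fin n → Fin m) : ℕ :=
  ∑ v, P.misrep v (σ v)

/-- The maximum misrepresentation of a voter under the assignment `σ`. -/
def maxMisrep (P : ApprovalProfile n m) (σ : Fin n → Fin m) : ℕ :=
  Finset.univ.sup fun v => P.misrep v (σ v)

end ApprovalProfile

/-- `σ` is a proportional `k`-assignment: exactly `k` alternatives are assigned, and each of them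
represents at least `⌊n / k⌋` and at most `⌈n / k⌉` voters. -/
def IsProportionalAssignment {n m : ℕ} (k : ℕ) (σ : Fin n → Fin m) : Prop :=
  (Finset.univ.image σ).card = k ∧
    ∀ a ∈ Finset.univ.image σ,
      ⌊(n : ℚ) / k⌋₊ ≤ (Finset.univ.filter fun v => σ v = a).card ∧
        (Finset.univ.filter fun v => σ v = a).card ≤ ⌈(n : ℚ) / k⌉₊

/-- A way of measuring the overall misrepresentation of an assignment. -/
abbrev MisrepMeasure : Type :=
  ∀ {n m : ℕ}, ApprovalProfile n m → (Fin n → Fin m) → ℕ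

/-- `σ` is an optimal solution for the Monroe rule with committee size `k`, where the overall
misrepresentation is measured by `μ`. -/
def IsMonroeOptimal (μ : MisrepMeasure) {n m : ℕ} (P : ApprovalProfile n m) (k : ℕ)
    (σ : Fin n → Fin m) : Prop :=
  IsProportionalAssignment k σ ∧
    ∀ τ : Fin n → Fin m, IsProportionalAssignment k τ → μ P σ ≤ μ P τ

/-! ## Random access machines

A unit-cost random access machine with addition and truncated subtraction as its only arithmetic.
There is no multiplication, so the bit length of the numbers occurring in a run exceeds that of the
numbers in the input and the program by at most the number of steps, and polynomially many steps
are polynomial time. -/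

namespace RAM

/-- A memory configuration: the registers, which a program addresses by constants, and the main
memory, which it addresses through the content of a register. -/
structure State where
  reg : ℕ → ℕ
  mem : ℕ → ℕ

/-- Programs of the machine, with structured flow of control. A program mentions only finitely many
registers. -/
inductive Prog : Type
  /-- `R[x] := c` -/
  | const (x c : ℕ) : Prog
  /-- `R[x] := R[y] + R[z]` -/
  | add (x y z : ℕ) : Prog
  /-- `R[x] := R[y] - R[z]`, truncated at `0` -/
  | sub (x y z : ℕ) : Prog
  /-- `R[x] := M[R[y]]` -/
  | load (x y : ℕ) : Prog
  /-- `M[R[x]] := R[y]` -/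
  | store (x y : ℕ) : Prog
  /-- first `p`, then `q` -/
  | seq (p q : Prog) : Prog
  /-- `p` if `R[x] ≠ 0`, and `q` otherwise -/
  | ifNonzero (x : ℕ) (p q : Prog) : Prog
  /-- repeat `p` as long as `R[x] ≠ 0` -/
  | whileNonzero (x : ℕ) (p : Prog) : Prog

/-- `Exec p s t s'`: started in `s`, the program `p` halts after exactly `t` steps in `s'`. Each
elementary instruction and each test of a register takes one step. -/
inductive Exec : Prog → State → ℕ → State → Prop
  | const (x c : ℕ) (s : State) :
      Exec (.const x c) s 1 { s with reg := Function.update s.reg x c }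
  | add (x y z : ℕ) (s : State) :
      Exec (.add x y z) s 1 { s with reg := Function.update s.reg x (s.reg y + s.reg z) }
  | sub (x y z : ℕ) (s : State) :
      Exec (.sub x y z) s 1 { s with reg := Function.update s.reg x (s.reg y - s.reg z) }
  | load (x y : ℕ) (s : State) :
      Exec (.load x y) s 1 { s with reg := Function.update s.reg x (s.mem (s.reg y)) }
  | store (x y : ℕ) (s : State) :
      Exec (.store x y) s 1 { s with mem := Function.update s.mem (s.reg x) (s.reg y) }
  | seq {p q : Prog} {s s' s'' : State} {t t' : ℕ}
      (hp : Exec p s t s') (hq : Exec q s' t' s'') : Exec (.seq p q) s (t + t') s''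
  | ifTrue {x : ℕ} {p q : Prog} {s s' : State} {t : ℕ}
      (hx : s.reg x ≠ 0) (hp : Exec p s t s') : Exec (.ifNonzero x p q) s (t + 1) s'
  | ifFalse {x : ℕ} {p q : Prog} {s s' : State} {t : ℕ}
      (hx : s.reg x = 0) (hq : Exec q s t s') : Exec (.ifNonzero x p q) s (t + 1) s'
  | whileStop {x : ℕ} {p : Prog} {s : State}
      (hx : s.reg x = 0) : Exec (.whileNonzero x p) s 1 s
  | whileStep {x : ℕ} {p : Prog} {s s' s'' : State} {t t' : ℕ}
      (hx : s.reg x ≠ 0) (hp : Exec p s t s') (hw : Exec (.whileNonzero x p) s' t' s'') :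
      Exec (.whileNonzero x p) s (t + 1 + t') s''

end RAM

/-! ## Winner determination as a computational problem -/

/-- The initial state for the instance `(P, k)`: registers `0`, `1`, `2` hold `n`, `m`, `k`, and
memory holds the approval matrix row by row: cell `i * m + a` contains `1` if voter `i` approves of
alternative `a`, and `0` otherwise. All other registers and cells contain `0`. -/
def encodeInstance {n m : ℕ} (P : ApprovalProfile n m) (k : ℕ) : RAM.State where
  reg x := if x = 0 then n else if x = 1 then m else if x = 2 then k else 0
  mem c := if ∃ (i : Fin n) (a : Fin m), c = (i : ℕ) * m + a ∧ a ∈ P.approved i then 1 else 0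

/-- The state `s` presents the assignment `σ` as output: register `0` holds `1`, and memory cell
`i` holds the alternative that represents voter `i`. -/
def PresentsAssignment {n m : ℕ} (s : RAM.State) (σ : Fin n → Fin m) : Prop :=
  s.reg 0 = 1 ∧ ∀ i : Fin n, s.mem i = σ i

/-- `s` is a correct final state for the instance `(P, k)`: it presents an optimal solution, or
register `0` holds `0` and there is no proportional `k`-assignment at all. -/
def IsCorrectOutput (μ : MisrepMeasure) {n m : ℕ} (P : ApprovalProfile n m) (k : ℕ)
    (s : RAM.State) : Prop :=
  (∃ σ : Fin n → Fin m, IsMonroeOptimal μ P k σ ∧ PresentsAssignment s σ) ∨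
    (s.reg 0 = 0 ∧ ¬ ∃ σ : Fin n → Fin m, IsProportionalAssignment k σ)

/-- On every single-crossing approval profile with `n` voters and `m` alternatives and every
committee size `k ≥ 1`, the program solves winner determination for the Monroe rule within
`T n m k` steps. The input contains no single-crossing order. -/
def SolvesMonroeOnSingleCrossing (μ : MisrepMeasure) (prog : RAM.Prog) (T : ℕ → ℕ → ℕ → ℕ) : Prop :=
  ∀ (n m k : ℕ) (P : ApprovalProfile n m), 1 ≤ k → P.IsSingleCrossing →
    ∃ (t : ℕ) (s : RAM.State),
      RAM.Exec prog (encodeInstance P k) t s ∧ t ≤ T n m k ∧ IsCorrectOutput μ P k s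

/-! Misrepresentation takes only the values 0 and 1, so a proportional assignment that minimizes the
sum also minimizes the maximum, and one program settles both problems. If `k > n` or `k > m` there
is no proportional assignment; otherwise there is one, and the problem splits as follows.

Finding an order. If an alternative is approved by `v` and `v'` but not by `u`, then every
single-crossing order contains both or neither of `(u, v)` and `(u, v')`, and likewise for the
reversed pairs. This forcing generates classes of ordered pairs. No class contains a pair of
distinct voters together with its reversal, because some single-crossing order exists. Of each class
and its reversal, keep the one containing the lexicographically largest pair. The result is a linear
order: in a directed triangle, a side can move within its class while the other two sides follow
within theirs (`IsClassMax.move`), and comparing the largest members of the three classes gives a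
contradiction (`IsClassMax.not_cyclic`). The approving voters form intervals, since a violation
would be a forced pair oriented the wrong way. The largest members are found by propagating maxima
along the forcing relation.

Scheduling. Let `n = k * q + r` with `r < k`. List the voters in the order found and regard them as
unit time slots; alternatives are jobs, each available on an interval. The task is to fill as many
slots as possible with at most `k` jobs, each having at most `q + 1` slots and at most `r` of them
exactly `q + 1`. The approved pairs of a proportional assignment form such a schedule
(`IsProportionalAssignment.isSchedule`). Conversely, such a schedule extends voter by voter to a
proportional assignment (`IsPartialAssignment.exists_extend`), whose misrepresentation is at most
`n` minus the size of the schedule.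

Dynamic programming. Jobs enter in order of their deadlines. By exchanging slots, the newest job
needs to run only when no other scheduled job is pending (`IsSchedule.exists_tail`). Then each slot
`p` of it separates the schedule: the other jobs running after `p` are released after `p`, so the
two sides are independent. The slots of the new job are guessed from the last to the first.

Reading off a solution. No back pointers are kept. A pair `(a, p)` has weight `(m + 1) ^ n + (a + 1)
* (m + 1) ^ p`, so the total weight of a schedule determines its size and lists its slots as digits
in base `m + 1`. Soundness says that a table entry is the weight of an actual schedule; completeness
is needed only up to multiples of `(m + 1) ^ n`.

Running time. The algorithm is written in a small language whose loops all have length `n + 1` or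
`m`. Its translation to the machine is verified once (`Cmd.compile_runs`), and the nesting depths of
the two kinds of loops bound the exponents of the running time (`Cmd.polyBound_cost`). -/

namespace RAM

/-! ## Bounded runs -/

/-- Started in `s`, the program `p` halts after at most `T` steps in a state satisfying `Q`. -/
def Runs (p : Prog) (s : State) (T : ℕ) (Q : State → Prop) : Prop :=
  ∃ t s', Exec p s t s' ∧ t ≤ T ∧ Q s'

theorem Runs.mono {p : Prog} {s : State} {T T' : ℕ} {Q Q' : State → Prop} (h : Runs p s T Q)
    (hT : T ≤ T') (hQ : ∀ s', Q s' → Q' s') : Runs p s T' Q' := by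
  obtain ⟨t, s', h1, h2, h3⟩ := h
  exact ⟨t, s', h1, h2.trans hT, hQ _ h3⟩

theorem Runs.seq {p q : Prog} {s : State} {T T' : ℕ} {Q R : State → Prop} (h : Runs p s T Q)
    (h' : ∀ s', Q s' → Runs q s' T' R) : Runs (.seq p q) s (T + T') R := by
  obtain ⟨t, s', h1, h2, h3⟩ := h
  obtain ⟨t', s'', h4, h5, h6⟩ := h' _ h3
  exact ⟨_, s'', .seq h1 h4, by omega, h6⟩

theorem Runs.const {x c : ℕ} {s : State} {Q : State → Prop}
    (h : Q { s with reg := Function.update s.reg x c }) : Runs (.const x c) s 1 Q :=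
  ⟨_, _, .const x c s, le_rfl, h⟩

theorem Runs.add {x y z : ℕ} {s : State} {Q : State → Prop}
    (h : Q { s with reg := Function.update s.reg x (s.reg y + s.reg z) }) :
    Runs (.add x y z) s 1 Q :=
  ⟨_, _, .add x y z s, le_rfl, h⟩

theorem Runs.sub {x y z : ℕ} {s : State} {Q : State → Prop}
    (h : Q { s with reg := Function.update s.reg x (s.reg y - s.reg z) }) :
    Runs (.sub x y z) s 1 Q :=
  ⟨_, _, .sub x y z s, le_rfl, h⟩

theorem Runs.load {x y : ℕ} {s : State} {Q : State → Prop}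
    (h : Q { s with reg := Function.update s.reg x (s.mem (s.reg y)) }) :
    Runs (.load x y) s 1 Q :=
  ⟨_, _, .load x y s, le_rfl, h⟩

theorem Runs.store {x y : ℕ} {s : State} {Q : State → Prop}
    (h : Q { s with mem := Function.update s.mem (s.reg x) (s.reg y) }) :
    Runs (.store x y) s 1 Q :=
  ⟨_, _, .store x y s, le_rfl, h⟩

theorem Runs.ite {x : ℕ} {p q : Prog} {s : State} {T : ℕ} {Q : State → Prop}
    (hp : s.reg x ≠ 0 → Runs p s T Q) (hq : s.reg x = 0 → Runs q s T Q) :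
    Runs (.ifNonzero x p q) s (T + 1) Q := by
  by_cases hx : s.reg x = 0
  · obtain ⟨t, s', h1, h2, h3⟩ := hq hx
    exact ⟨_, s', .ifFalse hx h1, by omega, h3⟩
  · obtain ⟨t, s', h1, h2, h3⟩ := hp hx
    exact ⟨_, s', .ifTrue hx h1, by omega, h3⟩

/-- The register `c` counts the remaining rounds, so induction on their number `j` gives
termination. Each round costs the body and one test, and one further test ends the loop. -/
theorem Runs.while {p : Prog} {c T n : ℕ} (I : ℕ → State → Prop)
    (hI : ∀ i s, I i s → s.reg c = n - i)
    (h : ∀ i s, i < n → I i s → Runs p s T (I (i + 1))) (j : ℕ) :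
    ∀ i s, i + j = n → I i s → Runs (.whileNonzero c p) s (j * (T + 1) + 1) (I n) := by
  induction j with
  | zero =>
    intro i s hi hs
    obtain rfl : i = n := by omega
    exact ⟨_, s, .whileStop (by rw [hI _ _ hs]; omega), by omega, hs⟩
  | succ j ih =>
    intro i s hi hs
    obtain ⟨t, s', h1, h2, h3⟩ := h i s (by omega) hs
    obtain ⟨t', s'', h4, h5, h6⟩ := ih (i + 1) s' (by omega) h3
    refine ⟨_, s'', .whileStep (by rw [hI _ _ hs]; omega) h1 h4, ?_, h6⟩
    nlinarith

/-! ## A language of bounded loops -/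

/-- The register holding the number of iterations of a loop; there are two kinds of loops. -/
def sizeReg (b : Bool) : ℕ := if b then 3 else 1

/-- Expressions. Loops run over an initial segment whose length depends on a Boolean tag. -/
inductive Exp : Type
  | var (x : ℕ) : Exp
  | const (c : ℕ) : Exp
  | add (e f : Exp) : Exp
  | sub (e f : Exp) : Exp
  | load (e : Exp) : Exp
  | cond (c e f : Exp) : Exp
  | bind (x : ℕ) (e f : Exp) : Exp
  | sum (b : Bool) (x : ℕ) (e : Exp) : Exp
  | sup (b : Bool) (x : ℕ) (e : Exp) : Exp
  | iter (b : Bool) (x y : ℕ) (e f : Exp) : Exp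

/-- The value of an expression, given the lengths of the loops, the memory, and the values of the
variables. -/
def Exp.eval (sz : Bool → ℕ) (mem : ℕ → ℕ) : Exp → (ℕ → ℕ) → ℕ
  | .var x, env => env x
  | .const c, _ => c
  | .add e f, env => e.eval sz mem env + f.eval sz mem env
  | .sub e f, env => e.eval sz mem env - f.eval sz mem env
  | .load e, env => mem (e.eval sz mem env)
  | .cond c e f, env => if c.eval sz mem env ≠ 0 then e.eval sz mem env else f.eval sz mem env
  | .bind x e f, env => f.eval sz mem (Function.update env x (e.eval sz mem env))
  | .sum b x e, env => ∑ i ∈ Finset.range (sz b), e.eval sz mem (Function.update env x i)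
  | .sup b x e, env => (Finset.range (sz b)).sup fun i => e.eval sz mem (Function.update env x i)
  | .iter b x y e f, env =>
      Nat.rec (e.eval sz mem env)
        (fun i v => f.eval sz mem (Function.update (Function.update env x i) y v)) (sz b)

/-- Commands. They change the memory only. -/
inductive Cmd : Type
  | store (e f : Exp) : Cmd
  | seq (c d : Cmd) : Cmd
  | guard (e : Exp) (c : Cmd) : Cmd
  | bind (x : ℕ) (e : Exp) (c : Cmd) : Cmd
  | loop (b : Bool) (x : ℕ) (c : Cmd) : Cmd

/-- The memory after the execution of a command. -/
def Cmd.run (sz : Bool → ℕ) : Cmd → (ℕ → ℕ) → (ℕ → ℕ) → (ℕ → ℕ)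
  | .store e f, env, mem => Function.update mem (e.eval sz mem env) (f.eval sz mem env)
  | .seq c d, env, mem => d.run sz env (c.run sz env mem)
  | .guard e c, env, mem => if e.eval sz mem env ≠ 0 then c.run sz env mem else mem
  | .bind x e c, env, mem => c.run sz (Function.update env x (e.eval sz mem env)) mem
  | .loop b x c, env, mem =>
      Nat.rec mem (fun i mem' => c.run sz (Function.update env x i) mem') (sz b)

/-- `R[x] := R[y]` -/
def moveProg (x y : ℕ) : Prog := .seq (.const x 0) (.add x x y)

/-- A loop that counts up in register `d + 1`, with its invariant data in the registers up to
`d`. -/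
def loopProg (b : Bool) (d : ℕ) (body : Prog) : Prog :=
  .seq (.const (d + 1) 0) (.seq (moveProg (d + 2) (sizeReg b)) (.seq (.const (d + 3) 1)
    (.whileNonzero (d + 2) (.seq body (.seq (.add (d + 1) (d + 1) (d + 3))
      (.sub (d + 2) (d + 2) (d + 3)))))))

/-- The translation of an expression, with the variables kept in the registers given by `ρ`. The
value is computed in register `d`, and registers below `d` remain unchanged. -/
def Exp.compile : Exp → (ℕ → ℕ) → ℕ → Prog
  | .var x, ρ, d => moveProg d (ρ x)
  | .const c, _, d => .const d c
  | .add e f, ρ, d => .seq (e.compile ρ d) (.seq (f.compile ρ (d + 1)) (.add d d (d + 1)))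
  | .sub e f, ρ, d => .seq (e.compile ρ d) (.seq (f.compile ρ (d + 1)) (.sub d d (d + 1)))
  | .load e, ρ, d => .seq (e.compile ρ d) (.load d d)
  | .cond c e f, ρ, d => .seq (c.compile ρ d) (.ifNonzero d (e.compile ρ d) (f.compile ρ d))
  | .bind x e f, ρ, d => .seq (e.compile ρ d)
      (.seq (f.compile (Function.update ρ x d) (d + 1)) (moveProg d (d + 1)))
  | .sum b x e, ρ, d => .seq (.const d 0) (loopProg b d
      (.seq (e.compile (Function.update ρ x (d + 1)) (d + 4)) (.add d d (d + 4))))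
  | .sup b x e, ρ, d => .seq (.const d 0) (loopProg b d
      (.seq (e.compile (Function.update ρ x (d + 1)) (d + 4))
        (.seq (.sub (d + 4) (d + 4) d) (.add d d (d + 4)))))
  | .iter b x y e f, ρ, d => .seq (e.compile ρ d) (loopProg b d
      (.seq (f.compile (Function.update (Function.update ρ x (d + 1)) y d) (d + 4))
        (moveProg d (d + 4))))

/-- The translation of a command, with scratch registers from `d` on. -/
def Cmd.compile : Cmd → (ℕ → ℕ) → ℕ → Prog
  | .store e f, ρ, d => .seq (e.compile ρ d) (.seq (f.compile ρ (d + 1)) (.store d (d + 1)))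
  | .seq c c', ρ, d => .seq (c.compile ρ d) (c'.compile ρ d)
  | .guard e c, ρ, d => .seq (e.compile ρ d) (.ifNonzero d (c.compile ρ d) (.const d 0))
  | .bind x e c, ρ, d => .seq (e.compile ρ d) (c.compile (Function.update ρ x d) (d + 1))
  | .loop b x c, ρ, d => .seq (.const d 0)
      (loopProg b d (c.compile (Function.update ρ x (d + 1)) (d + 4)))

/-- A bound for the running time of an expression. -/
def Exp.cost (sz : Bool → ℕ) : Exp → ℕ
  | .var _ => 2
  | .const _ => 1
  | .add e f => e.cost sz + f.cost sz + 1
  | .sub e f => e.cost sz + f.cost sz + 1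
  | .load e => e.cost sz + 1
  | .cond c e f => c.cost sz + (e.cost sz + f.cost sz + 1)
  | .bind _ e f => e.cost sz + f.cost sz + 2
  | .sum b _ e => sz b * (e.cost sz + 5) + 6
  | .sup b _ e => sz b * (e.cost sz + 5) + 6
  | .iter b _ _ e f => e.cost sz + sz b * (f.cost sz + 5) + 5

/-- A bound for the running time of a command. -/
def Cmd.cost (sz : Bool → ℕ) : Cmd → ℕ
  | .store e f => e.cost sz + f.cost sz + 1
  | .seq c d => c.cost sz + d.cost sz
  | .guard e c => e.cost sz + (c.cost sz + 2)
  | .bind _ e c => e.cost sz + c.cost sz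
  | .loop b _ c => sz b * (c.cost sz + 3) + 6

/-! ### Correctness of the translation into machine programs -/

theorem Runs.move {x y : ℕ} {s : State} {Q : State → Prop} (hxy : y ≠ x)
    (h : Q { s with reg := Function.update s.reg x (s.reg y) }) : Runs (moveProg x y) s 2 Q := by
  refine Runs.seq (T := 1) (T' := 1) (Q := fun s' => s' = _) (Runs.const rfl) ?_
  rintro s' rfl
  refine Runs.add ?_
  simpa [hxy] using h

/-- Register `d` accumulates, `d + 1` is the index, `d + 2` counts the remaining rounds and `d + 3`
holds the constant 1; the body works from `d + 4` on. The sequences `acc` and `mm` are arbitrary, so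
that the lemma serves loops in expressions (constant memory) and loops of commands (constant
accumulator) alike. -/
theorem runs_loopProg {b : Bool} {d : ℕ} {body : Prog} {s : State} {n T : ℕ} {acc : ℕ → ℕ}
    {mm : ℕ → ℕ → ℕ} (hb : sizeReg b < d) (hn : s.reg (sizeReg b) = n) (h0 : s.reg d = acc 0)
    (hm : s.mem = mm 0)
    (hbody : ∀ i < n, ∀ s', (∀ j < d, s'.reg j = s.reg j) → s'.reg d = acc i →
      s'.reg (d + 1) = i → s'.mem = mm i → Runs body s' T (fun s'' =>
        (∀ j < d + 4, j ≠ d → s''.reg j = s'.reg j) ∧ s''.reg d = acc (i + 1) ∧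
          s''.mem = mm (i + 1))) :
    Runs (loopProg b d body) s (n * (T + 3) + 5) (fun s' =>
      (∀ j < d, s'.reg j = s.reg j) ∧ s'.reg d = acc n ∧ s'.mem = mm n) := by
  set I : ℕ → State → Prop := fun i s' =>
    (∀ j < d, s'.reg j = s.reg j) ∧ s'.reg d = acc i ∧ s'.mem = mm i ∧ s'.reg (d + 1) = i ∧
      s'.reg (d + 2) = n - i ∧ s'.reg (d + 3) = 1 with hI
  refine Runs.mono (T := 1 + (2 + (1 + (n * ((T + (1 + 1)) + 1) + 1)))) (Q := I n) ?_ ?_ ?_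
  rotate_left
  · apply le_of_eq; ring
  · rintro s' ⟨h1, h2, h3, -⟩
    exact ⟨h1, h2, h3⟩
  refine Runs.seq (Q := fun s' => s' = _) (Runs.const rfl) ?_
  rintro _ rfl
  refine Runs.seq (Q := fun s' => s' = _) (Runs.move (by omega) rfl) ?_
  rintro _ rfl
  refine Runs.seq (Q := fun s' => s' = _) (Runs.const rfl) ?_
  rintro _ rfl
  refine Runs.while I (fun i s h => h.2.2.2.2.1) ?_ n 0 _ (by omega) ?_
  · rintro i s' hi ⟨h1, h2, h3, h4, h5, h6⟩
    refine Runs.seq (hbody i hi s' h1 h2 h4 h3) ?_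
    rintro s₁ ⟨g1, g2, g3⟩
    refine Runs.seq (T := 1) (T' := 1) (Q := fun s' => s' = _) (Runs.add rfl) ?_
    rintro _ rfl
    refine Runs.sub ⟨?_, ?_, ?_, ?_, ?_, ?_⟩
    · intro j hj
      simp [show j ≠ d + 2 by omega, show j ≠ d + 1 by omega, g1 j (by omega) (by omega), h1 j hj]
    · simp [g2]
    · simp [g3]
    · simp [g1, h4, h6]
    · simp [g1, h5, h6]
      omega
    · simp [g1, h6]
  · refine ⟨?_, ?_, ?_, ?_, ?_, ?_⟩
    · intro j hj
      simp [Function.update_apply, show j ≠ d + 2 by omega, show j ≠ d + 1 by omega,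
        show j ≠ d + 3 by omega]
    · simp [h0]
    · simp [hm]
    · simp
    · simp [show sizeReg b ≠ d + 1 by omega, hn]
    · simp

theorem layout_update {ρ env : ℕ → ℕ} {d d' : ℕ} {s s' : State} {x v r : ℕ}
    (hρ : ∀ x, ρ x < d ∧ s.reg (ρ x) = env x) (hd : d ≤ d') (hr : r < d')
    (hs : ∀ j < d, s'.reg j = s.reg j) (hv : s'.reg r = v) (y : ℕ) :
    Function.update ρ x r y < d' ∧
      s'.reg (Function.update ρ x r y) = Function.update env x v y := by
  rcases eq_or_ne y x with rfl | h
  · simp [hr, hv]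
  · have := hρ y
    simp only [Function.update_of_ne h]
    exact ⟨by omega, by rw [hs _ this.1, this.2]⟩

theorem layout_mono {ρ env : ℕ → ℕ} {d d' : ℕ} {s s' : State}
    (hρ : ∀ x, ρ x < d ∧ s.reg (ρ x) = env x) (hd : d ≤ d')
    (hs : ∀ j < d, s'.reg j = s.reg j) (y : ℕ) : ρ y < d' ∧ s'.reg (ρ y) = env y :=
  ⟨(hρ y).1.trans_le hd, by rw [hs _ (hρ y).1, (hρ y).2]⟩

theorem sizeReg_lt {b : Bool} {d : ℕ} (hd : 3 < d) : sizeReg b < d := by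
  unfold sizeReg; split <;> omega

/-- Registers are used as a stack: nothing below `d` is written, so variables and loop lengths
survive the evaluation of subexpressions. The condition `3 < d` protects the registers 1 and 3,
which hold the loop lengths. -/
theorem Exp.compile_runs {sz : Bool → ℕ} (e : Exp) : ∀ (ρ env : ℕ → ℕ) (d : ℕ) (s : State),
    3 < d → (∀ x, ρ x < d ∧ s.reg (ρ x) = env x) → (∀ b, s.reg (sizeReg b) = sz b) →
    Runs (e.compile ρ d) s (e.cost sz) (fun s' => s'.reg d = e.eval sz s.mem env ∧
      s'.mem = s.mem ∧ ∀ j < d, s'.reg j = s.reg j) := by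
  induction e with
  | var x =>
    intro ρ env d s hd hρ hs
    refine Runs.move (hρ x).1.ne ⟨?_, rfl, ?_⟩
    · simp [eval, (hρ x).2]
    · intro j hj
      simp [hj.ne]
  | const c =>
    intro ρ env d s hd hρ hs
    refine Runs.const ⟨?_, rfl, ?_⟩
    · simp [eval]
    · intro j hj
      simp [hj.ne]
  | add e f he hf =>
    intro ρ env d s hd hρ hs
    refine Runs.mono (Runs.seq (he ρ env d s hd hρ hs) (T' := f.cost sz + 1) ?_)
      (by simp [cost]; omega) (fun _ h => h)
    rintro s₁ ⟨h1, h2, h3⟩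
    refine Runs.seq (hf ρ env (d + 1) s₁ (by omega) (layout_mono hρ (by omega) h3)
      (fun b => by rw [h3 _ (sizeReg_lt hd), hs])) ?_
    rintro s₂ ⟨g1, g2, g3⟩
    refine Runs.add ⟨?_, ?_, ?_⟩
    · simp [eval, g1, g3, h1, h2]
    · simp [g2, h2]
    · intro j hj
      simp [hj.ne, g3 j (by omega), h3 j hj]
  | sub e f he hf =>
    intro ρ env d s hd hρ hs
    refine Runs.mono (Runs.seq (he ρ env d s hd hρ hs) (T' := f.cost sz + 1) ?_)
      (by simp [cost]; omega) (fun _ h => h)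
    rintro s₁ ⟨h1, h2, h3⟩
    refine Runs.seq (hf ρ env (d + 1) s₁ (by omega) (layout_mono hρ (by omega) h3)
      (fun b => by rw [h3 _ (sizeReg_lt hd), hs])) ?_
    rintro s₂ ⟨g1, g2, g3⟩
    refine Runs.sub ⟨?_, ?_, ?_⟩
    · simp [eval, g1, g3, h1, h2]
    · simp [g2, h2]
    · intro j hj
      simp [hj.ne, g3 j (by omega), h3 j hj]
  | load e he =>
    intro ρ env d s hd hρ hs
    refine Runs.seq (he ρ env d s hd hρ hs) ?_
    rintro s₁ ⟨h1, h2, h3⟩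
    refine Runs.load ⟨?_, ?_, ?_⟩
    · simp [eval, h1, h2]
    · simp [h2]
    · intro j hj
      simp [hj.ne, h3 j hj]
  | cond c e f hc he hf =>
    intro ρ env d s hd hρ hs
    refine Runs.seq (hc ρ env d s hd hρ hs) ?_
    rintro s₁ ⟨h1, h2, h3⟩
    have hs₁ : ∀ b, s₁.reg (sizeReg b) = sz b := fun b => by rw [h3 _ (sizeReg_lt hd), hs]
    refine Runs.ite (fun hx => ?_) (fun hx => ?_)
    · refine Runs.mono (he ρ env d s₁ hd (layout_mono hρ le_rfl h3) hs₁) (by omega) ?_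
      rintro s₂ ⟨g1, g2, g3⟩
      rw [h1] at hx
      exact ⟨by simp [eval, g1, h2, hx], by rw [g2, h2], fun j hj => by rw [g3 j hj, h3 j hj]⟩
    · refine Runs.mono (hf ρ env d s₁ hd (layout_mono hρ le_rfl h3) hs₁) (by omega) ?_
      rintro s₂ ⟨g1, g2, g3⟩
      rw [h1] at hx
      exact ⟨by simp [eval, g1, h2, hx], by rw [g2, h2], fun j hj => by rw [g3 j hj, h3 j hj]⟩
  | bind x e f he hf =>
    intro ρ env d s hd hρ hs
    refine Runs.mono (Runs.seq (he ρ env d s hd hρ hs) (T' := f.cost sz + 2) ?_)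
      (by simp [cost]; omega) (fun _ h => h)
    rintro s₁ ⟨h1, h2, h3⟩
    refine Runs.seq (hf (Function.update ρ x d) _ (d + 1) s₁ (by omega)
      (layout_update (x := x) hρ (by omega) (by omega) h3 h1)
      (fun b => by rw [h3 _ (sizeReg_lt hd), hs])) ?_
    rintro s₂ ⟨g1, g2, g3⟩
    refine Runs.move (by omega) ⟨?_, ?_, ?_⟩
    · simp [eval, g1, h2]
    · simp [g2, h2]
    · intro j hj
      simp [hj.ne, g3 j (by omega), h3 j hj]
  | sum b x e he =>
    intro ρ env d s hd hρ hs
    refine Runs.mono (T := 1 + (sz b * ((e.cost sz + 1 + 1) + 3) + 5))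
      (Runs.seq (Q := fun s' => s' = _) (Runs.const rfl) ?_)
      (by simp [cost]; ring_nf; omega) (fun _ h => h)
    rintro _ rfl
    refine Runs.mono (runs_loopProg (n := sz b) (mm := fun _ => s.mem) (T := e.cost sz + 1 + 1)
      (acc := fun n => ∑ i ∈ Finset.range n, e.eval sz s.mem (Function.update env x i))
      (sizeReg_lt hd) ?_ ?_ ?_ ?_) le_rfl ?_
    · simp [(sizeReg_lt (b := b) hd).ne, hs]
    · simp
    · simp
    · intro i hi s₁ h1 h2 h3 h4
      have h1' : ∀ j < d, s₁.reg j = s.reg j := fun j hj => by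
        rw [h1 j hj]; simp [hj.ne]
      refine Runs.mono (Runs.seq (he (Function.update ρ x (d + 1)) _ (d + 4) s₁ (by omega)
        (layout_update (x := x) hρ (by omega) (by omega) h1' h3)
        (fun b => by rw [h1' _ (sizeReg_lt hd), hs])) (T' := 1) ?_) (by omega) (fun _ h => h)
      rintro s₂ ⟨g1, g2, g3⟩
      refine Runs.add ⟨?_, ?_, ?_⟩
      · intro j hj hj'
        simp [hj', g3 j hj]
      · simp [g1, g3, h2, h4, Finset.sum_range_succ]
      · simp [g2, h4]
    · rintro s' ⟨h1, h2, h3⟩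
      refine ⟨by simp [eval, h2], h3, fun j hj => ?_⟩
      rw [h1 j hj]; simp [hj.ne]
  | sup b x e he =>
    intro ρ env d s hd hρ hs
    refine Runs.mono (T := 1 + (sz b * ((e.cost sz + 1 + 1) + 3) + 5))
      (Runs.seq (Q := fun s' => s' = _) (Runs.const rfl) ?_)
      (by simp [cost]; ring_nf; omega) (fun _ h => h)
    rintro _ rfl
    refine Runs.mono (runs_loopProg (n := sz b) (mm := fun _ => s.mem) (T := e.cost sz + 1 + 1)
      (acc := fun n => (Finset.range n).sup fun i => e.eval sz s.mem (Function.update env x i))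
      (sizeReg_lt hd) ?_ ?_ ?_ ?_) le_rfl ?_
    · simp [(sizeReg_lt (b := b) hd).ne, hs]
    · simp
    · simp
    · intro i hi s₁ h1 h2 h3 h4
      have h1' : ∀ j < d, s₁.reg j = s.reg j := fun j hj => by
        rw [h1 j hj]; simp [hj.ne]
      refine Runs.mono (Runs.seq (he (Function.update ρ x (d + 1)) _ (d + 4) s₁ (by omega)
        (layout_update (x := x) hρ (by omega) (by omega) h1' h3)
        (fun b => by rw [h1' _ (sizeReg_lt hd), hs])) (T' := 1 + 1) ?_) (by omega) (fun _ h => h)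
      rintro s₂ ⟨g1, g2, g3⟩
      refine Runs.seq (Q := fun s' => s' = _) (Runs.sub rfl) ?_
      rintro _ rfl
      refine Runs.add ⟨?_, ?_, ?_⟩
      · intro j hj hj'
        simp [hj', g3 j hj, show j ≠ d + 4 by omega]
      -- With truncated subtraction, the maximum of the accumulator `x` and the new value `y` is `x
      -- + (y - x)`.
      · simp only [Finset.range_add_one, Finset.sup_insert]
        simp [g1, g3, h2, h4]
        omega
      · simp [g2, h4]
    · rintro s' ⟨h1, h2, h3⟩
      refine ⟨by simp [eval, h2], h3, fun j hj => ?_⟩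
      rw [h1 j hj]; simp [hj.ne]
  | iter b x y e f he hf =>
    intro ρ env d s hd hρ hs
    refine Runs.mono (T := e.cost sz + (sz b * ((f.cost sz + 2) + 3) + 5))
      (Runs.seq (he ρ env d s hd hρ hs) ?_) (by simp [cost]; ring_nf; omega) (fun _ h => h)
    rintro s₀ ⟨k1, k2, k3⟩
    refine Runs.mono (runs_loopProg (n := sz b) (mm := fun _ => s.mem) (T := f.cost sz + 2)
      (acc := fun n => Nat.rec (e.eval sz s.mem env)
        (fun i v => f.eval sz s.mem (Function.update (Function.update env x i) y v)) n)
      (sizeReg_lt hd) ?_ ?_ ?_ ?_) le_rfl ?_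
    · rw [k3 _ (sizeReg_lt hd), hs]
    · simp [k1]
    · simp [k2]
    · intro i hi s₁ h1 h2 h3 h4
      have h1' : ∀ j < d, s₁.reg j = s.reg j := fun j hj => by
        rw [h1 j hj, k3 j hj]
      refine Runs.seq (hf (Function.update (Function.update ρ x (d + 1)) y d) _ (d + 4) s₁
        (by omega) (layout_update (x := y) (d := d + 4) (s := s₁)
          (layout_update (x := x) hρ (by omega) (by omega) h1' h3) (by omega) (by omega)
          (fun _ _ => rfl) h2) (fun b => by rw [h1' _ (sizeReg_lt hd), hs])) ?_
      rintro s₂ ⟨g1, g2, g3⟩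
      refine Runs.move (by omega) ⟨?_, ?_, ?_⟩
      · intro j hj hj'
        simp [hj', g3 j hj]
      · simp [g1, h4]
      · simp [g2, h4]
    · rintro s' ⟨h1, h2, h3⟩
      refine ⟨by simp [eval, h2], h3, fun j hj => ?_⟩
      rw [h1 j hj, k3 j hj]

theorem Cmd.compile_runs {sz : Bool → ℕ} (c : Cmd) : ∀ (ρ env : ℕ → ℕ) (d : ℕ) (s : State),
    3 < d → (∀ x, ρ x < d ∧ s.reg (ρ x) = env x) → (∀ b, s.reg (sizeReg b) = sz b) →
    Runs (c.compile ρ d) s (c.cost sz) (fun s' => s'.mem = c.run sz env s.mem ∧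
      ∀ j < d, s'.reg j = s.reg j) := by
  induction c with
  | store e f =>
    intro ρ env d s hd hρ hs
    refine Runs.mono (Runs.seq (e.compile_runs ρ env d s hd hρ hs) (T' := f.cost sz + 1) ?_)
      (by simp [cost]; omega) (fun _ h => h)
    rintro s₁ ⟨h1, h2, h3⟩
    refine Runs.seq (f.compile_runs ρ env (d + 1) s₁ (by omega) (layout_mono hρ (by omega) h3)
      (fun b => by rw [h3 _ (sizeReg_lt hd), hs])) ?_
    rintro s₂ ⟨g1, g2, g3⟩
    refine Runs.store ⟨?_, ?_⟩
    · simp [run, g1, g2, g3, h1, h2]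
    · intro j hj
      simp [g3 j (by omega), h3 j hj]
  | seq c c' hc hc' =>
    intro ρ env d s hd hρ hs
    refine Runs.seq (hc ρ env d s hd hρ hs) ?_
    rintro s₁ ⟨h2, h3⟩
    refine Runs.mono (hc' ρ env d s₁ hd (layout_mono hρ le_rfl h3)
      (fun b => by rw [h3 _ (sizeReg_lt hd), hs])) le_rfl ?_
    rintro s₂ ⟨g2, g3⟩
    exact ⟨by rw [g2, h2, run], fun j hj => by rw [g3 j hj, h3 j hj]⟩
  | guard e c hc =>
    intro ρ env d s hd hρ hs
    refine Runs.seq (e.compile_runs ρ env d s hd hρ hs) ?_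
    rintro s₁ ⟨h1, h2, h3⟩
    refine Runs.ite (T := c.cost sz + 1) (fun hx => ?_) (fun hx => ?_)
    · refine Runs.mono (hc ρ env d s₁ hd (layout_mono hρ le_rfl h3)
        (fun b => by rw [h3 _ (sizeReg_lt hd), hs])) (by omega) ?_
      rintro s₂ ⟨g2, g3⟩
      rw [h1] at hx
      exact ⟨by simp [run, g2, h2, hx], fun j hj => by rw [g3 j hj, h3 j hj]⟩
    · rw [h1] at hx
      refine Runs.mono (T := 1) (Runs.const (Q := fun s' => s'.mem = _ ∧ _) ⟨?_, ?_⟩) (by omega)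
        (fun _ h => h)
      · simp [run, h2, hx]
      · intro j hj
        simp [hj.ne, h3 j hj]
  | bind x e c hc =>
    intro ρ env d s hd hρ hs
    refine Runs.seq (e.compile_runs ρ env d s hd hρ hs) ?_
    rintro s₁ ⟨h1, h2, h3⟩
    refine Runs.mono (hc (Function.update ρ x d) _ (d + 1) s₁ (by omega)
      (layout_update (x := x) hρ (by omega) (by omega) h3 h1)
      (fun b => by rw [h3 _ (sizeReg_lt hd), hs])) le_rfl ?_
    rintro s₂ ⟨g2, g3⟩
    exact ⟨by rw [g2, h2, run], fun j hj => by rw [g3 j (by omega), h3 j hj]⟩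
  | loop b x c hc =>
    intro ρ env d s hd hρ hs
    refine Runs.mono (T := 1 + (sz b * (c.cost sz + 3) + 5)) (Runs.seq (Q := fun s' => s' = _)
      (Runs.const rfl) ?_) (by simp [cost]; omega) (fun _ h => h)
    rintro _ rfl
    refine Runs.mono (runs_loopProg (n := sz b) (acc := fun _ => 0) (T := c.cost sz)
      (mm := fun n => Nat.rec s.mem (fun i mem' => c.run sz (Function.update env x i) mem') n)
      (sizeReg_lt hd) ?_ ?_ ?_ ?_) le_rfl ?_
    · simp [(sizeReg_lt (b := b) hd).ne, hs]
    · simp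
    · simp
    · intro i hi s₁ h1 h2 h3 h4
      have h1' : ∀ j < d, s₁.reg j = s.reg j := fun j hj => by
        rw [h1 j hj]; simp [hj.ne]
      refine Runs.mono (hc (Function.update ρ x (d + 1)) _ (d + 4) s₁ (by omega)
        (layout_update (x := x) hρ (by omega) (by omega) h1' h3)
        (fun b => by rw [h1' _ (sizeReg_lt hd), hs])) le_rfl ?_
      rintro s₂ ⟨g2, g3⟩
      exact ⟨fun j hj _ => g3 j hj, by rw [g3 d (by omega), h2], by rw [g2, h4]⟩
    · rintro s' ⟨h1, h2, h3⟩
      refine ⟨by simp [run, h3], fun j hj => ?_⟩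
      rw [h1 j hj]; simp [hj.ne]

/-! ## Polynomial bounds for the running time -/

/-- The nesting depth of loops with tag `b`. -/
def Exp.deg (b : Bool) : Exp → ℕ
  | .var _ => 0
  | .const _ => 0
  | .add e f => max (e.deg b) (f.deg b)
  | .sub e f => max (e.deg b) (f.deg b)
  | .load e => e.deg b
  | .cond c e f => max (c.deg b) (max (e.deg b) (f.deg b))
  | .bind _ e f => max (e.deg b) (f.deg b)
  | .sum b' _ e => e.deg b + if b' = b then 1 else 0
  | .sup b' _ e => e.deg b + if b' = b then 1 else 0
  | .iter b' _ _ e f => max (e.deg b) (f.deg b + if b' = b then 1 else 0)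

/-- The nesting depth of loops with tag `b`. -/
def Cmd.deg (b : Bool) : Cmd → ℕ
  | .store e f => max (e.deg b) (f.deg b)
  | .seq c d => max (c.deg b) (d.deg b)
  | .guard e c => max (e.deg b) (c.deg b)
  | .bind _ e c => max (e.deg b) (c.deg b)
  | .loop b' _ c => c.deg b + if b' = b then 1 else 0

/-- `f` grows at most like `N ^ i * M ^ j` in the lengths `N` and `M` of the loops. -/
def PolyBound (f : (Bool → ℕ) → ℕ) (i j : ℕ) : Prop :=
  ∃ C : ℕ, ∀ sz : Bool → ℕ, (∀ b, 1 ≤ sz b) → f sz ≤ C * (sz true ^ i * sz false ^ j)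

theorem PolyBound.const (c : ℕ) (i j : ℕ) : PolyBound (fun _ => c) i j :=
  ⟨c, fun sz h => Nat.le_mul_of_pos_right _ (by have := h true; have := h false; positivity)⟩

theorem PolyBound.add {f g : (Bool → ℕ) → ℕ} {i j : ℕ} (hf : PolyBound f i j)
    (hg : PolyBound g i j) : PolyBound (fun sz => f sz + g sz) i j := by
  obtain ⟨C, hC⟩ := hf
  obtain ⟨D, hD⟩ := hg
  exact ⟨C + D, fun sz h => by rw [add_mul]; exact add_le_add (hC sz h) (hD sz h)⟩

/-- Lower powers are absorbed because loop lengths are at least 1, which is why `PolyBound`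
quantifies only over such lengths. -/
theorem PolyBound.mono {f : (Bool → ℕ) → ℕ} {i j i' j' : ℕ} (hf : PolyBound f i j) (hi : i ≤ i')
    (hj : j ≤ j') : PolyBound f i' j' := by
  obtain ⟨C, hC⟩ := hf
  exact ⟨C, fun sz h => (hC sz h).trans (Nat.mul_le_mul_left _
    (Nat.mul_le_mul (Nat.pow_le_pow_right (h _) hi) (Nat.pow_le_pow_right (h _) hj)))⟩

theorem PolyBound.mul {f : (Bool → ℕ) → ℕ} {i j : ℕ} (hf : PolyBound f i j) (b : Bool) :
    PolyBound (fun sz => sz b * f sz) (i + if b = true then 1 else 0)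
      (j + if b = false then 1 else 0) := by
  obtain ⟨C, hC⟩ := hf
  refine ⟨C, fun sz h => (Nat.mul_le_mul_left _ (hC sz h)).trans (le_of_eq ?_)⟩
  cases b <;> simp <;> ring

/-- Costs add up under every construct except loops, which multiply by one loop length. A bound
value is evaluated once, so loops in it are not nested with those of the expression that uses it. -/
theorem Exp.polyBound_cost (e : Exp) :
    PolyBound (fun sz => e.cost sz) (e.deg true) (e.deg false) := by
  induction e with
  | var x => exact .const _ _ _
  | const c => exact .const _ _ _
  | add e f he hf =>
    exact ((he.mono (le_max_left _ _) (le_max_left _ _)).add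
      (hf.mono (le_max_right _ _) (le_max_right _ _))).add (.const _ _ _)
  | sub e f he hf =>
    exact ((he.mono (le_max_left _ _) (le_max_left _ _)).add
      (hf.mono (le_max_right _ _) (le_max_right _ _))).add (.const _ _ _)
  | load e he => exact he.add (.const _ _ _)
  | cond c e f hc he hf =>
    exact (hc.mono (by simp [deg]) (by simp [deg])).add
      (((he.mono (by simp [deg]) (by simp [deg])).add
        (hf.mono (by simp [deg]) (by simp [deg]))).add (.const _ _ _))
  | bind x e f he hf =>
    exact ((he.mono (le_max_left _ _) (le_max_left _ _)).add
      (hf.mono (le_max_right _ _) (le_max_right _ _))).add (.const _ _ _)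
  | sum b x e he => exact ((he.add (.const _ _ _)).mul b).add (.const _ _ _)
  | sup b x e he => exact ((he.add (.const _ _ _)).mul b).add (.const _ _ _)
  | iter b x y e f he hf =>
    exact ((he.mono (le_max_left _ _) (le_max_left _ _)).add
      (((hf.add (.const _ _ _)).mul b).mono (le_max_right _ _) (le_max_right _ _))).add
        (.const _ _ _)

theorem Cmd.polyBound_cost (c : Cmd) :
    PolyBound (fun sz => c.cost sz) (c.deg true) (c.deg false) := by
  induction c with
  | store e f =>
    exact ((e.polyBound_cost.mono (le_max_left _ _) (le_max_left _ _)).add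
      (f.polyBound_cost.mono (le_max_right _ _) (le_max_right _ _))).add (.const _ _ _)
  | seq c d hc hd =>
    exact (hc.mono (le_max_left _ _) (le_max_left _ _)).add
      (hd.mono (le_max_right _ _) (le_max_right _ _))
  | guard e c hc =>
    exact (e.polyBound_cost.mono (le_max_left _ _) (le_max_left _ _)).add
      ((hc.mono (le_max_right _ _) (le_max_right _ _)).add (.const _ _ _))
  | bind x e c hc =>
    exact (e.polyBound_cost.mono (le_max_left _ _) (le_max_left _ _)).add
      (hc.mono (le_max_right _ _) (le_max_right _ _))
  | loop b x c hc => exact ((hc.add (.const _ _ _)).mul b).add (.const _ _ _)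

end RAM

/-! ## Recovering a single-crossing order -/

section Orders

variable {V ι : Type*} (fam : V → ι → Prop)

/-- Two ordered pairs of points are linked if they share a component, and some member of the family
contains both of the other components but not the common one. A linear order in which the members
of the family are intervals contains both of the pairs or none of them. -/
def Linked (p q : V × V) : Prop :=
  ∃ a, (p.1 = q.1 ∧ fam p.2 a ∧ fam q.2 a ∧ ¬ fam p.1 a) ∨
    (p.2 = q.2 ∧ fam p.1 a ∧ fam q.1 a ∧ ¬ fam p.2 a)

variable {fam}

theorem Linked.symm {p q : V × V} (h : Linked fam p q) : Linked fam q p := by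
  obtain ⟨a, ⟨h1, h2, h3, h4⟩ | ⟨h1, h2, h3, h4⟩⟩ := h
  · exact ⟨a, .inl ⟨h1.symm, h3, h2, h1 ▸ h4⟩⟩
  · exact ⟨a, .inr ⟨h1.symm, h3, h2, h1 ▸ h4⟩⟩

theorem Linked.swap {p q : V × V} (h : Linked fam p q) : Linked fam p.swap q.swap := by
  obtain ⟨a, h | h⟩ := h
  · exact ⟨a, .inr h⟩
  · exact ⟨a, .inl h⟩

/-- The equivalence relation generated by `Linked`. -/
abbrev LinkedStar (fam : V → ι → Prop) : V × V → V × V → Prop :=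
  Relation.ReflTransGen (Linked fam)

theorem LinkedStar.symm {p q : V × V} (h : LinkedStar fam p q) : LinkedStar fam q p := by
  induction h with
  | refl => exact .refl
  | tail _ h ih => exact ih.head h.symm

theorem LinkedStar.swap {p q : V × V} (h : LinkedStar fam p q) :
    LinkedStar fam p.swap q.swap :=
  h.lift Prod.swap fun _ _ => Linked.swap

/-- If `r` ordered two linked pairs differently, their common component would lie between the other
two components, and the member containing those two would contain it as well. -/
theorem LinkedStar.rel_iff {r : V → V → Prop} [IsStrictTotalOrder V r]
    (hr : ∀ a u v w, r u v → r v w → fam u a → fam w a → fam v a) {p q : V × V}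
    (h : LinkedStar fam p q) : r p.1 p.2 ↔ r q.1 q.2 := by
  have key : ∀ p q : V × V, Linked fam p q → r p.1 p.2 → r q.1 q.2 := by
    rintro ⟨u, v⟩ ⟨u', v'⟩ ⟨a, ⟨h1, h2, h3, h4⟩ | ⟨h1, h2, h3, h4⟩⟩ huv
    · obtain rfl : u = u' := h1
      rcases trichotomous_of r u v' with h | h | h
      · exact h
      · exact absurd (show fam u a from h ▸ h3) h4
      · exact absurd (hr a v' u v h huv h3 h2) h4
    · obtain rfl : v = v' := h1
      rcases trichotomous_of r u' v with h | h | h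
      · exact h
      · exact absurd (show fam v a from h ▸ h3) h4
      · exact absurd (hr a u v u' huv h h2 h3) h4
  induction h with
  | refl => rfl
  | tail _ h ih => exact ih.trans ⟨key _ _ h, key _ _ h.symm⟩

/-- `lab` labels every ordered pair with the maximal code of a pair in its class. -/
structure IsClassMax (fam : V → ι → Prop) (code lab : V × V → ℕ) : Prop where
  exists_eq : ∀ p, ∃ q, LinkedStar fam p q ∧ lab p = code q
  le : ∀ p q, LinkedStar fam p q → code q ≤ lab p

variable {code lab : V × V → ℕ}

theorem IsClassMax.congr (hl : IsClassMax fam code lab) {p q : V × V} (h : LinkedStar fam p q) :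
    lab p = lab q := by
  have key : ∀ p q, LinkedStar fam p q → lab p ≤ lab q := fun p q h => by
    obtain ⟨p', h1, h2⟩ := hl.exists_eq p
    rw [h2]
    exact hl.le _ _ (h.symm.trans h1)
  exact le_antisymm (key _ _ h) (key _ _ h.symm)

/-- The order determined by a labelling. -/
def LabLT (lab : V × V → ℕ) (u v : V) : Prop := lab (v, u) < lab (u, v)

theorem IsClassMax.labLT_congr (hl : IsClassMax fam code lab) {p q : V × V}
    (h : LinkedStar fam p q) : LabLT lab p.1 p.2 ↔ LabLT lab q.1 q.2 := by
  have h1 := hl.congr h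
  have h2 := hl.congr h.swap
  simp only [LabLT, Prod.swap] at *
  rw [h1, h2]

/-- Equal labels for a pair and its reversal would, by injectivity of `code`, put both in one class,
which the order `r` excludes. -/
theorem IsClassMax.labLT_total (hl : IsClassMax fam code lab) (hinj : Function.Injective code)
    {r : V → V → Prop} [IsStrictTotalOrder V r]
    (hr : ∀ a u v w, r u v → r v w → fam u a → fam w a → fam v a) {u v : V} (huv : u ≠ v) :
    LabLT lab u v ∨ LabLT lab v u := by
  rcases lt_trichotomy (lab (v, u)) (lab (u, v)) with h | h | h
  · exact .inl h
  · exfalso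
    obtain ⟨q, h1, h2⟩ := hl.exists_eq (v, u)
    obtain ⟨q', h3, h4⟩ := hl.exists_eq (u, v)
    obtain rfl : q = q' := hinj (by rw [← h2, ← h4, h])
    have h5 : r v u ↔ r u v := LinkedStar.rel_iff hr (h1.trans h3.symm)
    rcases trichotomous_of r u v with h | h | h
    · exact asymm h (h5.2 h)
    · exact huv h
    · exact asymm h (h5.1 h)
  · exact .inr h

/-- Let one link move the side `p` of the directed triangle, with witness `a` missing the fixed
vertex. If `a` contained `u`, it would link `p` to a side at `u` taken in the wrong direction. So
`a` misses `u`, and the same `a` links the side of the triangle that moves along. -/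
theorem IsClassMax.move (hl : IsClassMax fam code lab) {u v w : V} (huv : LabLT lab u v)
    (hvw : LabLT lab v w) (hwu : LabLT lab w u) {q : V × V} (h : LinkedStar fam (v, w) q) :
    LinkedStar fam (u, v) (u, q.1) ∧ LinkedStar fam (w, u) (q.2, u) := by
  induction h with
  | refl => exact ⟨.refl, .refl⟩
  | @tail p q hp hpq ih =>
    have h1 : LabLT lab u p.1 := (hl.labLT_congr ih.1).1 huv
    have h2 : LabLT lab p.1 p.2 := (hl.labLT_congr hp).1 hvw
    have h3 : LabLT lab p.2 u := (hl.labLT_congr ih.2).1 hwu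
    obtain ⟨a, ⟨g1, g2, g3, g4⟩ | ⟨g1, g2, g3, g4⟩⟩ := hpq
    · refine ⟨by rw [← g1]; exact ih.1, ih.2.tail ⟨a, .inr ⟨rfl, g2, g3, fun hu => ?_⟩⟩⟩
      have : LabLT lab p.1 u := (hl.labLT_congr (p := (p.1, p.2)) (q := (p.1, u))
        (.single ⟨a, .inl ⟨rfl, g2, hu, g4⟩⟩)).1 h2
      exact lt_asymm this h1
    · refine ⟨ih.1.tail ⟨a, .inl ⟨rfl, g2, g3, fun hu => ?_⟩⟩, by rw [← g1]; exact ih.2⟩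
      have : LabLT lab u p.2 := (hl.labLT_congr (p := (p.1, p.2)) (q := (u, p.2))
        (.single ⟨a, .inr ⟨rfl, g2, hu, g4⟩⟩)).1 h2
      exact lt_asymm this h3

/-- The class of `(u, v)` was preferred to its reversal, so its largest code also bounds the codes
of the reversed pairs. The first component of the pair with this code therefore bounds both
components of all members. -/
theorem IsClassMax.exists_max [LinearOrder V] (hl : IsClassMax fam code lab)
    (hcode : ∀ p q, code q ≤ code p → q.1 ≤ p.1) {u v : V} (huv : LabLT lab u v) :
    ∃ p, LinkedStar fam (u, v) p ∧ ∀ q, LinkedStar fam (u, v) q → q.1 ≤ p.1 ∧ q.2 ≤ p.1 := by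
  obtain ⟨p, h1, h2⟩ := hl.exists_eq (u, v)
  refine ⟨p, h1, fun q hq => ⟨hcode _ _ (h2 ▸ hl.le _ _ hq), hcode p q.swap ?_⟩⟩
  exact (hl.le (v, u) _ hq.swap).trans (h2 ▸ huv.le)

/-- Moving the sides to the largest members of their classes puts each of the three extremal first
components into a neighbouring class, so these components bound each other cyclically and coincide.
-/
theorem IsClassMax.not_cyclic [LinearOrder V] (hl : IsClassMax fam code lab)
    (hcode : ∀ p q, code q ≤ code p → q.1 ≤ p.1) {u v w : V} (huv : LabLT lab u v)
    (hvw : LabLT lab v w) (hwu : LabLT lab w u) : False := by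
  obtain ⟨⟨p₁, q₁⟩, h1, m1⟩ := hl.exists_max hcode huv
  obtain ⟨⟨p₂, q₂⟩, h2, m2⟩ := hl.exists_max hcode hvw
  obtain ⟨⟨p₃, q₃⟩, h3, m3⟩ := hl.exists_max hcode hwu
  have a1 := hl.move hwu huv hvw h1
  have a2 := hl.move huv hvw hwu h2
  have a3 := hl.move hvw hwu huv h3
  have l1 : p₁ ≤ p₃ := (m3 _ a1.1).2
  have l2 : p₂ ≤ p₁ := (m1 _ a2.1).2
  have l3 : p₃ ≤ p₂ := (m2 _ a3.1).2
  obtain rfl : p₁ = p₃ := le_antisymm l1 (l3.trans l2)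
  have k1 : LabLT lab p₁ q₁ := (hl.labLT_congr h1).1 huv
  have k2 : LabLT lab q₁ w := (hl.labLT_congr a1.2).1 hvw
  have k3 : LabLT lab w p₁ := (hl.labLT_congr a1.1).1 hwu
  -- The class of `(w, p₁)` contains `(p₁, q₃)`. Moving that side of the triangle `q₁, w, p₁` there
  -- turns `(q₁, w)` into `(q₁, p₁)`, the reversal of another side.
  have b := (hl.move k2 k3 k1 (a1.1.symm.trans h3)).1
  exact lt_asymm k1 ((hl.labLT_congr b).1 k2)

theorem IsClassMax.labLT_trans [LinearOrder V] (hl : IsClassMax fam code lab)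
    (hinj : Function.Injective code) (hcode : ∀ p q, code q ≤ code p → q.1 ≤ p.1)
    {r : V → V → Prop} [IsStrictTotalOrder V r]
    (hr : ∀ a u v w, r u v → r v w → fam u a → fam w a → fam v a) {u v w : V}
    (huv : LabLT lab u v) (hvw : LabLT lab v w) : LabLT lab u w := by
  rcases eq_or_ne u w with rfl | h
  · exact absurd hvw (lt_asymm huv)
  · rcases hl.labLT_total hinj hr h with h | h
    · exact h
    · exact (hl.not_cyclic hcode huv hvw h).elim

/-- Otherwise `(v, w)` and `(v, u)` are linked, hence equally oriented. -/
theorem IsClassMax.labLT_between (hl : IsClassMax fam code lab) {a : ι} {u v w : V}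
    (huv : LabLT lab u v) (hvw : LabLT lab v w) (hu : fam u a) (hw : fam w a) : fam v a := by
  by_contra hv
  exact lt_asymm huv ((hl.labLT_congr (p := (v, w)) (q := (v, u))
    (.single ⟨a, .inl ⟨rfl, hw, hu, hv⟩⟩)).1 hvw)

end Orders

/-! ### Positions in a finite strict linear order -/

section Rank

variable {V : Type*} [Fintype V] (T : V → V → Prop) [DecidableRel T]

/-- The number of predecessors of an element. -/
def rankOf (u : V) : ℕ := (Finset.univ.filter fun v => T v u).card

variable {T}

theorem rankOf_lt_rankOf (htrans : ∀ u v w, T u v → T v w → T u w) (hirr : ∀ u, ¬ T u u) {u v : V}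
    (h : T u v) : rankOf T u < rankOf T v := by
  refine Finset.card_lt_card (Finset.ssubset_iff_of_subset ?_ |>.2 ⟨u, ?_, ?_⟩)
  · intro w hw
    simp only [Finset.mem_filter, Finset.mem_univ, true_and] at hw ⊢
    exact htrans _ _ _ hw h
  · simpa using h
  · simpa using hirr u

theorem lt_of_rankOf_lt (htrans : ∀ u v w, T u v → T v w → T u w) (hirr : ∀ u, ¬ T u u)
    (htot : ∀ u v, u ≠ v → T u v ∨ T v u) {u v : V} (h : rankOf T u < rankOf T v) : T u v := by
  rcases eq_or_ne u v with rfl | huv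
  · exact absurd h (lt_irrefl _)
  · exact (htot u v huv).resolve_right fun h' =>
      lt_asymm h (rankOf_lt_rankOf htrans hirr h')

theorem rankOf_injective (htrans : ∀ u v w, T u v → T v w → T u w) (hirr : ∀ u, ¬ T u u)
    (htot : ∀ u v, u ≠ v → T u v ∨ T v u) : Function.Injective (rankOf T) := by
  intro u v h
  by_contra huv
  rcases htot u v huv with h' | h'
  · exact (rankOf_lt_rankOf htrans hirr h').ne h
  · exact (rankOf_lt_rankOf htrans hirr h').ne' h

theorem rankOf_lt_card (hirr : ∀ u, ¬ T u u) (u : V) : rankOf T u < Fintype.card V :=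
  Finset.card_lt_card (Finset.ssubset_iff_of_subset (Finset.subset_univ _) |>.2
    ⟨u, Finset.mem_univ _, by simpa using hirr u⟩)

theorem exists_rankOf_eq (htrans : ∀ u v w, T u v → T v w → T u w) (hirr : ∀ u, ¬ T u u)
    (htot : ∀ u v, u ≠ v → T u v ∨ T v u) {p : ℕ} (hp : p < Fintype.card V) :
    ∃ u, rankOf T u = p := by
  have h : Finset.univ.image (rankOf T) = Finset.range (Fintype.card V) := by
    refine Finset.eq_of_subset_of_card_le (fun x hx => ?_) ?_
    · obtain ⟨u, -, rfl⟩ := Finset.mem_image.1 hx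
      exact Finset.mem_range.2 (rankOf_lt_card hirr u)
    · rw [Finset.card_image_of_injective _ (rankOf_injective htrans hirr htot)]
      simp
  have := h.ge (Finset.mem_range.2 hp)
  simpa using this

end Rank

/-! ## Computing the labels by propagation -/

section Propagation

variable {α : Type*} {R : α → α → Prop} {code : α → ℕ} {L : ℕ → α → ℕ}

theorem propagate_eq (h0 : ∀ x, L 0 x = code x)
    (hex : ∀ i x, ∃ y, (y = x ∨ R x y) ∧ L (i + 1) x = L i y) (i : ℕ) :
    ∀ x, ∃ y, Relation.ReflTransGen R x y ∧ L i x = code y := by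
  induction i with
  | zero => exact fun x => ⟨x, .refl, h0 x⟩
  | succ i ih =>
    intro x
    obtain ⟨y, hy, hy'⟩ := hex i x
    obtain ⟨z, hz, hz'⟩ := ih y
    refine ⟨z, ?_, hy'.trans hz'⟩
    rcases hy with rfl | hy
    · exact hz
    · exact hz.head hy

/-- A code travels one edge per round, and a path in the graph of `R` has fewer edges than `α` has
elements. -/
theorem propagate_le [Fintype α] (h0 : ∀ x, L 0 x = code x) (hR : ∀ x y, R x y → R y x)
    (hmono : ∀ i x, L i x ≤ L (i + 1) x) (hle : ∀ i x y, R x y → L i y ≤ L (i + 1) x)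
    {x y : α} (h : Relation.ReflTransGen R x y) {i : ℕ} (hi : Fintype.card α ≤ i) :
    code y ≤ L i x := by
  classical
  set G := SimpleGraph.fromRel R with hG
  have hreach : G.Reachable x y := by
    induction h with
    | refl => exact .rfl
    | @tail y z _ hyz ih =>
      rcases eq_or_ne y z with rfl | hne
      · exact ih
      · exact ih.trans (SimpleGraph.Adj.reachable
          ((SimpleGraph.fromRel_adj _ _ _).2 ⟨hne, .inl hyz⟩))
  have hwalk : ∀ x y : α, ∀ w : G.Walk x y, code y ≤ L w.length x := by
    intro x y w
    induction w with
    | nil => exact (h0 _).ge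
    | @cons x y z hxy w ih =>
      refine ih.trans (hle _ _ _ ?_)
      rcases ((SimpleGraph.fromRel_adj _ _ _).1 hxy).2 with h | h
      · exact h
      · exact hR _ _ h
  obtain ⟨w, hw⟩ := hreach.exists_isPath
  have hmon : Monotone fun i => L i x := monotone_nat_of_le_succ fun i => hmono i x
  exact (hwalk x y w).trans (hmon (hw.length_lt.le.trans hi))

end Propagation

/-! ## Partial assignments as schedules

Alternatives are regarded as jobs, and voters, listed in a single-crossing order, as time slots. -/

section Schedules

/-- The number of slots of the job `a` in the schedule `A`, a set of pairs of a job and a slot. -/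
def jobLoad (A : Finset (ℕ × ℕ)) (a : ℕ) : ℕ := (A.filter fun x => x.1 = a).card

/-- The number of jobs with at least `θ` slots, and at least one. -/
def jobCount (A : Finset (ℕ × ℕ)) (θ : ℕ) : ℕ :=
  ((A.image Prod.fst).filter fun a => θ ≤ jobLoad A a).card

@[simp] theorem jobCount_empty (θ : ℕ) : jobCount ∅ θ = 0 := by simp [jobCount]

theorem jobLoad_union {A B : Finset (ℕ × ℕ)} (h : ∀ x ∈ A, ∀ y ∈ B, x.1 ≠ y.1) (a : ℕ) :
    jobLoad (A ∪ B) a = jobLoad A a + jobLoad B a := by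
  unfold jobLoad
  rw [Finset.filter_union, Finset.card_union_of_disjoint]
  refine Finset.disjoint_left.2 fun x hx hy => ?_
  exact h x (Finset.mem_filter.1 hx).1 x (Finset.mem_filter.1 hy).1 rfl

theorem jobLoad_eq_zero {A : Finset (ℕ × ℕ)} {a : ℕ} (h : ∀ x ∈ A, x.1 ≠ a) : jobLoad A a = 0 := by
  simpa [jobLoad, Finset.filter_eq_empty_iff] using h

theorem jobCount_union {A B : Finset (ℕ × ℕ)} (h : ∀ x ∈ A, ∀ y ∈ B, x.1 ≠ y.1) (θ : ℕ) :
    jobCount (A ∪ B) θ = jobCount A θ + jobCount B θ := by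
  unfold jobCount
  rw [Finset.image_union, Finset.filter_union, Finset.card_union_of_disjoint]
  · congr 2
    · refine Finset.filter_congr fun a ha => ?_
      obtain ⟨x, hx, rfl⟩ := Finset.mem_image.1 ha
      rw [jobLoad_union h, jobLoad_eq_zero (A := B) fun y hy => (h x hx y hy).symm, add_zero]
    · refine Finset.filter_congr fun a ha => ?_
      obtain ⟨x, hx, rfl⟩ := Finset.mem_image.1 ha
      rw [jobLoad_union h, jobLoad_eq_zero (A := A) fun y hy => h y hy x hx, zero_add]
  · refine Finset.disjoint_left.2 fun a ha hb => ?_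
    obtain ⟨x, hx, rfl⟩ := Finset.mem_image.1 (Finset.mem_filter.1 ha).1
    obtain ⟨y, hy, hxy⟩ := Finset.mem_image.1 (Finset.mem_filter.1 hb).1
    exact h x hx y hy hxy.symm

theorem jobCount_single {A : Finset (ℕ × ℕ)} {a : ℕ} (h : ∀ x ∈ A, x.1 = a) (hA : A.Nonempty)
    (θ : ℕ) : jobCount A θ = if θ ≤ A.card then 1 else 0 := by
  have h1 : A.image Prod.fst = {a} := by
    ext b
    simp only [Finset.mem_image, Finset.mem_singleton]
    constructor
    · rintro ⟨x, hx, rfl⟩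
      exact h x hx
    · rintro rfl
      obtain ⟨x, hx⟩ := hA
      exact ⟨x, hx, h x hx⟩
  have h2 : jobLoad A a = A.card := by
    unfold jobLoad
    rw [Finset.filter_true_of_mem h]
  unfold jobCount
  rw [h1, Finset.filter_singleton, h2]
  split <;> simp

variable (q : ℕ) (app : ℕ → ℕ → Prop)

/-- `A` schedules jobs from `J` that are released at `s` or later in slots before `t`, at most
`κ` of them, each in at most `q + 1` slots and at most `μ` of them in `q + 1` slots. -/
structure IsSchedule (J : ℕ → Prop) (s t κ μ : ℕ) (A : Finset (ℕ × ℕ)) : Prop where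
  inj : ∀ x ∈ A, ∀ y ∈ A, x.2 = y.2 → x = y
  appr : ∀ x ∈ A, app x.1 x.2
  job : ∀ x ∈ A, J x.1
  lt : ∀ x ∈ A, x.2 < t
  rel : ∀ x ∈ A, ∀ p < s, ¬ app x.1 p
  count_one : jobCount A 1 ≤ κ
  count_long : jobCount A (q + 1) ≤ μ
  count_over : jobCount A (q + 2) = 0

variable {q app} {J : ℕ → Prop} {s t κ μ : ℕ} {A : Finset (ℕ × ℕ)}

theorem IsSchedule.empty : IsSchedule q app J s t κ μ ∅ := by
  constructor <;> simp

theorem IsSchedule.le (h : IsSchedule q app J s t κ μ A) {x : ℕ × ℕ} (hx : x ∈ A) : s ≤ x.2 := by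
  by_contra hlt
  exact h.rel x hx x.2 (by omega) (h.appr x hx)

theorem IsSchedule.mono {κ' μ' : ℕ} {J' : ℕ → Prop} (h : IsSchedule q app J s t κ μ A)
    (hJ : ∀ x ∈ A, J' x.1) (hκ : jobCount A 1 ≤ κ') (hμ : jobCount A (q + 1) ≤ μ') :
    IsSchedule q app J' s t κ' μ' A :=
  ⟨h.inj, h.appr, hJ, h.lt, h.rel, hκ, hμ, h.count_over⟩

/-- Jobs of `B` are released after `p`, while jobs of `A` run before `p`. So no job occurs in both,
and the job counts add. -/
theorem IsSchedule.union {p κ₁ κ₂ μ₁ μ₂ : ℕ} {B : Finset (ℕ × ℕ)}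
    (hA : IsSchedule q app J s p κ₁ μ₁ A) (hB : IsSchedule q app J (p + 1) t κ₂ μ₂ B)
    (hs : s ≤ p) (ht : p < t) (hκ : κ₁ + κ₂ ≤ κ) (hμ : μ₁ + μ₂ ≤ μ) :
    IsSchedule q app J s t κ μ (A ∪ B) ∧ Disjoint A B := by
  have hne : ∀ x ∈ A, ∀ y ∈ B, x.1 ≠ y.1 := fun x hx y hy hxy =>
    hB.rel y hy x.2 (by have := hA.lt x hx; omega) (hxy ▸ hA.appr x hx)
  refine ⟨⟨?_, ?_, ?_, ?_, ?_, ?_, ?_, ?_⟩,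
    Finset.disjoint_left.2 fun x hx hy => hne x hx x hy rfl⟩
  · intro x hx y hy hxy
    rcases Finset.mem_union.1 hx with hx | hx <;> rcases Finset.mem_union.1 hy with hy | hy
    · exact hA.inj x hx y hy hxy
    · have := hA.lt x hx; have := hB.le hy; omega
    · have := hB.le hx; have := hA.lt y hy; omega
    · exact hB.inj x hx y hy hxy
  · intro x hx
    exact (Finset.mem_union.1 hx).elim (hA.appr x) (hB.appr x)
  · intro x hx
    exact (Finset.mem_union.1 hx).elim (hA.job x) (hB.job x)
  · intro x hx
    exact (Finset.mem_union.1 hx).elim (fun h => (hA.lt x h).trans ht) (hB.lt x)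
  · intro x hx
    exact (Finset.mem_union.1 hx).elim (hA.rel x) (fun h p' hp' => hB.rel x h p' (by omega))
  · rw [jobCount_union hne]
    exact (add_le_add hA.count_one hB.count_one).trans hκ
  · rw [jobCount_union hne]
    exact (add_le_add hA.count_long hB.count_long).trans hμ
  · rw [jobCount_union hne, hA.count_over, hB.count_over]

/-- A schedule can be rearranged in such a way that the job `a`, which has the latest deadline,
runs only when no other job is pending. -/
theorem IsSchedule.exists_tail {a : ℕ}
    (hconv : ∀ b p p' p'', app b p → app b p'' → p ≤ p' → p' ≤ p'' → app b p')
    (hdl : ∀ b p p', J b → app a p → app b p' → p < p' → app a p')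
    (hA : IsSchedule q app (fun b => J b ∨ b = a) s t κ μ A) :
    ∃ B, IsSchedule q app (fun b => J b ∨ b = a) s t κ μ B ∧ B.card = A.card ∧
      ∀ p, (a, p) ∈ B → ∀ x ∈ B, x.1 ≠ a → p < x.2 → ∀ p' ≤ p, ¬ app x.1 p' := by
  -- Each exchange moves a slot of `a` to a later time, which lowers this sum.
  induction h : ∑ x ∈ A.filter (fun x => x.1 = a), (t - x.2) using Nat.strong_induction_on
    generalizing A with
  | _ v ih =>
    by_cases htail : ∀ p, (a, p) ∈ A → ∀ x ∈ A, x.1 ≠ a → p < x.2 → ∀ p' ≤ p, ¬ app x.1 p'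
    · exact ⟨A, hA, rfl, htail⟩
    push Not at htail
    obtain ⟨p, hpA, ⟨b, p'⟩, hbA, hba, hpp', p'', hp'', happ⟩ := htail
    simp only at hba hpp' happ
    -- By convexity `b` can run at `p`, and by the deadline hypothesis `a` can run at `p'`; the two
    -- slots are exchanged by the permutation `e`, which preserves all loads.
    have hbp : app b p := hconv b p'' p p' happ (hA.appr _ hbA) hp'' hpp'.le
    have hJb : J b := (hA.job _ hbA).resolve_right hba
    have hap' : app a p' := hdl b p p' hJb (hA.appr _ hpA) (hA.appr _ hbA) hpp'
    set e : ℕ × ℕ ≃ ℕ × ℕ := Equiv.prodCongr (Equiv.refl ℕ) (Equiv.swap p p') with he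
    have he1 : ∀ x, (e x).1 = x.1 := fun x => rfl
    have he2 : ∀ x, (e x).2 = Equiv.swap p p' x.2 := fun x => rfl
    have hcase : ∀ x ∈ A, x = (a, p) ∨ x = (b, p') ∨ (e x = x ∧ x.2 ≠ p ∧ x.2 ≠ p') := by
      intro x hx
      by_cases h1 : x.2 = p
      · exact .inl (hA.inj _ hx _ hpA h1)
      by_cases h2 : x.2 = p'
      · exact .inr (.inl (hA.inj _ hx _ hbA h2))
      · exact .inr (.inr ⟨Prod.ext rfl (Equiv.swap_apply_of_ne_of_ne h1 h2), h1, h2⟩)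
    have hload : ∀ c, jobLoad (A.map e.toEmbedding) c = jobLoad A c := by
      intro c
      unfold jobLoad
      rw [Finset.filter_map, Finset.card_map]
      rfl
    have hcount : ∀ θ, jobCount (A.map e.toEmbedding) θ = jobCount A θ := by
      intro θ
      unfold jobCount
      have : (A.map e.toEmbedding).image Prod.fst = A.image Prod.fst := by
        rw [Finset.map_eq_image, Finset.image_image]
        rfl
      rw [this]
      simp_rw [hload]
    have hB : IsSchedule q app (fun b => J b ∨ b = a) s t κ μ (A.map e.toEmbedding) := by
      refine ⟨?_, ?_, ?_, ?_, ?_, ?_, ?_, ?_⟩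
      · intro x hx y hy hxy
        obtain ⟨x, hx₁, rfl⟩ := Finset.mem_map.1 hx
        obtain ⟨y, hy₁, rfl⟩ := Finset.mem_map.1 hy
        rw [hA.inj x hx₁ y hy₁ ((Equiv.swap p p').injective hxy)]
      · intro x hx
        obtain ⟨x, hx₁, rfl⟩ := Finset.mem_map.1 hx
        simp only [Equiv.coe_toEmbedding]
        rcases hcase x hx₁ with rfl | rfl | h
        · simpa [he] using hap'
        · simpa [he] using hbp
        · rw [h.1]
          exact hA.appr x hx₁
      · intro x hx
        obtain ⟨x, hx₁, rfl⟩ := Finset.mem_map.1 hx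
        exact hA.job x hx₁
      · intro x hx
        obtain ⟨x, hx₁, rfl⟩ := Finset.mem_map.1 hx
        simp only [Equiv.coe_toEmbedding]
        rcases hcase x hx₁ with rfl | rfl | h
        · simpa [he] using hA.lt _ hbA
        · simpa [he] using hA.lt _ hpA
        · rw [h.1]
          exact hA.lt x hx₁
      · intro x hx
        obtain ⟨x, hx₁, rfl⟩ := Finset.mem_map.1 hx
        exact hA.rel x hx₁
      · rw [hcount]; exact hA.count_one
      · rw [hcount]; exact hA.count_long
      · rw [hcount]; exact hA.count_over
    suffices hlt : ∑ x ∈ (A.map e.toEmbedding).filter (fun x => x.1 = a), (t - x.2) < v by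
      obtain ⟨B, hB1, hB2, hB3⟩ := ih _ hlt hB rfl
      exact ⟨B, hB1, by rw [hB2, Finset.card_map], hB3⟩
    rw [← h, Finset.filter_map, Finset.sum_map]
    refine Finset.sum_lt_sum ?_ ⟨(a, p), ?_, ?_⟩
    · intro x hx
      have hx' := (Finset.mem_filter.1 hx).1
      have hxa : x.1 = a := (Finset.mem_filter.1 hx).2
      simp only [Equiv.coe_toEmbedding]
      rcases hcase x hx' with rfl | rfl | h
      · simp [he]
        omega
      · exact absurd hxa hba
      · rw [h.1]
    · exact Finset.mem_filter.2 ⟨hpA, rfl⟩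
    · have := hA.lt _ hbA
      simp [he]
      simp at this
      omega

/-! ## The dynamic program -/

variable (q app) (N : ℕ) (w : ℕ → ℕ → ℕ)

/-- Every entry of the table is attained by a schedule. -/
def DPSound (J : ℕ → Prop) (F : ℕ → ℕ → ℕ → ℕ → ℕ) : Prop :=
  ∀ s t κ μ, ∃ A, IsSchedule q app J s t κ μ A ∧ ∑ x ∈ A, w x.1 x.2 = F s t κ μ

/-- The table exceeds the sizes of schedules, in units of `W`. -/
def DPComplete (W : ℕ) (J : ℕ → Prop) (F : ℕ → ℕ → ℕ → ℕ → ℕ) : Prop :=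
  ∀ s t κ μ A, t < N → κ < N → μ < N → IsSchedule q app J s t κ μ A → A.card * W ≤ F s t κ μ

variable {q app N w} {W : ℕ}

theorem DPSound.zero : DPSound q app w (fun _ => False) (fun _ _ _ _ => 0) :=
  fun _ _ _ _ => ⟨∅, .empty, by simp⟩

theorem DPComplete.zero : DPComplete q app N W (fun _ => False) (fun _ _ _ _ => 0) := by
  intro s t κ μ A _ _ _ hA
  have : A = ∅ := Finset.eq_empty_of_forall_notMem fun x hx => hA.job x hx
  simp [this]

variable (q app N w) [∀ a p, Decidable (app a p)]

/-- One more slot for the job `a`, the last one of this job; the remaining slots are filled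
according to the tables `E` (before) and `F` (after). -/
def dpExtend (a : ℕ) (E F : ℕ → ℕ → ℕ → ℕ → ℕ) (s t κ μ : ℕ) : ℕ :=
  (Finset.range N).sup fun p => (Finset.range N).sup fun κ' => (Finset.range N).sup fun μ' =>
    if s ≤ p ∧ p < t ∧ app a p ∧ κ' ≤ κ ∧ μ' ≤ μ then
      E s p κ' μ' + w a p + F (p + 1) t (κ - κ') (μ - μ') else 0

/-- The table for schedules with `c` slots for the job `a`, which is not counted. -/
def dpIter (a : ℕ) (F : ℕ → ℕ → ℕ → ℕ → ℕ) : ℕ → ℕ → ℕ → ℕ → ℕ → ℕ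
  | 0 => F
  | c + 1 => dpExtend app N w a (dpIter a F c) F

/-- The value of schedules in which the job `a` has `c + 1` slots. -/
def dpCand (a : ℕ) (E : ℕ → ℕ → ℕ → ℕ → ℕ) (c s t κ μ : ℕ) : ℕ :=
  if c ≤ q ∧ 1 ≤ κ ∧ (c = q → 1 ≤ μ) ∧ ∀ p < s, ¬ app a p then
    E s t (κ - 1) (μ - if c = q then 1 else 0) else 0

/-- The table with the jobs processed so far and the job `a`, which may have up to `i` slots. -/
def dpUpTo (a : ℕ) (F : ℕ → ℕ → ℕ → ℕ → ℕ) (i s t κ μ : ℕ) : ℕ :=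
  max (F s t κ μ) ((Finset.range i).sup fun c =>
    dpCand q app a (dpIter app N w a F (c + 1)) c s t κ μ)

/-- Processing the job `a`. -/
def dpStep (a : ℕ) (F : ℕ → ℕ → ℕ → ℕ → ℕ) : ℕ → ℕ → ℕ → ℕ → ℕ := dpUpTo q app N w a F N

variable {q app N w} {F : ℕ → ℕ → ℕ → ℕ → ℕ} {a : ℕ}

theorem exists_eq_sup_range (f : ℕ → ℕ) (n : ℕ) :
    (Finset.range n).sup f = 0 ∨ ∃ i < n, (Finset.range n).sup f = f i := by
  rcases Nat.eq_zero_or_pos n with rfl | hn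
  · simp
  · obtain ⟨i, hi, h⟩ := Finset.exists_mem_eq_sup (Finset.range n) (by simpa using hn.ne') f
    exact .inr ⟨i, by simpa using hi, h⟩

theorem le_sup_range {f : ℕ → ℕ} {n i : ℕ} (hi : i < n) : f i ≤ (Finset.range n).sup f :=
  Finset.le_sup (f := f) (by simpa using hi)

/-- `A` consists of the slots of the other jobs and `P` of those of `a`. There may be fewer than `c`
of the latter: where no choice is admissible the table has the default value 0, which the empty
schedule attains. -/
theorem DPSound.iter (hF : DPSound q app w J F) (c : ℕ) : ∀ s t κ μ, ∃ A P,
    IsSchedule q app J s t κ μ A ∧ P.card ≤ c ∧ (∀ p ∈ P, s ≤ p ∧ p < t ∧ app a p) ∧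
      (∀ p ∈ P, ∀ x ∈ A, x.2 ≠ p) ∧
        ∑ x ∈ A, w x.1 x.2 + ∑ p ∈ P, w a p = dpIter app N w a F c s t κ μ := by
  induction c with
  | zero =>
    intro s t κ μ
    obtain ⟨A, h1, h2⟩ := hF s t κ μ
    exact ⟨A, ∅, h1, by simp, by simp, by simp, by simpa [dpIter] using h2⟩
  | succ c ih =>
    intro s t κ μ
    have hzero : ∀ v, v = 0 → ∃ A P, IsSchedule q app J s t κ μ A ∧ P.card ≤ c + 1 ∧
        (∀ p ∈ P, s ≤ p ∧ p < t ∧ app a p) ∧ (∀ p ∈ P, ∀ x ∈ A, x.2 ≠ p) ∧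
          ∑ x ∈ A, w x.1 x.2 + ∑ p ∈ P, w a p = v := by
      rintro v rfl
      exact ⟨∅, ∅, .empty, by simp, by simp, by simp, by simp⟩
    simp only [dpIter, dpExtend]
    rcases exists_eq_sup_range _ N with h | ⟨p, -, h⟩ <;> rw [h]
    · exact hzero _ rfl
    rcases exists_eq_sup_range _ N with h | ⟨κ', -, h⟩ <;> rw [h]
    · exact hzero _ rfl
    rcases exists_eq_sup_range _ N with h | ⟨μ', -, h⟩ <;> rw [h]
    · exact hzero _ rfl
    split_ifs with hc
    · obtain ⟨hsp, hpt, hap, hκ, hμ⟩ := hc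
      obtain ⟨A, P, h1, h2, h3, h4, h5⟩ := ih s p κ' μ'
      obtain ⟨B, g1, g2⟩ := hF (p + 1) t (κ - κ') (μ - μ')
      obtain ⟨hU, hD⟩ := h1.union g1 hsp hpt (show _ ≤ κ by omega) (show _ ≤ μ by omega)
      have hpP : p ∉ P := fun h => by have := h3 p h; omega
      refine ⟨A ∪ B, insert p P, hU, ?_, ?_, ?_, ?_⟩
      · rw [Finset.card_insert_of_notMem hpP]
        omega
      · intro p' hp'
        rcases Finset.mem_insert.1 hp' with rfl | hp'
        · exact ⟨hsp, hpt, hap⟩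
        · exact ⟨(h3 p' hp').1, (h3 p' hp').2.1.trans hpt, (h3 p' hp').2.2⟩
      · intro p' hp' x hx
        rcases Finset.mem_insert.1 hp' with rfl | hp' <;> rcases Finset.mem_union.1 hx with hx | hx
        · exact (h1.lt x hx).ne
        · have := g1.le hx; omega
        · exact h4 p' hp' x hx
        · have := g1.le hx; have := h3 p' hp'; omega
      · rw [Finset.sum_union hD, Finset.sum_insert hpP, ← h5, ← g2]
        ring
    · exact hzero _ rfl

theorem jobCount_map_single_le (a : ℕ) (P : Finset ℕ) (θ : ℕ) :
    jobCount (P.image fun p => (a, p)) θ ≤ if θ ≤ P.card then 1 else 0 := by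
  rcases P.eq_empty_or_nonempty with rfl | hP
  · simp
  · rw [jobCount_single (a := a) (by simp) (hP.image _),
      Finset.card_image_of_injective _ (Prod.mk_right_injective a)]

/-- `dpCand` pays in advance for one more job and, if `c = q`, for one more long job. Having fewer
slots of `a` than planned only lowers the counts. Since `a` is new, its slots do not mix with those
of jobs in `J`. -/
theorem DPSound.step (hF : DPSound q app w J F) (ha : ¬ J a) :
    DPSound q app w (fun b => J b ∨ b = a) (dpStep q app N w a F) := by
  intro s t κ μ
  have hbase : ∀ v, v = F s t κ μ → ∃ A, IsSchedule q app (fun b => J b ∨ b = a) s t κ μ A ∧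
      ∑ x ∈ A, w x.1 x.2 = v := by
    rintro v rfl
    obtain ⟨A, h1, h2⟩ := hF s t κ μ
    exact ⟨A, h1.mono (fun x hx => .inl (h1.job x hx)) h1.count_one h1.count_long, h2⟩
  simp only [dpStep, dpUpTo]
  rcases exists_eq_sup_range (fun c => dpCand q app a (dpIter app N w a F (c + 1)) c s t κ μ) N
    with h | ⟨c, -, h⟩ <;> rw [h]
  · exact hbase _ (by simp)
  rcases max_choice (F s t κ μ) (dpCand q app a (dpIter app N w a F (c + 1)) c s t κ μ) with h | h
    <;> rw [h]
  · exact hbase _ rfl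
  unfold dpCand at h ⊢
  by_cases hc : c ≤ q ∧ 1 ≤ κ ∧ (c = q → 1 ≤ μ) ∧ ∀ p < s, ¬ app a p
  · rw [if_pos hc]
    obtain ⟨hcq, hκ, hμ, hrel⟩ := hc
    obtain ⟨A, P, h1, h2, h3, h4, h5⟩ :=
      DPSound.iter (a := a) (N := N) hF (c + 1) s t (κ - 1) (μ - if c = q then 1 else 0)
    have hne : ∀ x ∈ A, ∀ y ∈ P.image (fun p => (a, p)), x.1 ≠ y.1 := by
      intro x hx y hy hxy
      obtain ⟨p, -, rfl⟩ := Finset.mem_image.1 hy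
      have hxa : x.1 = a := hxy
      exact ha (hxa ▸ h1.job x hx)
    have hcount := jobCount_union hne
    refine ⟨A ∪ P.image (fun p => (a, p)), ⟨?_, ?_, ?_, ?_, ?_, ?_, ?_, ?_⟩, ?_⟩
    · intro x hx y hy hxy
      rcases Finset.mem_union.1 hx with hx | hx <;> rcases Finset.mem_union.1 hy with hy | hy
      · exact h1.inj x hx y hy hxy
      · obtain ⟨p, hp, rfl⟩ := Finset.mem_image.1 hy
        exact absurd hxy (h4 p hp x hx)
      · obtain ⟨p, hp, rfl⟩ := Finset.mem_image.1 hx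
        exact absurd hxy.symm (h4 p hp y hy)
      · obtain ⟨p, hp, rfl⟩ := Finset.mem_image.1 hx
        obtain ⟨p', hp', rfl⟩ := Finset.mem_image.1 hy
        exact Prod.ext rfl hxy
    · intro x hx
      rcases Finset.mem_union.1 hx with hx | hx
      · exact h1.appr x hx
      · obtain ⟨p, hp, rfl⟩ := Finset.mem_image.1 hx
        exact (h3 p hp).2.2
    · intro x hx
      rcases Finset.mem_union.1 hx with hx | hx
      · exact .inl (h1.job x hx)
      · obtain ⟨p, hp, rfl⟩ := Finset.mem_image.1 hx
        exact .inr rfl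
    · intro x hx
      rcases Finset.mem_union.1 hx with hx | hx
      · exact h1.lt x hx
      · obtain ⟨p, hp, rfl⟩ := Finset.mem_image.1 hx
        exact (h3 p hp).2.1
    · intro x hx
      rcases Finset.mem_union.1 hx with hx | hx
      · exact h1.rel x hx
      · obtain ⟨p, hp, rfl⟩ := Finset.mem_image.1 hx
        exact hrel
    · have := h1.count_one
      have h' := jobCount_map_single_le a P 1
      rw [hcount]
      split_ifs at h' <;> omega
    · have := h1.count_long
      have h' := jobCount_map_single_le a P (q + 1)
      rw [hcount]
      by_cases hcq' : c = q
      · have := hμ hcq'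
        simp only [hcq', if_true] at *
        split_ifs at h' <;> omega
      · rw [if_neg (by omega)] at h'
        simp only [hcq', if_false] at *
        omega
    · have h' := jobCount_map_single_le a P (q + 2)
      rw [hcount, h1.count_over]
      rw [if_neg (by omega)] at h'
      omega
    · rw [Finset.sum_union (Finset.disjoint_left.2 fun x hx hy => hne x hx x hy rfl),
        Finset.sum_image (by intro x _ y _ h; exact (Prod.mk.inj h).2), ← h5]
  · rw [if_neg hc] at h ⊢
    exact hbase _ (by omega)

/-- Cut at the last slot `p` of `a`. By the last hypothesis, jobs running after `p` are released
after `p`, so the two sides share no job: `F` accounts for the right side and the induction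
hypothesis for the left. The guesses for `κ'` and `μ'` are the numbers of jobs and of long jobs on
the left. -/
theorem DPComplete.iter (hw : ∀ a p, W ≤ w a p) (hF : DPComplete q app N W J F) (c : ℕ) :
    ∀ s t κ μ A (P : Finset ℕ), t < N → κ < N → μ < N → IsSchedule q app J s t κ μ A → P.card = c →
      (∀ p ∈ P, s ≤ p ∧ p < t ∧ app a p) → (∀ p ∈ P, ∀ x ∈ A, x.2 ≠ p) →
      (∀ p ∈ P, ∀ x ∈ A, p < x.2 → ∀ p' ≤ p, ¬ app x.1 p') →
        (A.card + c) * W ≤ dpIter app N w a F c s t κ μ := by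
  induction c with
  | zero =>
    intro s t κ μ A P ht hκ hμ hA _ _ _ _
    simpa [dpIter] using hF s t κ μ A ht hκ hμ hA
  | succ c ih =>
    intro s t κ μ A P ht hκ hμ hA hc hP hne htail
    have hP0 : P.Nonempty := Finset.card_pos.1 (by omega)
    obtain ⟨p, hpP, hmax⟩ := P.exists_max_image id hP0
    simp only [id] at hmax
    obtain ⟨hsp, hpt, hap⟩ := hP p hpP
    set L := A.filter (fun x => x.2 < p) with hL
    set R := A.filter (fun x => p < x.2) with hR
    have hLA : ∀ x ∈ L, x ∈ A ∧ x.2 < p := fun x hx => Finset.mem_filter.1 hx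
    have hRA : ∀ x ∈ R, x ∈ A ∧ p < x.2 := fun x hx => Finset.mem_filter.1 hx
    have hA' : A = L ∪ R := by
      ext x
      simp only [hL, hR, Finset.mem_union, Finset.mem_filter]
      constructor
      · intro hx
        have := hne p hpP x hx
        rcases lt_or_gt_of_ne this with h | h
        · exact .inl ⟨hx, h⟩
        · exact .inr ⟨hx, h⟩
      · rintro (h | h) <;> exact h.1
    have hdisj : ∀ x ∈ L, ∀ y ∈ R, x.1 ≠ y.1 := fun x hx y hy hxy =>
      htail p hpP y (hRA y hy).1 (hRA y hy).2 x.2 (hLA x hx).2.le (hxy ▸ hA.appr x (hLA x hx).1)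
    have hcount : ∀ θ, jobCount A θ = jobCount L θ + jobCount R θ := fun θ => by
      rw [← jobCount_union hdisj, ← hA']
    have k1 := hA.count_one
    have k2 := hA.count_long
    have k3 := hA.count_over
    rw [hcount] at k1 k2 k3
    have hLs : IsSchedule q app J s p (jobCount L 1) (jobCount L (q + 1)) L :=
      ⟨fun x hx y hy => hA.inj x (hLA x hx).1 y (hLA y hy).1, fun x hx => hA.appr x (hLA x hx).1,
        fun x hx => hA.job x (hLA x hx).1, fun x hx => (hLA x hx).2,
        fun x hx => hA.rel x (hLA x hx).1, le_rfl, le_rfl, by omega⟩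
    have hRs : IsSchedule q app J (p + 1) t (κ - jobCount L 1) (μ - jobCount L (q + 1)) R :=
      ⟨fun x hx y hy => hA.inj x (hRA x hx).1 y (hRA y hy).1, fun x hx => hA.appr x (hRA x hx).1,
        fun x hx => hA.job x (hRA x hx).1, fun x hx => hA.lt x (hRA x hx).1,
        fun x hx p' hp' => htail p hpP x (hRA x hx).1 (hRA x hx).2 p' (by omega),
        by omega, by omega, by omega⟩
    have e1 := ih s p (jobCount L 1) (jobCount L (q + 1)) L (P.erase p) (by omega) (by omega)
      (by omega) hLs (by rw [Finset.card_erase_of_mem hpP]; omega)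
      (fun p' hp' => by
        obtain ⟨h1, h2⟩ := Finset.mem_erase.1 hp'
        have := hmax p' h2
        exact ⟨(hP p' h2).1, by omega, (hP p' h2).2.2⟩)
      (fun p' hp' x hx => hne p' (Finset.mem_erase.1 hp').2 x (hLA x hx).1)
      (fun p' hp' x hx => htail p' (Finset.mem_erase.1 hp').2 x (hLA x hx).1)
    have e2 := hF (p + 1) t _ _ R ht (by omega) (by omega) hRs
    have e3 : A.card = L.card + R.card := by
      rw [hA', Finset.card_union_of_disjoint]
      exact Finset.disjoint_left.2 fun x hx hy => hdisj x hx x hy rfl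
    have e4 := hw a p
    calc (A.card + (c + 1)) * W = (L.card + c) * W + W + R.card * W := by rw [e3]; ring
      _ ≤ dpIter app N w a F c s p (jobCount L 1) (jobCount L (q + 1)) + w a p +
          F (p + 1) t (κ - jobCount L 1) (μ - jobCount L (q + 1)) := by omega
      _ = if s ≤ p ∧ p < t ∧ app a p ∧ jobCount L 1 ≤ κ ∧ jobCount L (q + 1) ≤ μ then
            dpIter app N w a F c s p (jobCount L 1) (jobCount L (q + 1)) + w a p +
              F (p + 1) t (κ - jobCount L 1) (μ - jobCount L (q + 1)) else 0 := by
          rw [if_pos ⟨hsp, hpt, hap, by omega, by omega⟩]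
      _ ≤ _ := (le_sup_range (n := N) (i := jobCount L (q + 1)) (f := fun μ' =>
          if s ≤ p ∧ p < t ∧ app a p ∧ jobCount L 1 ≤ κ ∧ μ' ≤ μ then
            dpIter app N w a F c s p (jobCount L 1) μ' + w a p +
              F (p + 1) t (κ - jobCount L 1) (μ - μ') else 0) (by omega))
      _ ≤ _ := (le_sup_range (n := N) (i := jobCount L 1) (f := fun κ' =>
          (Finset.range N).sup fun μ' => if s ≤ p ∧ p < t ∧ app a p ∧ κ' ≤ κ ∧ μ' ≤ μ then
            dpIter app N w a F c s p κ' μ' + w a p + F (p + 1) t (κ - κ') (μ - μ') else 0)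
              (by omega))
      _ ≤ _ := (le_sup_range (n := N) (i := p) (f := fun p => (Finset.range N).sup fun κ' =>
          (Finset.range N).sup fun μ' => if s ≤ p ∧ p < t ∧ app a p ∧ κ' ≤ κ ∧ μ' ≤ μ then
            dpIter app N w a F c s p κ' μ' + w a p + F (p + 1) t (κ - κ') (μ - μ') else 0)
              (by omega))

/-- After the rearrangement by `IsSchedule.exists_tail`, split off the set `D` of pairs of the job
`a`. If it is nonempty, with `c + 1` elements, the entry is reached through the candidate for `c`;
otherwise through the old table. -/
theorem DPComplete.step (hw : ∀ a p, W ≤ w a p)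
    (hconv : ∀ b p p' p'', app b p → app b p'' → p ≤ p' → p' ≤ p'' → app b p')
    (hdl : ∀ b p p', J b → app a p → app b p' → p < p' → app a p')
    (hF : DPComplete q app N W J F) :
    DPComplete q app N W (fun b => J b ∨ b = a) (dpStep q app N w a F) := by
  intro s t κ μ A ht hκ hμ hA
  obtain ⟨B, hB, hcard, htail⟩ := hA.exists_tail hconv hdl
  rw [← hcard]
  set D := B.filter (fun x => x.1 = a) with hD
  set O := B.filter (fun x => x.1 ≠ a) with hO
  have hDB : ∀ x ∈ D, x ∈ B ∧ x.1 = a := fun x hx => Finset.mem_filter.1 hx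
  have hOB : ∀ x ∈ O, x ∈ B ∧ x.1 ≠ a := fun x hx => Finset.mem_filter.1 hx
  have hBDO : B = O ∪ D := by
    rw [Finset.union_comm]
    exact (Finset.filter_union_filter_not_eq _ _).symm
  have hne : ∀ x ∈ O, ∀ y ∈ D, x.1 ≠ y.1 := fun x hx y hy => by
    rw [(hDB y hy).2]
    exact (hOB x hx).2
  have hcount : ∀ θ, jobCount B θ = jobCount O θ + jobCount D θ := fun θ => by
    rw [← jobCount_union hne, ← hBDO]
  have k1 := hB.count_one
  have k2 := hB.count_long
  have k3 := hB.count_over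
  rw [hcount] at k1 k2 k3
  have hOs : ∀ κ' μ', jobCount O 1 ≤ κ' → jobCount O (q + 1) ≤ μ' →
      IsSchedule q app J s t κ' μ' O := fun κ' μ' h1 h2 =>
    ⟨fun x hx y hy => hB.inj x (hOB x hx).1 y (hOB y hy).1, fun x hx => hB.appr x (hOB x hx).1,
      fun x hx => (hB.job x (hOB x hx).1).resolve_right (hOB x hx).2,
      fun x hx => hB.lt x (hOB x hx).1, fun x hx => hB.rel x (hOB x hx).1, h1, h2, by omega⟩
  rcases D.eq_empty_or_nonempty with hD0 | hD0
  · have hBO : B = O := by rw [hBDO, hD0, Finset.union_empty]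
    rw [hBO]
    exact (hF s t κ μ O ht hκ hμ (hOs _ _ (by omega) (by omega))).trans (le_max_left _ _)
  · have hDc := jobCount_single (fun x hx => (hDB x hx).2) hD0
    rw [hDc] at k1 k2 k3
    have hinj : Set.InjOn Prod.snd (D : Set (ℕ × ℕ)) := fun x hx y hy hxy =>
      hB.inj x (hDB x hx).1 y (hDB y hy).1 hxy
    have hP : (D.image Prod.snd).card = D.card := Finset.card_image_of_injOn hinj
    have hmem : ∀ p ∈ D.image Prod.snd, (a, p) ∈ B := fun p hp => by
      obtain ⟨x, hx, rfl⟩ := Finset.mem_image.1 hp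
      obtain ⟨h1, rfl⟩ := hDB x hx
      exact h1
    -- At most `t < N` slots are used, so `c` lies in the range of the supremum in `dpUpTo`.
    have hDt : D.card ≤ t := by
      rw [← hP]
      calc (D.image Prod.snd).card ≤ (Finset.range t).card := Finset.card_le_card fun p hp => by
            simpa using hB.lt _ (hmem p hp)
        _ = t := Finset.card_range t
    obtain ⟨c, hc⟩ : ∃ c, D.card = c + 1 := ⟨D.card - 1, by have := hD0.card_pos; omega⟩
    rw [hc] at k1 k2 k3 hDt hP
    have hcq : c ≤ q := by
      by_contra hcon
      rw [if_pos (by omega)] at k3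
      omega
    have hκ1 : jobCount O 1 + 1 ≤ κ := by simpa using k1
    have hμ1 : jobCount O (q + 1) + (if c = q then 1 else 0) ≤ μ := by
      split_ifs at k2 ⊢ <;> omega
    have e1 := DPComplete.iter (a := a) hw hF (c + 1) s t (κ - 1) (μ - if c = q then 1 else 0) O
      (D.image Prod.snd) ht (by omega) (by omega) (hOs _ _ (by omega) (by omega)) hP
      (fun p hp => ⟨hB.le (hmem p hp), hB.lt _ (hmem p hp), hB.appr _ (hmem p hp)⟩)
      (fun p hp x hx hxp => (hOB x hx).2
        (congrArg Prod.fst (hB.inj x (hOB x hx).1 _ (hmem p hp) hxp)))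
      (fun p hp x hx => htail p (hmem p hp) x (hOB x hx).1 (hOB x hx).2)
    have e2 : B.card = O.card + (c + 1) := by
      rw [hBDO, Finset.card_union_of_disjoint, hc]
      exact Finset.disjoint_left.2 fun x hx hy => hne x hx x hy rfl
    have hrel : ∀ p < s, ¬ app a p := by
      obtain ⟨x, hx⟩ := hD0
      have := hB.rel x (hDB x hx).1
      rwa [(hDB x hx).2] at this
    rw [e2]
    refine e1.trans (le_trans ?_ (le_max_right _ _))
    refine le_trans (le_of_eq ?_) (le_sup_range (i := c) (by omega))
    have hμ2 : c = q → 1 ≤ μ := fun h => by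
      rw [if_pos h] at hμ1
      omega
    rw [dpCand, if_pos (show c ≤ q ∧ 1 ≤ κ ∧ (c = q → 1 ≤ μ) ∧ ∀ p < s, ¬ app a p from
      ⟨hcq, by omega, hμ2, hrel⟩)]

end Schedules

/-! ## Completing partial assignments -/

section Completion

/-- The number of voters assigned to the alternative `b` by the table `S`, whose entries are `0`
for unassigned voters and `a + 1` for voters assigned to `a`. -/
def tabLoad (n : ℕ) (S : ℕ → ℕ) (b : ℕ) : ℕ := ∑ u ∈ Finset.range n, if S u = b + 1 then 1 else 0

/-- The number of alternatives with at least `θ` voters. -/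
def tabCount (n m : ℕ) (S : ℕ → ℕ) (θ : ℕ) : ℕ :=
  ∑ b ∈ Finset.range m, if θ ≤ tabLoad n S b then 1 else 0

/-- The partial assignment `S` uses at most `k` alternatives, each at most `q + 1` times and at
most `r` of them `q + 1` times. -/
structure IsPartialAssignment (n m k q r : ℕ) (S : ℕ → ℕ) : Prop where
  le : ∀ u < n, S u ≤ m
  count_one : tabCount n m S 1 ≤ k
  count_long : tabCount n m S (q + 1) ≤ r
  count_over : tabCount n m S (q + 2) = 0

variable {n m k q r : ℕ} {S : ℕ → ℕ}

theorem tabLoad_update {v : ℕ} (hv : v < n) (hS : S v = 0) (a b : ℕ) :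
    tabLoad n (Function.update S v (a + 1)) b = tabLoad n S b + if b = a then 1 else 0 := by
  unfold tabLoad
  rw [← Finset.add_sum_erase _ _ (Finset.mem_range.2 hv),
    ← Finset.add_sum_erase (Finset.range n) (fun u => if S u = b + 1 then 1 else 0)
      (Finset.mem_range.2 hv)]
  have : ∑ x ∈ (Finset.range n).erase v, (if Function.update S v (a + 1) x = b + 1 then 1 else 0)
      = ∑ x ∈ (Finset.range n).erase v, if S x = b + 1 then 1 else 0 :=
    Finset.sum_congr rfl fun x hx => by
      rw [Function.update_of_ne (Finset.ne_of_mem_erase hx)]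
  rw [this]
  rw [Function.update_self, hS, if_neg (show ¬ 0 = b + 1 by omega), zero_add, add_comm]
  simp [eq_comm]

theorem tabCount_update_le {v : ℕ} (hv : v < n) (hS : S v = 0) (a θ : ℕ) :
    tabCount n m (Function.update S v (a + 1)) θ ≤
      tabCount n m S θ + if θ = tabLoad n S a + 1 then 1 else 0 := by
  unfold tabCount
  calc _ ≤ ∑ b ∈ Finset.range m, ((if θ ≤ tabLoad n S b then 1 else 0) +
        if b = a then (if θ = tabLoad n S a + 1 then 1 else 0) else 0) := by
        refine Finset.sum_le_sum fun b _ => ?_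
        rw [tabLoad_update hv hS]
        rcases eq_or_ne b a with rfl | hb
        · simp only [if_true]
          split_ifs <;> omega
        · simp [hb]
    _ ≤ _ := by
        rw [Finset.sum_add_distrib, Finset.sum_ite_eq']
        split_ifs <;> omega

theorem sum_tabLoad (hS : ∀ u < n, S u ≤ m) :
    ∑ b ∈ Finset.range m, tabLoad n S b = ∑ u ∈ Finset.range n, if S u = 0 then 0 else 1 := by
  unfold tabLoad
  rw [Finset.sum_comm]
  refine Finset.sum_congr rfl fun u hu => ?_
  have := hS u (Finset.mem_range.1 hu)
  split_ifs with h
  · simp [h]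
  · rw [Finset.sum_eq_single (S u - 1)]
    · rw [if_pos (by omega)]
    · intro b _ hb
      rw [if_neg (by omega)]
    · intro hb
      exact absurd (Finset.mem_range.2 (by omega)) hb

theorem tabLoad_le (hS : tabCount n m S (q + 2) = 0) {b : ℕ} (hb : b < m) :
    tabLoad n S b ≤ q + 1 := by
  unfold tabCount at hS
  rw [Finset.sum_eq_zero_iff] at hS
  have := hS b (Finset.mem_range.2 hb)
  split_ifs at this
  omega

/-- If fewer than `k` alternatives are in use, take an unused one. Otherwise take a used one with
load below `q`. If there is none, all `k` loads are `q` or `q + 1`; as `v` is unassigned, they sum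
to less than `k * q + r`, so fewer than `r` of them are `q + 1`. As `r < k`, some load is `q` and
can be raised. -/
theorem IsPartialAssignment.exists_extend (hS : IsPartialAssignment n m k q r S)
    (hn : n = k * q + r) (hr : r < k) (hq : 1 ≤ q) (hm : k ≤ m) {v : ℕ} (hv : v < n)
    (hSv : S v = 0) :
    ∃ a < m, IsPartialAssignment n m k q r (Function.update S v (a + 1)) := by
  have key : ∀ a < m, (tabLoad n S a = 0 → tabCount n m S 1 < k) →
      (tabLoad n S a = q → tabCount n m S (q + 1) < r) → tabLoad n S a ≤ q →
      IsPartialAssignment n m k q r (Function.update S v (a + 1)) := by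
    intro a ha h1 h2 h3
    refine ⟨fun u hu => ?_, ?_, ?_, ?_⟩
    · rcases eq_or_ne u v with rfl | h
      · simpa using ha
      · rw [Function.update_of_ne h]
        exact hS.le u hu
    · have := tabCount_update_le (m := m) hv hSv a 1
      have := hS.count_one
      split_ifs at * <;> omega
    · have := tabCount_update_le (m := m) hv hSv a (q + 1)
      have := hS.count_long
      split_ifs at * <;> omega
    · have := tabCount_update_le (m := m) hv hSv a (q + 2)
      have := hS.count_over
      split_ifs at * <;> omega
  rcases Nat.lt_or_ge (tabCount n m S 1) k with hlt | hge
  · obtain ⟨b, hb, hb0⟩ : ∃ b < m, tabLoad n S b = 0 := by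
      by_contra! h
      have : tabCount n m S 1 = m := by
        unfold tabCount
        rw [Finset.sum_congr rfl (g := fun _ => 1) fun b hb => by
          rw [if_pos (Nat.one_le_iff_ne_zero.2 (h b (Finset.mem_range.1 hb)))]]
        simp
      omega
    exact ⟨b, hb, key b hb (fun _ => hlt) (by omega) (by omega)⟩
  by_cases h : ∃ b < m, 1 ≤ tabLoad n S b ∧ tabLoad n S b < q
  · obtain ⟨b, hb, h1, h2⟩ := h
    exact ⟨b, hb, key b hb (by omega) (by omega) (by omega)⟩
  push Not at h
  have hsum : ∑ b ∈ Finset.range m, tabLoad n S b =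
      q * tabCount n m S 1 + tabCount n m S (q + 1) := by
    unfold tabCount
    rw [Finset.mul_sum, ← Finset.sum_add_distrib]
    refine Finset.sum_congr rfl fun b hb => ?_
    have h1 := h b (Finset.mem_range.1 hb)
    have h2 := tabLoad_le hS.count_over (Finset.mem_range.1 hb)
    split_ifs <;> omega
  have hlt : ∑ b ∈ Finset.range m, tabLoad n S b < n := by
    rw [sum_tabLoad hS.le]
    calc _ < ∑ u ∈ Finset.range n, 1 := by
          refine Finset.sum_lt_sum (fun u _ => by split_ifs <;> omega)
            ⟨v, Finset.mem_range.2 hv, by simp [hSv]⟩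
      _ = n := by simp
  have hk : tabCount n m S 1 = k := le_antisymm hS.count_one hge
  have hlong : tabCount n m S (q + 1) < r := by
    rw [hsum, hk, mul_comm] at hlt
    omega
  obtain ⟨b, hb, h1, h2⟩ : ∃ b < m, 1 ≤ tabLoad n S b ∧ tabLoad n S b < q + 1 := by
    by_contra! h'
    have : tabCount n m S 1 ≤ tabCount n m S (q + 1) := by
      unfold tabCount
      refine Finset.sum_le_sum fun b hb => ?_
      have := h' b (Finset.mem_range.1 hb)
      split_ifs <;> omega
    omega
  have := h b hb h1
  exact ⟨b, hb, key b hb (by omega) (fun _ => hlong) (by omega)⟩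

theorem card_filter_eq_tabLoad {σ : Fin n → Fin m} (hσ : ∀ u : Fin n, S u = σ u + 1) (a : Fin m) :
    (Finset.univ.filter fun v => σ v = a).card = tabLoad n S a := by
  rw [Finset.card_filter, tabLoad, Finset.sum_range]
  refine Finset.sum_congr rfl fun u _ => ?_
  rw [hσ u]
  simp [Fin.ext_iff]

theorem card_image_eq_tabCount {σ : Fin n → Fin m} (hσ : ∀ u : Fin n, S u = σ u + 1) :
    (Finset.univ.image σ).card = tabCount n m S 1 := by
  rw [tabCount, Finset.sum_range, ← Finset.card_filter]
  congr 1
  ext a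
  rw [Finset.mem_filter, ← card_filter_eq_tabLoad hσ]
  simp [Nat.one_le_iff_ne_zero, Finset.card_eq_zero, Finset.filter_eq_empty_iff]

/-- The second bound states without division that the load is at most `⌈n / k⌉`. -/
theorem isProportionalAssignment_of_bounds (hk : 1 ≤ k) {σ : Fin n → Fin m}
    (hc : (Finset.univ.image σ).card = k)
    (h : ∀ a ∈ Finset.univ.image σ, n / k ≤ (Finset.univ.filter fun v => σ v = a).card ∧
      ((Finset.univ.filter fun v => σ v = a).card - 1) * k < n) :
    IsProportionalAssignment k σ := by
  have hk0 : (0 : ℚ) < k := by exact_mod_cast hk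
  refine ⟨hc, fun a ha => ⟨?_, ?_⟩⟩
  · rw [Nat.floor_div_eq_div]
    exact (h a ha).1
  · have h2 := (h a ha).2
    set l := (Finset.univ.filter fun v => σ v = a).card
    rcases Nat.eq_zero_or_pos l with h0 | h0
    · omega
    · have : l - 1 < ⌈(n : ℚ) / k⌉₊ := by
        rw [Nat.lt_ceil, lt_div_iff₀ hk0]
        exact_mod_cast h2
      omega

theorem IsProportionalAssignment.bounds (hk : 1 ≤ k) {σ : Fin n → Fin m}
    (h : IsProportionalAssignment k σ) {a : Fin m} (ha : a ∈ Finset.univ.image σ) :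
    n / k ≤ (Finset.univ.filter fun v => σ v = a).card ∧
      (Finset.univ.filter fun v => σ v = a).card ≤ n / k + 1 := by
  have hk0 : (0 : ℚ) < k := by exact_mod_cast hk
  obtain ⟨h1, h2⟩ := h.2 a ha
  rw [Nat.floor_div_eq_div] at h1
  refine ⟨h1, h2.trans (Nat.ceil_le.2 ?_)⟩
  rw [div_le_iff₀ hk0]
  have := Nat.div_add_mod n k
  have := Nat.mod_lt n hk
  have : n ≤ (n / k + 1) * k := by nlinarith
  exact_mod_cast this

theorem IsProportionalAssignment.le_left {σ : Fin n → Fin m} (h : IsProportionalAssignment k σ) :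
    k ≤ n := by
  rw [← h.1]
  exact Finset.card_image_le.trans (by simp)

theorem IsProportionalAssignment.le_right {σ : Fin n → Fin m} (h : IsProportionalAssignment k σ) :
    k ≤ m := by
  rw [← h.1]
  exact (Finset.card_le_univ _).trans (by simp)

/-- With all voters assigned, `n` is at most `q` times the number of used alternatives plus the
number of long ones, hence at most `k * q + r = n`. Equality throughout forces exactly `k` used
alternatives with loads `q` or `q + 1`. -/
theorem IsPartialAssignment.isProportionalAssignment
    (hS : IsPartialAssignment n m k (n / k) (n % k) S) (hk : 1 ≤ k) (hkn : k ≤ n)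
    {σ : Fin n → Fin m} (hσ : ∀ u : Fin n, S u = σ u + 1) : IsProportionalAssignment k σ := by
  set q := n / k with hq'
  set r := n % k with hr'
  have hn : n = k * q + r := (Nat.div_add_mod n k).symm
  have hq : 1 ≤ q := (Nat.one_le_div_iff hk).2 hkn
  have hsum : ∑ b ∈ Finset.range m, tabLoad n S b = n := by
    rw [sum_tabLoad hS.le]
    calc _ = ∑ u ∈ Finset.range n, 1 := Finset.sum_congr rfl fun u hu => by
          rw [hσ ⟨u, Finset.mem_range.1 hu⟩]
          simp
      _ = n := by simp
  have hterm : ∀ b ∈ Finset.range m, tabLoad n S b ≤ q * (if 1 ≤ tabLoad n S b then 1 else 0) +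
      if q + 1 ≤ tabLoad n S b then 1 else 0 := fun b hb => by
    have h2 := tabLoad_le hS.count_over (Finset.mem_range.1 hb)
    split_ifs <;> omega
  have htot : ∑ b ∈ Finset.range m, (q * (if 1 ≤ tabLoad n S b then 1 else 0) +
      if q + 1 ≤ tabLoad n S b then 1 else 0) = q * tabCount n m S 1 + tabCount n m S (q + 1) := by
    unfold tabCount
    rw [Finset.sum_add_distrib, Finset.mul_sum]
  have hle := Finset.sum_le_sum hterm
  have h1 := hS.count_one
  have h2 := hS.count_long
  have hcount : tabCount n m S 1 = k := by
    refine le_antisymm h1 ?_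
    rw [htot, hsum] at hle
    have : k * q ≤ tabCount n m S 1 * q := by
      have := mul_comm q (tabCount n m S 1)
      omega
    exact Nat.le_of_mul_le_mul_right this hq
  have hsum2 : q * tabCount n m S 1 + tabCount n m S (q + 1) ≤ n := by
    rw [hcount, mul_comm]
    omega
  have heq : ∀ b ∈ Finset.range m, tabLoad n S b =
      q * (if 1 ≤ tabLoad n S b then 1 else 0) + if q + 1 ≤ tabLoad n S b then 1 else 0 := by
    intro b hb
    by_contra hne
    have := Finset.sum_lt_sum hterm ⟨b, hb, lt_of_le_of_ne (hterm b hb) hne⟩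
    rw [htot, hsum] at this
    omega
  refine isProportionalAssignment_of_bounds hk (by rw [card_image_eq_tabCount hσ, hcount]) ?_
  intro a ha
  have ha1 : 1 ≤ tabLoad n S a := by
    obtain ⟨u, -, rfl⟩ := Finset.mem_image.1 ha
    rw [← card_filter_eq_tabLoad hσ]
    exact Finset.card_pos.2 ⟨u, by simp⟩
  rw [card_filter_eq_tabLoad hσ]
  have h3 := heq a (Finset.mem_range.2 a.2)
  rw [if_pos ha1] at h3
  refine ⟨by omega, ?_⟩
  split_ifs at h3 with h4
  -- A load of `q + 1` requires `r ≥ 1`, so `k * q < n` and this load does not exceed the ceiling.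
  · have hr1 : 1 ≤ tabCount n m S (q + 1) := by
      unfold tabCount
      calc 1 = if q + 1 ≤ tabLoad n S a then 1 else 0 := by rw [if_pos h4]
        _ ≤ _ := Finset.single_le_sum (f := fun b => if q + 1 ≤ tabLoad n S b then 1 else 0)
            (fun _ _ => Nat.zero_le _) (Finset.mem_range.2 a.2)
    rw [h3]
    have : (q * 1 + 1 - 1) * k = k * q := by simp [mul_comm]
    omega
  · rw [h3]
    have : (q * 1 + 0 - 1) * k < k * q := by
      rw [mul_comm k]
      exact Nat.mul_lt_mul_of_pos_right (by omega) hk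
    omega

end Completion

/-! ## Schedules and assignments -/

section Conversion

variable {n m k : ℕ}

/-- The schedule in which the voters that `τ` assigns to approved alternatives take part. -/
def schedOf (P : ApprovalProfile n m) (pos : Fin n → ℕ) (τ : Fin n → Fin m) : Finset (ℕ × ℕ) :=
  (Finset.univ.filter fun u => τ u ∈ P.approved u).image fun u => ((τ u : ℕ), pos u)

/-- This turns minimal misrepresentation into maximal schedule size. -/
theorem card_schedOf {P : ApprovalProfile n m} {pos : Fin n → ℕ} (hpos : Function.Injective pos)
    (τ : Fin n → Fin m) : (schedOf P pos τ).card + P.sumMisrep τ = n := by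
  rw [schedOf, Finset.card_image_of_injective _ fun u v h => hpos (Prod.mk.inj h).2,
    Finset.card_filter, ApprovalProfile.sumMisrep, ← Finset.sum_add_distrib]
  have : ∀ u ∈ Finset.univ, ((if τ u ∈ P.approved u then 1 else 0) + P.misrep u (τ u)) = 1 := by
    intro u _
    unfold ApprovalProfile.misrep
    split_ifs <;> rfl
  rw [Finset.sum_congr rfl this]
  simp

theorem jobLoad_schedOf_le {P : ApprovalProfile n m} {pos : Fin n → ℕ} (τ : Fin n → Fin m)
    (a : Fin m) :
    jobLoad (schedOf P pos τ) a ≤ (Finset.univ.filter fun v => τ v = a).card := by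
  unfold jobLoad schedOf
  rw [Finset.filter_image]
  refine Finset.card_image_le.trans (Finset.card_le_card fun u hu => ?_)
  simp only [Finset.mem_filter, Finset.mem_univ, true_and] at hu ⊢
  exact Fin.ext hu.2

theorem IsProportionalAssignment.isSchedule {P : ApprovalProfile n m} {pos : Fin n → ℕ}
    (hpos : Function.Injective pos) (hlt : ∀ u, pos u < n) {app : ℕ → ℕ → Prop}
    (happ : ∀ u a, a ∈ P.approved u → app a (pos u)) (hk : 1 ≤ k) {τ : Fin n → Fin m}
    (hτ : IsProportionalAssignment k τ) :
    IsSchedule (n / k) app (fun a => a < m) 0 n k (n % k) (schedOf P pos τ) := by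
  have hmem : ∀ x ∈ schedOf P pos τ, ∃ u, τ u ∈ P.approved u ∧ ((τ u : ℕ), pos u) = x := by
    intro x hx
    simpa [schedOf] using hx
  have himg : ∀ b ∈ (schedOf P pos τ).image Prod.fst, ∃ a ∈ Finset.univ.image τ, (a : ℕ) = b := by
    intro b hb
    obtain ⟨x, hx, rfl⟩ := Finset.mem_image.1 hb
    obtain ⟨u, -, rfl⟩ := hmem x hx
    exact ⟨τ u, by simp, rfl⟩
  refine ⟨?_, ?_, ?_, ?_, ?_, ?_, ?_, ?_⟩
  · intro x hx y hy hxy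
    obtain ⟨u, -, rfl⟩ := hmem x hx
    obtain ⟨v, -, rfl⟩ := hmem y hy
    rw [hpos hxy]
  · intro x hx
    obtain ⟨u, hu, rfl⟩ := hmem x hx
    exact happ u _ hu
  · intro x hx
    obtain ⟨u, hu, rfl⟩ := hmem x hx
    exact (τ u).2
  · intro x hx
    obtain ⟨u, hu, rfl⟩ := hmem x hx
    exact hlt u
  · intro x _ p hp
    omega
  · rw [← hτ.1, ← Finset.card_image_of_injective (Finset.univ.image τ) Fin.val_injective]
    refine (Finset.card_filter_le _ _).trans (Finset.card_le_card fun b hb => ?_)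
    obtain ⟨a, ha, rfl⟩ := himg b hb
    exact Finset.mem_image_of_mem _ ha
  · set Lg := (Finset.univ.image τ).filter fun a =>
      n / k + 1 ≤ (Finset.univ.filter fun v => τ v = a).card with hLg
    have h1 : jobCount (schedOf P pos τ) (n / k + 1) ≤ Lg.card := by
      rw [← Finset.card_image_of_injective Lg Fin.val_injective]
      refine Finset.card_le_card fun b hb => ?_
      obtain ⟨hb1, hb2⟩ := Finset.mem_filter.1 hb
      obtain ⟨a, ha, rfl⟩ := himg b hb1
      exact Finset.mem_image_of_mem _ (Finset.mem_filter.2 ⟨ha, hb2.trans (jobLoad_schedOf_le τ a)⟩)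
    have h2 : n = ∑ a ∈ Finset.univ.image τ, (Finset.univ.filter fun v => τ v = a).card := by
      rw [← Finset.card_eq_sum_card_image]
      simp
    -- Each of the `k` loads is at least `n / k`, and the long ones contribute one more each, so at
    -- most `n % k` are long.
    have h3 : k * (n / k) + Lg.card ≤ n := by
      conv_rhs => rw [h2]
      rw [hLg, Finset.card_filter, ← hτ.1, ← smul_eq_mul, ← Finset.sum_const,
        ← Finset.sum_add_distrib, hτ.1]
      refine Finset.sum_le_sum fun a ha => ?_
      have := hτ.bounds hk ha
      split_ifs <;> omega
    have := Nat.div_add_mod n k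
    omega
  · unfold jobCount
    rw [Finset.card_eq_zero, Finset.filter_eq_empty_iff]
    intro b hb
    obtain ⟨a, ha, rfl⟩ := himg b hb
    have := hτ.bounds hk ha
    have := jobLoad_schedOf_le (P := P) (pos := pos) τ a
    omega

/-- `S` is the table of the schedule `A`. -/
def IsTableOf (n : ℕ) (pos : ℕ → ℕ) (A : Finset (ℕ × ℕ)) (S : ℕ → ℕ) : Prop :=
  ∀ u < n, ∀ a, S u = a + 1 ↔ (a, pos u) ∈ A

theorem IsTableOf.tabLoad_eq {pos S : ℕ → ℕ} {A : Finset (ℕ × ℕ)} (h : IsTableOf n pos A S)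
    (hinj : ∀ u < n, ∀ v < n, pos u = pos v → u = v)
    (hsurj : ∀ x ∈ A, ∃ u < n, pos u = x.2) (b : ℕ) : tabLoad n S b = jobLoad A b := by
  unfold tabLoad jobLoad
  rw [← Finset.card_filter]
  refine Finset.card_bij (fun u _ => (b, pos u)) ?_ ?_ ?_
  · intro u hu
    obtain ⟨h1, h2⟩ := Finset.mem_filter.1 hu
    exact Finset.mem_filter.2 ⟨(h u (Finset.mem_range.1 h1) b).1 h2, rfl⟩
  · intro u hu v hv huv
    exact hinj u (Finset.mem_range.1 (Finset.mem_filter.1 hu).1) v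
      (Finset.mem_range.1 (Finset.mem_filter.1 hv).1) (Prod.mk.inj huv).2
  · rintro ⟨c, p⟩ hx
    obtain ⟨h1, rfl⟩ := Finset.mem_filter.1 hx
    obtain ⟨u, hu, rfl⟩ := hsurj _ h1
    exact ⟨u, Finset.mem_filter.2 ⟨Finset.mem_range.2 hu, (h u hu c).2 h1⟩, rfl⟩

/-- The condition `1 ≤ θ` matters: for `θ = 0` the table count includes unused alternatives, which
`jobCount` ignores. -/
theorem IsTableOf.tabCount_le {pos S : ℕ → ℕ} {A : Finset (ℕ × ℕ)} (h : IsTableOf n pos A S)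
    (hinj : ∀ u < n, ∀ v < n, pos u = pos v → u = v)
    (hsurj : ∀ x ∈ A, ∃ u < n, pos u = x.2) {θ : ℕ} (hθ : 1 ≤ θ) :
    tabCount n m S θ ≤ jobCount A θ := by
  unfold tabCount jobCount
  rw [← Finset.card_filter]
  refine Finset.card_le_card fun b hb => ?_
  obtain ⟨-, hb⟩ := Finset.mem_filter.1 hb
  rw [h.tabLoad_eq hinj hsurj] at hb
  refine Finset.mem_filter.2 ⟨?_, hb⟩
  obtain ⟨x, hx⟩ := Finset.card_pos.1 (hθ.trans hb)
  obtain ⟨h1, rfl⟩ := Finset.mem_filter.1 hx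
  exact Finset.mem_image_of_mem _ h1

theorem IsTableOf.isPartialAssignment {pos S : ℕ → ℕ} {A : Finset (ℕ × ℕ)} {q r s t : ℕ}
    {app : ℕ → ℕ → Prop} (h : IsTableOf n pos A S)
    (hinj : ∀ u < n, ∀ v < n, pos u = pos v → u = v)
    (hsurj : ∀ p < n, ∃ u < n, pos u = p) (ht : t ≤ n)
    (hA : IsSchedule q app (fun a => a < m) s t k r A) : IsPartialAssignment n m k q r S := by
  have hs : ∀ x ∈ A, ∃ u < n, pos u = x.2 := fun x hx => hsurj _ ((hA.lt x hx).trans_le ht)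
  refine ⟨fun u hu => ?_, (h.tabCount_le hinj hs le_rfl).trans hA.count_one,
    (h.tabCount_le hinj hs (by omega)).trans hA.count_long,
    Nat.le_zero.1 ((h.tabCount_le hinj hs (by omega)).trans hA.count_over.le)⟩
  rcases Nat.eq_zero_or_pos (S u) with h0 | h0
  · omega
  · have := hA.job _ ((h u hu (S u - 1)).1 (by omega))
    simp only at this
    omega

end Conversion

namespace RAM

/-! ## Derived expressions -/

namespace Exp

/-- `if e < f then g else h` -/
def ifLt (e f g h : Exp) : Exp := cond (sub f e) g h

/-- `if e ≤ f then g else h` -/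
def ifLe (e f g h : Exp) : Exp := cond (sub e f) h g

/-- `if e = f then g else h` -/
def ifEq (e f g h : Exp) : Exp := cond (add (sub e f) (sub f e)) h g

/-- `max e f` -/
def max2 (e f : Exp) : Exp := add e (sub f e)

/-- The product of `e` and the length of the loops with tag `b`. -/
def times (b : Bool) (e : Exp) : Exp := bind 30 e (sum b 31 (var 30))

/-- `8 * e` -/
def times8 (e : Exp) : Exp :=
  bind 30 e (bind 30 (add (var 30) (var 30)) (bind 30 (add (var 30) (var 30))
    (add (var 30) (var 30))))

/-- The address of a cell of the four-dimensional array `c`, where variable `3` contains the first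
address after the input. -/
def cell (c : ℕ) (e f g h : Exp) : Exp :=
  add (add (var 3) (times8 (add (times true (add (times true (add (times true e) f)) g)) h)))
    (const c)

/-- An entry of the array `c`. -/
def get (c : ℕ) (e f g h : Exp) : Exp := load (cell c e f g h)

/-- The entry of the approval matrix for the voter `e` and the alternative `f`. -/
def input (e f : Exp) : Exp := ifLt e (var 0) (load (add (times false e) f)) (const 0)

end Exp

/-- The address of a cell of the array `c`. -/
def cellAddr (N Z c i j k l : ℕ) : ℕ := Z + 8 * (N * (N * (N * i + j) + k) + l) + c

section Eval

variable {sz : Bool → ℕ} {mem env : ℕ → ℕ}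

open Exp

@[simp] theorem eval_ifLt (e f g h : Exp) : (ifLt e f g h).eval sz mem env =
    if e.eval sz mem env < f.eval sz mem env then g.eval sz mem env else h.eval sz mem env := by
  simp only [ifLt, eval]
  exact if_congr (by omega) rfl rfl

@[simp] theorem eval_ifLe (e f g h : Exp) : (ifLe e f g h).eval sz mem env =
    if e.eval sz mem env ≤ f.eval sz mem env then g.eval sz mem env else h.eval sz mem env := by
  simp only [ifLe, eval]
  exact (ite_not _ _ _).symm.trans (if_congr (by omega) rfl rfl)

@[simp] theorem eval_ifEq (e f g h : Exp) : (ifEq e f g h).eval sz mem env =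
    if e.eval sz mem env = f.eval sz mem env then g.eval sz mem env else h.eval sz mem env := by
  simp only [ifEq, eval]
  exact (ite_not _ _ _).symm.trans (if_congr (by omega) rfl rfl)

@[simp] theorem eval_max2 (e f : Exp) : (max2 e f).eval sz mem env =
    max (e.eval sz mem env) (f.eval sz mem env) := by
  simp only [max2, eval]
  omega

@[simp] theorem eval_times (b : Bool) (e : Exp) :
    (times b e).eval sz mem env = sz b * e.eval sz mem env := by
  simp [times, eval]

@[simp] theorem eval_times8 (e : Exp) : (times8 e).eval sz mem env = 8 * e.eval sz mem env := by
  simp [times8, eval]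
  omega

@[simp] theorem eval_cell (c : ℕ) (e f g h : Exp) : (cell c e f g h).eval sz mem env =
    cellAddr (sz true) (env 3) c (e.eval sz mem env) (f.eval sz mem env) (g.eval sz mem env)
      (h.eval sz mem env) := by
  simp [cell, eval, cellAddr]

@[simp] theorem eval_get (c : ℕ) (e f g h : Exp) : (get c e f g h).eval sz mem env =
    mem (cellAddr (sz true) (env 3) c (e.eval sz mem env) (f.eval sz mem env) (g.eval sz mem env)
      (h.eval sz mem env)) := by
  simp [Exp.get, eval]

end Eval

/-! ## Arrays in memory -/

theorem mul_add_inj {N a b a' b' : ℕ} (hb : b < N) (hb' : b' < N) (h : N * a + b = N * a' + b') :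
    a = a' ∧ b = b' := by
  have h1 := congrArg (· / N) h
  have h2 := congrArg (· % N) h
  simp only [Nat.mul_add_div (Nat.zero_lt_of_lt hb), Nat.div_eq_of_lt hb, Nat.div_eq_of_lt hb',
    Nat.mul_add_mod, Nat.mod_eq_of_lt hb, Nat.mod_eq_of_lt hb', add_zero] at h1 h2
  exact ⟨h1, h2⟩

/-- The eight arrays are interleaved, with the array number as residue modulo 8. The first index is
the leading digit and needs no bound. -/
theorem cellAddr_inj {N Z c i j k l c' i' j' k' l' : ℕ} (hc : c < 8) (hj : j < N) (hk : k < N)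
    (hl : l < N) (hc' : c' < 8) (hj' : j' < N) (hk' : k' < N) (hl' : l' < N)
    (h : cellAddr N Z c i j k l = cellAddr N Z c' i' j' k' l') :
    c = c' ∧ i = i' ∧ j = j' ∧ k = k' ∧ l = l' := by
  unfold cellAddr at h
  obtain ⟨h1, h2⟩ := mul_add_inj hl hl'
    (show N * (N * (N * i + j) + k) + l = N * (N * (N * i' + j') + k') + l' by omega)
  obtain ⟨h3, h4⟩ := mul_add_inj hk hk' h1
  obtain ⟨h5, h6⟩ := mul_add_inj hj hj' h3
  exact ⟨by omega, h5, h6, h4, h2⟩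

/-- A four-dimensional table. -/
abbrev Table := ℕ → ℕ → ℕ → ℕ → ℕ

/-- The memory contains the `n × m` matrix `inp` and, behind it, the arrays `T c` for `c < 8` of
side length `n + 1`. -/
structure Represents (n m : ℕ) (inp : ℕ → ℕ → ℕ) (T : ℕ → Table) (mem : ℕ → ℕ) : Prop where
  matrix : ∀ u < n, ∀ a < m, mem (m * u + a) = inp u a
  table : ∀ c < 8, ∀ i < n + 1, ∀ j < n + 1, ∀ k < n + 1, ∀ l < n + 1,
    mem (cellAddr (n + 1) (m * n) c i j k l) = T c i j k l

/-- The lengths of the loops for `n` voters and `m` alternatives. -/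
def sizes (n m : ℕ) (b : Bool) : ℕ := if b then n + 1 else m

@[simp] theorem sizes_true (n m : ℕ) : sizes n m true = n + 1 := rfl

@[simp] theorem sizes_false (n m : ℕ) : sizes n m false = m := rfl

variable {n m : ℕ} {inp : ℕ → ℕ → ℕ} {T : ℕ → Table} {mem env : ℕ → ℕ}

theorem Represents.eval_input (h : Represents n m inp T mem) (h0 : env 0 = n)
    (hinp : ∀ u a, n ≤ u → inp u a = 0) {e f : Exp}
    (hf : f.eval (sizes n m) mem env < m) : (Exp.input e f).eval (sizes n m) mem env =
      inp (e.eval (sizes n m) mem env) (f.eval (sizes n m) mem env) := by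
  simp only [Exp.input, eval_ifLt, Exp.eval, h0, eval_times, sizes_false]
  split_ifs with hlt
  · exact h.matrix _ hlt _ hf
  · exact (hinp _ _ (by omega)).symm

theorem Represents.get (h : Represents n m inp T mem) (c : ℕ) {i j k l : ℕ} (hi : i ≤ n)
    (hj : j ≤ n) (hk : k ≤ n) (hl : l ≤ n) (hc : c < 8) :
    mem (cellAddr (n + 1) (m * n) c i j k l) = T c i j k l :=
  h.table c hc i (by omega) j (by omega) k (by omega) l (by omega)

/-- Compute all entries of the array `c`; the indices are the variables `10` to `13`. -/
def Cmd.fill (c : ℕ) (e : Exp) : Cmd :=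
  .loop true 10 (.loop true 11 (.loop true 12 (.loop true 13
    (.store (.cell c (.var 10) (.var 11) (.var 12) (.var 13)) e))))

theorem Cmd.run_loop_induct {sz : Bool → ℕ} {b : Bool} {x : ℕ} {c : Cmd} (I : ℕ → (ℕ → ℕ) → Prop)
    (h0 : I 0 mem)
    (h : ∀ i < sz b, ∀ mem, I i mem → I (i + 1) (c.run sz (Function.update env x i) mem)) :
    I (sz b) ((Cmd.loop b x c).run sz env mem) := by
  have : ∀ j ≤ sz b,
      I j (Nat.rec mem (fun i mem' => c.run sz (Function.update env x i) mem') j) := by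
    intro j
    induction j with
    | zero => exact fun _ => h0
    | succ j ih => exact fun hj => h j (by omega) _ (ih (by omega))
  exact this _ le_rfl

theorem Cmd.run_loop_union {α : Type*} {sz : Bool → ℕ} {b : Bool} {x : ℕ} {c : Cmd}
    (Q : Set α → (ℕ → ℕ) → Prop) (A : ℕ → Set α)
    (h : ∀ i < sz b, ∀ S mem, Q S mem → Q (S ∪ A i) (c.run sz (Function.update env x i) mem))
    (S : Set α) (hS : Q S mem) :
    Q (S ∪ ⋃ i < sz b, A i) ((Cmd.loop b x c).run sz env mem) := by
  refine Cmd.run_loop_induct (fun i mem => Q (S ∪ ⋃ j < i, A j) mem) (by simpa using hS) ?_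
  intro i hi mem hmem
  have := h i hi _ mem hmem
  rwa [Set.union_assoc, ← Set.biUnion_lt_succ] at this

/-- During the loops the array `c` is only partly filled, so `e` must have the right value whatever
`c` contains. For this reason, updates that depend on the old content of an array are computed in
another array and then copied. -/
theorem Represents.fill (hT : Represents n m inp T mem) (h3 : env 3 = m * n) {c : ℕ} {e : Exp}
    (G : Table)
    (hG : ∀ mem' T', Represents n m inp T' mem' → (∀ c', c' ≠ c → T' c' = T c') →
      ∀ i j k l, i ≤ n → j ≤ n → k ≤ n → l ≤ n → e.eval (sizes n m) mem'
        (Function.update (Function.update (Function.update (Function.update env 10 i) 11 j) 12 k)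
          13 l) = G i j k l) (hc : c < 8 := by decide) :
    Represents n m inp (Function.update T c G) ((Cmd.fill c e).run (sizes n m) env mem) := by
  set Q : Set (ℕ × ℕ × ℕ × ℕ) → (ℕ → ℕ) → Prop := fun S mem' =>
    (∃ T', Represents n m inp T' mem' ∧ ∀ c', c' ≠ c → T' c' = T c') ∧
      ∀ i ≤ n, ∀ j ≤ n, ∀ k ≤ n, ∀ l ≤ n, (i, j, k, l) ∈ S →
        mem' (cellAddr (n + 1) (m * n) c i j k l) = G i j k l with hQ
  have hstore : ∀ i < sizes n m true, ∀ j < sizes n m true, ∀ k < sizes n m true,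
      ∀ l < sizes n m true, ∀ S mem', Q S mem' → Q (S ∪ {(i, j, k, l)})
        ((Cmd.store (.cell c (.var 10) (.var 11) (.var 12) (.var 13)) e).run (sizes n m)
          (Function.update (Function.update (Function.update (Function.update env 10 i) 11 j) 12 k)
            13 l) mem') := by
    rintro i hi j hj k hk l hl S mem' ⟨⟨T', hT', hT'T⟩, hS⟩
    simp only [sizes_true] at hi hj hk hl
    have hval := hG mem' T' hT' hT'T i j k l (by omega) (by omega) (by omega) (by omega)
    simp only [Cmd.run, hval, eval_cell, Exp.eval, sizes_true]
    simp only [Function.update_apply, h3, Nat.reduceEqDiff, if_true, if_false]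
    -- The new content of `c` is read off the memory itself, since it is not specified outside `S`.
    refine ⟨⟨fun c' => if c' = c then fun i' j' k' l' => Function.update mem'
      (cellAddr (n + 1) (m * n) c i j k l) (G i j k l) (cellAddr (n + 1) (m * n) c i' j' k' l')
        else T' c', ⟨?_, ?_⟩, ?_⟩, ?_⟩
    · intro u hu a ha
      rw [Function.update_of_ne, hT'.matrix u hu a ha]
      have : m * u + a < m * n := by nlinarith
      unfold cellAddr
      omega
    · intro c' hc' i' hi' j' hj' k' hk' l' hl'
      by_cases hcc : c' = c
      · subst hcc
        simp
      · rw [Function.update_of_ne, if_neg hcc, hT'.table c' hc' i' hi' j' hj' k' hk' l' hl']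
        exact fun h => hcc (cellAddr_inj hc' hj' hk' hl' hc hj hk hl h).1
    · intro c' hc'
      exact (if_neg hc').trans (hT'T c' hc')
    · intro i' hi' j' hj' k' hk' l' hl' hmem
      by_cases heq : (i', j', k', l') = (i, j, k, l)
      · simp only [Prod.mk.injEq] at heq
        obtain ⟨rfl, rfl, rfl, rfl⟩ := heq
        simp
      · rw [Function.update_of_ne]
        · exact hS i' hi' j' hj' k' hk' l' hl' (hmem.resolve_right heq)
        · intro h
          obtain ⟨-, rfl, rfl, rfl, rfl⟩ :=
            cellAddr_inj hc (by omega) (by omega) (by omega) hc hj hk hl h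
          exact heq rfl
  have hfin := Cmd.run_loop_union (mem := mem) (env := env) (sz := sizes n m) (b := true)
    (x := 10) Q
    (fun i => ⋃ j < sizes n m true, ⋃ k < sizes n m true, ⋃ l < sizes n m true, {(i, j, k, l)})
    (fun i hi S mem hS => Cmd.run_loop_union (x := 11) Q
      (fun j => ⋃ k < sizes n m true, ⋃ l < sizes n m true, {(i, j, k, l)})
      (fun j hj S mem hS => Cmd.run_loop_union (x := 12) Q
        (fun k => ⋃ l < sizes n m true, {(i, j, k, l)})
        (fun k hk S mem hS => Cmd.run_loop_union (x := 13) Q (fun l => {(i, j, k, l)})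
          (fun l hl S mem hS => hstore i hi j hj k hk l hl S mem hS) S hS) S hS) S hS)
    ∅ ⟨⟨T, hT, fun _ _ => rfl⟩, by simp⟩
  obtain ⟨⟨T', hT', hT'T⟩, hS⟩ := hfin
  refine ⟨hT'.matrix, fun c' hc' i hi j hj k hk l hl => ?_⟩
  by_cases hcc : c' = c
  · subst hcc
    rw [Function.update_self]
    refine hS i (by omega) j (by omega) k (by omega) l (by omega) ?_
    simp only [Set.empty_union, Set.mem_iUnion, sizes_true]
    exact ⟨i, hi, j, hj, k, hk, l, hl, rfl⟩
  · rw [Function.update_of_ne hcc, ← hT'T c' hcc]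
    exact hT'.table c' hc' i hi j hj k hk l hl

end RAM

namespace RAM

open Exp

/-! ## The program: labels and positions -/

/-- The environment contains the parameters of an instance. -/
structure IsContext (n m k : ℕ) (env : ℕ → ℕ) : Prop where
  h0 : env 0 = n
  h1 : env 1 = m
  h2 : env 2 = k
  h3 : env 3 = m * n
  h4 : env 4 = n / k
  h5 : env 5 = n % k
  h6 : env 6 = (m + 1) ^ n

theorem IsContext.update {n m k : ℕ} {env : ℕ → ℕ} (h : IsContext n m k env) {x v : ℕ}
    (hx : 7 ≤ x) : IsContext n m k (Function.update env x v) := by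
  constructor <;> rw [Function.update_of_ne (by omega)]
  exacts [h.h0, h.h1, h.h2, h.h3, h.h4, h.h5, h.h6]

variable {n m k : ℕ} {inp : ℕ → ℕ → ℕ} {T : ℕ → Table} {mem env : ℕ → ℕ}

/-- The entry of the array `c` at the indices of the current cell. -/
def copyExp (c : ℕ) : Exp := .get c (.var 10) (.var 11) (.var 12) (.var 13)

theorem Represents.copy (hT : Represents n m inp T mem) (h3 : env 3 = m * n) (c c' : ℕ)
    (hcc : c' ≠ c := by decide) (hc : c < 8 := by decide) (hc' : c' < 8 := by decide) :
    Represents n m inp (Function.update T c (T c'))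
      ((Cmd.fill c (copyExp c')).run (sizes n m) env mem) := by
  refine hT.fill h3 _ (fun mem' T' hT' hT'T i j k l hi hj hk hl => ?_) hc
  rw [← hT'T c' hcc]
  simp [copyExp, Exp.eval, h3, hT'.get c' hi hj hk hl hc']

/-- One round of the propagation of labels. -/
def labStep (n m : ℕ) (inp L : ℕ → ℕ → ℕ) (u v : ℕ) : ℕ :=
  max (L u v) ((Finset.range (n + 1)).sup fun w => (Finset.range m).sup fun a =>
    if inp w a ≠ 0 then
      max (if inp v a ≠ 0 then if inp u a ≠ 0 then 0 else L u w else 0)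
        (if inp u a ≠ 0 then if inp v a ≠ 0 then 0 else L w v else 0)
    else 0)

/-- The labels after `i` rounds. -/
def labIter (n m : ℕ) (inp : ℕ → ℕ → ℕ) : ℕ → ℕ → ℕ → ℕ
  | 0 => fun u v => (n + 1) * u + v
  | i + 1 => labStep n m inp (labIter n m inp i)

/-- The expression for `labStep`. -/
def labExp : Exp :=
  max2 (copyExp 0) (.sup true 17 (.sup false 18 (.cond (input (.var 17) (.var 18))
    (max2
      (.cond (input (.var 11) (.var 18)) (.cond (input (.var 10) (.var 18)) (.const 0)
        (.get 0 (.var 10) (.var 17) (.var 12) (.var 13))) (.const 0))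
      (.cond (input (.var 10) (.var 18)) (.cond (input (.var 11) (.var 18)) (.const 0)
        (.get 0 (.var 17) (.var 11) (.var 12) (.var 13))) (.const 0)))
    (.const 0))))

/-- Compute the labels in the array `0`. -/
def labCmd : Cmd :=
  .seq (.fill 0 (.add (.times true (.var 10)) (.var 11)))
    (.loop true 14 (.loop true 15 (.seq (.fill 1 labExp) (.fill 0 (copyExp 1)))))

/-- Two nested loops provide `(n + 1) * (n + 1)` rounds, no fewer than there are pairs of voters.
Array 1 is a buffer for one round. -/
theorem Represents.run_labCmd (hT : Represents n m inp T mem) (hinp : ∀ u a, n ≤ u → inp u a = 0)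
    (hc : IsContext n m k env) :
    ∃ T', Represents n m inp T' (labCmd.run (sizes n m) env mem) ∧
      T' 0 = fun u v _ _ => labIter n m inp ((n + 1) * (n + 1)) u v := by
  have h0 : Represents n m inp (Function.update T 0 fun u v _ _ => labIter n m inp 0 u v)
      ((Cmd.fill 0 (.add (.times true (.var 10)) (.var 11))).run (sizes n m) env mem) := by
    refine hT.fill hc.h3 _ fun mem' T' hT' hT'T i j k l hi hj hk hl => ?_
    simp [Exp.eval, labIter]
  have hround : ∀ env, IsContext n m k env → ∀ i T mem, Represents n m inp T mem →
      (T 0 = fun u v _ _ => labIter n m inp i u v) → ∃ T', Represents n m inp T'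
        ((Cmd.seq (.fill 1 labExp) (.fill 0 (copyExp 1))).run (sizes n m) env mem) ∧
          T' 0 = fun u v _ _ => labIter n m inp (i + 1) u v := by
    intro env hc i T mem hT hT0
    have h1 : Represents n m inp (Function.update T 1 fun u v _ _ => labIter n m inp (i + 1) u v)
        ((Cmd.fill 1 labExp).run (sizes n m) env mem) := by
      refine hT.fill hc.h3 _ fun mem' T' hT' hT'T u v κ μ hu hv hκ hμ => ?_
      have hT0' := (hT'T 0 (by decide)).trans hT0
      simp only [labExp, copyExp, eval_max2, eval_get, Exp.eval, sizes_true, sizes_false, labIter,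
        labStep]
      congr 1
      · simp [hc.h3, hT'.get, hu, hv, hκ, hμ, hT0']
      refine Finset.sup_congr rfl fun w hw => Finset.sup_congr rfl fun a ha => ?_
      have hw' : w ≤ n := by simpa [Nat.lt_succ_iff] using hw
      have ha' : a < m := by simpa using ha
      rw [hT'.eval_input (by simpa using hc.h0) hinp (by simpa [Exp.eval] using ha'),
        hT'.eval_input (by simpa using hc.h0) hinp (by simpa [Exp.eval] using ha'),
        hT'.eval_input (by simpa using hc.h0) hinp (by simpa [Exp.eval] using ha')]
      simp [Exp.eval, hc.h3, hT'.get, hu, hv, hκ, hμ, hT0', hw']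
    exact ⟨_, h1.copy hc.h3 0 1, by simp⟩
  refine Cmd.run_loop_induct (b := true) (sz := sizes n m) (fun i mem => ∃ T',
    Represents n m inp T' mem ∧ T' 0 = fun u v _ _ => labIter n m inp ((n + 1) * i) u v)
      ⟨_, h0, by simp⟩ ?_
  rintro i - mem ⟨T₁, hT₁, hT₁0⟩
  refine Cmd.run_loop_induct (b := true) (sz := sizes n m) (fun j mem => ∃ T',
    Represents n m inp T' mem ∧ T' 0 = fun u v _ _ => labIter n m inp ((n + 1) * i + j) u v)
      ⟨T₁, hT₁, hT₁0⟩ ?_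
  rintro j - mem ⟨T₂, hT₂, hT₂0⟩
  exact hround _ ((hc.update (by decide)).update (by decide)) _ T₂ mem hT₂ hT₂0

/-- The position of the voter `u` in the order determined by the labels. -/
def labPos (n : ℕ) (lab : ℕ → ℕ → ℕ) (u : ℕ) : ℕ :=
  ∑ v ∈ Finset.range (n + 1), if v < n then if lab u v < lab v u then 1 else 0 else 0

/-- The voter at the position `p`. -/
def voterAt (n : ℕ) (pos : ℕ → ℕ) (p : ℕ) : ℕ :=
  ∑ u ∈ Finset.range (n + 1), if u < n then if pos u = p then u else 0 else 0

/-- Compute the positions in the array `2` and the voters in the array `3`. -/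
def posCmd : Cmd :=
  .seq (.fill 2 (.sum true 17 (ifLt (.var 17) (.var 0)
      (ifLt (.get 0 (.var 10) (.var 17) (.const 0) (.const 0))
        (.get 0 (.var 17) (.var 10) (.const 0) (.const 0)) (.const 1) (.const 0)) (.const 0))))
    (.fill 3 (.sum true 17 (ifLt (.var 17) (.var 0)
      (ifEq (.get 2 (.var 17) (.const 0) (.const 0) (.const 0)) (.var 10) (.var 17) (.const 0))
        (.const 0))))

theorem Represents.run_posCmd (hT : Represents n m inp T mem) (hc : IsContext n m k env)
    {lab : ℕ → ℕ → ℕ} (hlab : T 0 = fun u v _ _ => lab u v) :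
    ∃ T', Represents n m inp T' (posCmd.run (sizes n m) env mem) ∧
      (T' 2 = fun u _ _ _ => labPos n lab u) ∧
        T' 3 = fun p _ _ _ => voterAt n (labPos n lab) p := by
  have h1 := hT.fill (c := 2) (e := .sum true 17 (ifLt (.var 17) (.var 0)
      (ifLt (.get 0 (.var 10) (.var 17) (.const 0) (.const 0))
        (.get 0 (.var 17) (.var 10) (.const 0) (.const 0)) (.const 1) (.const 0)) (.const 0)))
    hc.h3 (fun u _ _ _ => labPos n lab u)
    (fun mem' T' hT' hT'T u v κ μ hu hv hκ hμ => by
      have hT0' := (hT'T 0 (by decide)).trans hlab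
      simp only [Exp.eval, eval_ifLt, eval_get, sizes_true, labPos]
      refine Finset.sum_congr rfl fun w hw => ?_
      have hw' : w ≤ n := by simpa [Nat.lt_succ_iff] using hw
      simp [hc.h3, hc.h0, hT'.get, hu, hT0', hw'])
  refine ⟨_, h1.fill hc.h3 (fun p _ _ _ => voterAt n (labPos n lab) p) ?_, by simp, by simp⟩
  intro mem' T' hT' hT'T u v κ μ hu hv hκ hμ
  have hT2' := hT'T 2 (by decide)
  rw [Function.update_self] at hT2'
  simp only [Exp.eval, eval_ifLt, eval_ifEq, eval_get, sizes_true, voterAt]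
  refine Finset.sum_congr rfl fun w hw => ?_
  have hw' : w ≤ n := by simpa [Nat.lt_succ_iff] using hw
  simp [hc.h3, hc.h0, hT'.get, hT2', hw']

/-! ## The program: dynamic programming -/

/-- Nonzero if the alternative `a` is approved by the voter at the position `p`. -/
def slotVal (n : ℕ) (inp : ℕ → ℕ → ℕ) (vot : ℕ → ℕ) (a p : ℕ) : ℕ :=
  if p < n then inp (vot p) a else 0

/-- The alternative `a` is approved by the voter at the position `p`. -/
def appAt (n : ℕ) (inp : ℕ → ℕ → ℕ) (vot : ℕ → ℕ) (a p : ℕ) : Prop := slotVal n inp vot a p ≠ 0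

instance (n : ℕ) (inp : ℕ → ℕ → ℕ) (vot : ℕ → ℕ) (a p : ℕ) : Decidable (appAt n inp vot a p) :=
  inferInstanceAs (Decidable (slotVal n inp vot a p ≠ 0))

/-- The expression for `slotVal`. -/
def slotExp (a p : Exp) : Exp :=
  ifLt p (.var 0) (input (.get 3 p (.const 0) (.const 0) (.const 0)) a) (.const 0)

theorem Represents.eval_slotExp (h : Represents n m inp T mem) (h0 : env 0 = n)
    (h3 : env 3 = m * n) (hinp : ∀ u a, n ≤ u → inp u a = 0) {vot : ℕ → ℕ}
    (hvot : T 3 = fun p _ _ _ => vot p) {a p : Exp} (ha : a.eval (sizes n m) mem env < m)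
    (hp : p.eval (sizes n m) mem env ≤ n) : (slotExp a p).eval (sizes n m) mem env =
      slotVal n inp vot (a.eval (sizes n m) mem env) (p.eval (sizes n m) mem env) := by
  rw [slotExp, eval_ifLt, h.eval_input h0 hinp ha]
  simp [h0, Exp.eval, h3, h.get, hp, hvot, slotVal]

/-- The power of `m + 1` with exponent `e`. -/
def powExp (e : Exp) : Exp :=
  .bind 24 e (.iter true 22 23 (.const 1) (ifLt (.var 22) (.var 24)
    (.add (.times false (.var 23)) (.var 23)) (.var 23)))

/-- There is no multiplication: a factor `m + 1` is formed as `m * v + v`, where `m * v` is itself a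
loop. The loop has fixed length and idles once `e` factors have been collected, whence the minimum.
-/
theorem rec_pow (m e j : ℕ) :
    Nat.rec 1 (fun i v => if i < e then m * v + v else v) j = (m + 1) ^ min e j := by
  induction j with
  | zero => simp
  | succ j ih =>
    simp only [ih]
    split_ifs with h
    · rw [min_eq_right h.le, min_eq_right (show j + 1 ≤ e from h), pow_succ]
      ring
    · rw [min_eq_left (by omega), min_eq_left (by omega)]

@[simp] theorem eval_powExp (e : Exp) : (powExp e).eval (sizes n m) mem env =
    (m + 1) ^ min (e.eval (sizes n m) mem env) (n + 1) := by
  rw [← rec_pow]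
  simp [powExp, Exp.eval]

theorem sum_range_ite_le {m a : ℕ} (ha : a < m) (c : ℕ) :
    (∑ x ∈ Finset.range m, if x ≤ a then c else 0) = (a + 1) * c := by
  rw [← Finset.sum_filter, Finset.sum_const, smul_eq_mul]
  congr 1
  rw [show (Finset.range m).filter (fun x => x ≤ a) = Finset.range (a + 1) by
    ext x; simp; omega, Finset.card_range]

theorem sum_range_ite_lt {m a : ℕ} (ha : a ≤ m) (c : ℕ) :
    (∑ x ∈ Finset.range m, if x < a then c else 0) = a * c := by
  rw [← Finset.sum_filter, Finset.sum_const, smul_eq_mul]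
  congr 1
  rw [show (Finset.range m).filter (fun x => x < a) = Finset.range a by
    ext x; simp; omega, Finset.card_range]

/-- The weight of the alternative `a` at the position `p`. Up to multiples of `(m + 1) ^ n`, the
total weight of a partial assignment encodes the assignment in base `m + 1`. -/
def slotWeight (n m a p : ℕ) : ℕ := (m + 1) ^ n + (a + 1) * (m + 1) ^ p

/-- The expression for the weight of the current alternative at the position in variable `17`. -/
def weightExp : Exp :=
  .add (.var 6) (.bind 25 (powExp (.var 17))
    (.sum false 27 (ifLe (.var 27) (.var 15) (.var 25) (.const 0))))

theorem eval_weightExp (h6 : env 6 = (m + 1) ^ n) (ha : env 15 < m) (hp : env 17 ≤ n) :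
    weightExp.eval (sizes n m) mem env = slotWeight n m (env 15) (env 17) := by
  simp [weightExp, Exp.eval, h6, slotWeight, sum_range_ite_le ha,
    min_eq_left (show env 17 ≤ n + 1 by omega)]

/-- The expression for `dpExtend`. -/
def extendExp : Exp :=
  .sup true 17 (.sup true 18 (.sup true 19
    (ifLe (.var 10) (.var 17) (ifLt (.var 17) (.var 11) (.cond (slotExp (.var 15) (.var 17))
      (ifLe (.var 18) (.var 12) (ifLe (.var 19) (.var 13)
        (.add (.add (.get 5 (.var 10) (.var 17) (.var 18) (.var 19)) weightExp)
          (.get 4 (.add (.var 17) (.const 1)) (.var 11) (.sub (.var 12) (.var 18))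
            (.sub (.var 13) (.var 19))))
      (.const 0)) (.const 0)) (.const 0)) (.const 0)) (.const 0))))

theorem Represents.eval_extendExp (h : Represents n m inp T mem) (hc : IsContext n m k env)
    (hinp : ∀ u a, n ≤ u → inp u a = 0) {vot : ℕ → ℕ} (hvot : T 3 = fun p _ _ _ => vot p)
    (ha : env 15 < m) {s t κ μ : ℕ} (hs : env 10 = s) (ht : env 11 = t) (hκ : env 12 = κ)
    (hμ : env 13 = μ) (hs' : s ≤ n) (ht' : t ≤ n) (hκ' : κ ≤ n) (hμ' : μ ≤ n) :
    extendExp.eval (sizes n m) mem env =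
      dpExtend (appAt n inp vot) (n + 1) (slotWeight n m) (env 15) (T 5) (T 4)
        s t κ μ := by
  simp only [extendExp, Exp.eval, sizes_true, dpExtend]
  refine Finset.sup_congr rfl fun p hp => Finset.sup_congr rfl fun κ₁ hκ₁ =>
    Finset.sup_congr rfl fun μ₁ hμ₁ => ?_
  have hp' : p ≤ n := by simpa [Nat.lt_succ_iff] using hp
  simp only [eval_ifLe, eval_ifLt, Exp.eval, Function.update_apply, Nat.reduceEqDiff, if_true,
    if_false, hs, ht, hκ, hμ]
  by_cases h1 : s ≤ p
  swap
  · simp [h1]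
  by_cases h2 : p < t
  swap
  · simp [h2]
  rw [h.eval_slotExp (by simpa using hc.h0) (by simpa using hc.h3) hinp hvot
    (by simpa [Exp.eval] using ha) (by simpa [Exp.eval] using hp')]
  simp only [Exp.eval, Function.update_apply, Nat.reduceEqDiff, if_true, if_false]
  by_cases h3 : appAt n inp vot (env 15) p
  swap
  · simp [h3, not_not.1 h3]
  have h3' : slotVal n inp vot (env 15) p ≠ 0 := h3
  by_cases h4 : κ₁ ≤ κ
  swap
  · simp [h4]
  by_cases h5 : μ₁ ≤ μ
  swap
  · simp [h5]
  rw [eval_weightExp (by simpa using hc.h6) (by simpa using ha) (by simpa using hp')]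
  simp [h1, h2, h3, h3', h4, h5, Exp.eval, hs, ht, hκ, hμ, hc.h3, hs', ht', hp',
    h.get, show p + 1 ≤ n by omega, show κ₁ ≤ n by omega, show μ₁ ≤ n by omega,
    show κ - κ₁ ≤ n by omega, show μ - μ₁ ≤ n by omega]

/-- `e` if the current alternative is not approved at positions before the one in variable `10`. -/
def relExp (e : Exp) : Exp :=
  .cond (.sum true 17 (ifLt (.var 17) (.var 10) (.cond (slotExp (.var 15) (.var 17)) (.const 1)
    (.const 0)) (.const 0))) (.const 0) e

theorem Represents.eval_relExp (h : Represents n m inp T mem) (hc : IsContext n m k env)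
    (hinp : ∀ u a, n ≤ u → inp u a = 0) {vot : ℕ → ℕ} (hvot : T 3 = fun p _ _ _ => vot p)
    (ha : env 15 < m) (hs : env 10 ≤ n) (e : Exp) :
    (relExp e).eval (sizes n m) mem env =
      if ∀ p < env 10, ¬ appAt n inp vot (env 15) p then e.eval (sizes n m) mem env
      else 0 := by
  have hsum : (Exp.sum true 17 (ifLt (.var 17) (.var 10) (.cond (slotExp (.var 15) (.var 17))
      (.const 1) (.const 0)) (.const 0))).eval (sizes n m) mem env =
        ∑ p ∈ Finset.range (n + 1), if p < env 10 then
          if slotVal n inp vot (env 15) p ≠ 0 then 1 else 0 else 0 := by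
    simp only [Exp.eval, sizes_true]
    refine Finset.sum_congr rfl fun p hp => ?_
    have hp' : p ≤ n := by simpa [Nat.lt_succ_iff] using hp
    rw [eval_ifLt]
    simp only [Exp.eval]
    rw [h.eval_slotExp (by simpa using hc.h0) (by simpa using hc.h3) hinp hvot
      (by simpa [Exp.eval] using ha) (by simpa [Exp.eval] using hp')]
    simp [Exp.eval]
  rw [relExp, Exp.eval, hsum]
  refine (ite_not _ _ _).trans (if_congr ?_ rfl rfl)
  rw [Finset.sum_eq_zero_iff]
  refine ⟨fun h p hp => ?_, fun h p hp => ?_⟩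
  · have := h p (Finset.mem_range.2 (by omega))
    rw [if_pos hp] at this
    by_contra hne
    rw [if_pos (show slotVal n inp vot (env 15) p ≠ 0 from hne)] at this
    exact one_ne_zero this
  · split_ifs with h1 h2
    · exact absurd h2 (h p h1)
    · rfl
    · rfl

/-- The expression for the next table `dpUpTo`. -/
def upToExp : Exp :=
  max2 (copyExp 7) (ifLe (.var 16) (.var 4) (ifLt (.const 0) (.var 12)
    (ifEq (.var 16) (.var 4)
      (ifLt (.const 0) (.var 13) (relExp (.get 5 (.var 10) (.var 11) (.sub (.var 12) (.const 1))
        (.sub (.var 13) (.const 1)))) (.const 0))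
      (relExp (.get 5 (.var 10) (.var 11) (.sub (.var 12) (.const 1)) (.var 13))))
    (.const 0)) (.const 0))

theorem Represents.eval_upToExp (h : Represents n m inp T mem) (hc : IsContext n m k env)
    (hinp : ∀ u a, n ≤ u → inp u a = 0) {vot : ℕ → ℕ} (hvot : T 3 = fun p _ _ _ => vot p)
    (ha : env 15 < m) {s t κ μ : ℕ} (hs : env 10 = s) (ht : env 11 = t) (hκ : env 12 = κ)
    (hμ : env 13 = μ) (hs' : s ≤ n) (ht' : t ≤ n) (hκ' : κ ≤ n) (hμ' : μ ≤ n) :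
    upToExp.eval (sizes n m) mem env =
      max (T 7 s t κ μ) (dpCand (n / k) (appAt n inp vot) (env 15) (T 5)
        (env 16) s t κ μ) := by
  have hrel := fun e => h.eval_relExp hc hinp hvot ha (hs.trans_le hs') e
  simp only [upToExp, copyExp, eval_max2, eval_get, eval_ifLe, eval_ifLt, eval_ifEq, hrel, Exp.eval,
    hs, ht, hκ, hμ, hc.h3, hc.h4, sizes_true, dpCand, h.get 7 hs' ht' hκ' hμ' (by decide),
    h.get 5 hs' ht' (show κ - 1 ≤ n by omega) hμ' (by decide),
    h.get 5 hs' ht' (show κ - 1 ≤ n by omega) (show μ - 1 ≤ n by omega)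
      (by decide)]
  congr 1
  by_cases h1 : env 16 ≤ n / k
  swap
  · simp [h1]
  by_cases h2 : 0 < κ
  swap
  · simp [h1, show κ = 0 by omega]
  by_cases h3 : env 16 = n / k
  · by_cases h4 : 0 < μ
    · simp [h2, h3, h4, Nat.one_le_iff_ne_zero, h2.ne', h4.ne']
    · simp [h2, h3, show μ = 0 by omega]
  · simp [h1, h2, h3, Nat.one_le_iff_ne_zero, h2.ne']

/-- Process the alternative in variable `15`. -/
def jobCmd : Cmd :=
  .seq (.fill 5 (copyExp 4)) (.seq (.fill 7 (copyExp 4)) (.seq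
    (.loop true 16 (.seq (.fill 6 extendExp) (.seq (.fill 5 (copyExp 6))
      (.seq (.fill 6 upToExp) (.fill 7 (copyExp 6))))))
    (.fill 4 (copyExp 7))))

/-- Array 4 keeps the old table `F`, array 5 holds `dpIter` and array 7 holds `dpUpTo` for the
current number of rounds, and array 6 is a buffer. The `n + 1` rounds yield `dpStep`. -/
theorem Represents.run_jobCmd (hT : Represents n m inp T mem) (hc : IsContext n m k env)
    (hinp : ∀ u a, n ≤ u → inp u a = 0) {vot : ℕ → ℕ} (hvot : T 3 = fun p _ _ _ => vot p)
    (ha : env 15 < m) :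
    ∃ T', Represents n m inp T' (jobCmd.run (sizes n m) env mem) ∧ T' 2 = T 2 ∧ T' 3 = T 3 ∧
      T' 4 = dpStep (n / k) (appAt n inp vot) (n + 1) (slotWeight n m)
        (env 15) (T 4) := by
  set app : ℕ → ℕ → Prop := appAt n inp vot with happ
  have h1 := hT.copy hc.h3 5 4
  have h2 := h1.copy hc.h3 7 4
  obtain ⟨T', hT', e2, e3, e4, -, e7⟩ := Cmd.run_loop_induct (env := env) (b := true)
    (sz := sizes n m) (x := 16)
    (c := .seq (.fill 6 extendExp) (.seq (.fill 5 (copyExp 6))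
      (.seq (.fill 6 upToExp) (.fill 7 (copyExp 6)))))
    (fun i mem => ∃ T', Represents n m inp T' mem ∧ T' 2 = T 2 ∧ T' 3 = T 3 ∧ T' 4 = T 4 ∧
      T' 5 = dpIter app (n + 1) (slotWeight n m) (env 15) (T 4) i ∧
      T' 7 = dpUpTo (n / k) app (n + 1) (slotWeight n m) (env 15) (T 4) i)
    ⟨_, h2, by simp, by simp, by simp, by simp [dpIter], by
      funext s t κ μ
      simp [dpUpTo]⟩ (by
    rintro i - mem ⟨T₁, hT₁, e2, e3, e4, e5, e7⟩
    have hc' : IsContext n m k (Function.update env 16 i) := hc.update (by decide)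
    have g1 := hT₁.fill (c := 6) (e := extendExp) hc'.h3
      (dpIter app (n + 1) (slotWeight n m) (env 15) (T 4) (i + 1))
      (fun mem' T' hT' hT'T s t κ μ hs ht hκ hμ => by
        rw [hT'.eval_extendExp (vot := vot) (s := s) (t := t) (κ := κ) (μ := μ)
          ((((hc'.update (by decide)).update (by decide)).update (by decide)).update (by decide))
          hinp (by rw [hT'T 3 (by decide), e3, hvot]) (by simpa using ha) (by simp) (by simp)
          (by simp) (by simp) hs ht hκ hμ, hT'T 5 (by decide), hT'T 4 (by decide), e5, e4]
        simp [dpIter, happ])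
    have g2 := g1.copy hc'.h3 5 6
    have g3 := g2.fill (c := 6) (e := upToExp) hc'.h3
      (dpUpTo (n / k) app (n + 1) (slotWeight n m) (env 15) (T 4) (i + 1))
      (fun mem' T' hT' hT'T s t κ μ hs ht hκ hμ => by
        rw [hT'.eval_upToExp (vot := vot) (s := s) (t := t) (κ := κ) (μ := μ)
          ((((hc'.update (by decide)).update (by decide)).update (by decide)).update (by decide))
          hinp (by rw [hT'T 3 (by decide)]; simp [e3, hvot]) (by simpa using ha) (by simp) (by simp)
          (by simp) (by simp) hs ht hκ hμ, hT'T 5 (by decide), hT'T 7 (by decide)]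
        simp only [dpUpTo, Finset.range_add_one, Finset.sup_insert]
        simp [e7, dpUpTo, happ, max_comm, max_left_comm])
    exact ⟨_, g3.copy hc'.h3 7 6, by simp [e2], by simp [e3], by simp [e4], by simp, by simp⟩)
  exact ⟨_, hT'.copy hc.h3 4 7, by simp [e2], by simp [e3], by
    rw [Function.update_self, e7, dpStep]
    rfl⟩

/-- The last position at which the alternative `a` is approved. -/
def lastSlot (n : ℕ) (app : ℕ → ℕ → Prop) [∀ a p, Decidable (app a p)] (a : ℕ) : ℕ :=
  (Finset.range (n + 1)).sup fun p => if app a p then p else 0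

theorem le_lastSlot {app : ℕ → ℕ → Prop} [∀ a p, Decidable (app a p)] {a p : ℕ} (hp : p ≤ n)
    (h : app a p) : p ≤ lastSlot n app a := by
  have := le_sup_range (n := n + 1) (i := p) (f := fun p => if app a p then p else 0) (by omega)
  rwa [if_pos h] at this

theorem lastSlot_le (app : ℕ → ℕ → Prop) [∀ a p, Decidable (app a p)] (a : ℕ) :
    lastSlot n app a ≤ n :=
  Finset.sup_le fun p hp => by
    have := Finset.mem_range.1 hp
    split_ifs <;> omega

theorem app_lastSlot {app : ℕ → ℕ → Prop} [∀ a p, Decidable (app a p)] {a p : ℕ} (hp : p ≤ n)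
    (h : app a p) : app a (lastSlot n app a) := by
  have hle := le_lastSlot hp h
  -- The value 0 may arise as the position 0 or by default; in the default case `p ≤ 0`, so `p`
  -- itself is the position 0.
  rcases exists_eq_sup_range (fun p => if app a p then p else 0) (n + 1) with h0 | ⟨i, -, hi⟩
  · have : lastSlot n app a = 0 := h0
    rwa [this, ← Nat.le_zero.1 (this ▸ hle)]
  · have hi' : lastSlot n app a = if app a i then i else 0 := hi
    split_ifs at hi' with h1
    · rwa [hi']
    · rwa [hi', ← Nat.le_zero.1 (hi' ▸ hle)]

/-- The guard selecting the alternatives whose last slot is in variable `14`. -/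
def lastSlotGuard : Exp :=
  ifEq (.sup true 17 (.cond (slotExp (.var 15) (.var 17)) (.var 17) (.const 0))) (.var 14)
    (.const 1) (.const 0)

theorem Represents.eval_lastSlotGuard (h : Represents n m inp T mem) (hc : IsContext n m k env)
    (hinp : ∀ u a, n ≤ u → inp u a = 0) {vot : ℕ → ℕ} (hvot : T 3 = fun p _ _ _ => vot p)
    (ha : env 15 < m) : lastSlotGuard.eval (sizes n m) mem env =
      if lastSlot n (appAt n inp vot) (env 15) = env 14 then 1 else 0 := by
  have hsup : (Exp.sup true 17 (.cond (slotExp (.var 15) (.var 17)) (.var 17) (.const 0))).eval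
      (sizes n m) mem env = lastSlot n (appAt n inp vot) (env 15) := by
    simp only [Exp.eval, sizes_true, lastSlot]
    refine Finset.sup_congr rfl fun p hp => ?_
    have hp' : p ≤ n := by simpa [Nat.lt_succ_iff] using hp
    rw [h.eval_slotExp (by simpa using hc.h0) (by simpa using hc.h3) hinp hvot
      (by simpa [Exp.eval] using ha) (by simpa [Exp.eval] using hp')]
    simp only [Exp.eval, Function.update_self, Function.update_of_ne (show 15 ≠ 17 by decide)]
    rfl
  rw [lastSlotGuard, eval_ifEq, hsup]
  rfl

/-- Compute the table of the dynamic program in the array `4`. -/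
def dpCmd : Cmd :=
  .seq (.fill 4 (.const 0)) (.loop true 14 (.loop false 15 (.guard lastSlotGuard jobCmd)))

/-- `F` is a correct table of the dynamic program for the alternatives in `J`. -/
def DPCorrect (n m k : ℕ) (app : ℕ → ℕ → Prop) (J : ℕ → Prop) (F : Table) : Prop :=
  DPSound (n / k) app (slotWeight n m) J F ∧ DPComplete (n / k) app (n + 1) ((m + 1) ^ n) J F

theorem DPCorrect.congr {app : ℕ → ℕ → Prop} {J J' : ℕ → Prop} {F : Table}
    (hF : DPCorrect n m k app J F) (h : ∀ b, J b ↔ J' b) : DPCorrect n m k app J' F :=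
  (funext fun b => propext (h b) : J = J') ▸ hF

/-- If `a` is approved at `p` and `b` from `J` at a later `p'`, then `p'` is at most the last slot
of `b`, hence of `a`, and convexity makes `a` approved at `p'`. This is the deadline hypothesis of
`DPComplete.step`. -/
theorem DPCorrect.step {app : ℕ → ℕ → Prop} [∀ a p, Decidable (app a p)]
    (hlt : ∀ a p, app a p → p ≤ n)
    (hconv : ∀ b p p' p'', app b p → app b p'' → p ≤ p' → p' ≤ p'' → app b p')
    {J : ℕ → Prop} {F : Table} (hF : DPCorrect n m k app J F) {a : ℕ} (ha : ¬ J a)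
    (hJ : ∀ b, J b → lastSlot n app b ≤ lastSlot n app a) :
    DPCorrect n m k app (fun b => J b ∨ b = a)
      (dpStep (n / k) app (n + 1) (slotWeight n m) a F) := by
  refine ⟨hF.1.step ha, hF.2.step ?_ hconv ?_⟩
  · intro a p
    exact Nat.le_add_right _ _
  · rintro b p p' hb hap hbp' hpp'
    have h1 := le_lastSlot (hlt _ _ hbp') hbp'
    exact hconv a p p' _ hap (app_lastSlot (hlt _ _ hap) hap) hpp'.le (h1.trans (hJ b hb))

/-- The order of deadlines is obtained without sorting: for each deadline `d`, a pass over all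
alternatives processes those whose last slot is `d`. Alternatives approved by nobody have last slot
0 by default and take part harmlessly. -/
theorem Represents.run_dpCmd (hT : Represents n m inp T mem) (hc : IsContext n m k env)
    (hinp : ∀ u a, n ≤ u → inp u a = 0) {vot : ℕ → ℕ} (hvot : T 3 = fun p _ _ _ => vot p)
    (hconv : ∀ b p p' p'', appAt n inp vot b p → appAt n inp vot b p'' → p ≤ p' → p' ≤ p'' →
      appAt n inp vot b p') :
    ∃ T', Represents n m inp T' (dpCmd.run (sizes n m) env mem) ∧ T' 2 = T 2 ∧
      DPCorrect n m k (appAt n inp vot) (fun b => b < m) (T' 4) := by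
  have hlt : ∀ a p, appAt n inp vot a p → p ≤ n := fun a p h => by
    by_contra hp
    exact h (if_neg (by omega))
  have h0 := hT.fill (env := env) (c := 4) (e := .const 0) hc.h3 (fun _ _ _ _ => 0)
    (fun mem' T' hT' hT'T s t κ μ hs ht hκ hμ => by simp [Exp.eval])
  have hmain := Cmd.run_loop_induct (env := env) (b := true) (sz := sizes n m) (x := 14)
    (c := .loop false 15 (.guard lastSlotGuard jobCmd))
    (fun d mem => ∃ T', Represents n m inp T' mem ∧ T' 2 = T 2 ∧ T' 3 = T 3 ∧
      DPCorrect n m k (appAt n inp vot)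
        (fun b => b < m ∧ lastSlot n (appAt n inp vot) b < d) (T' 4))
    ⟨_, h0, by simp, by simp, by
      refine DPCorrect.congr (J := fun _ => False) ?_ (by simp)
      rw [Function.update_self]
      exact ⟨DPSound.zero, DPComplete.zero⟩⟩ (by
    rintro d - mem ⟨T₁, hT₁, e2, e3, e4⟩
    have hinner := Cmd.run_loop_induct (env := Function.update env 14 d) (b := false)
      (sz := sizes n m) (x := 15) (c := .guard lastSlotGuard jobCmd)
      (fun a mem => ∃ T', Represents n m inp T' mem ∧ T' 2 = T 2 ∧ T' 3 = T 3 ∧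
        DPCorrect n m k (appAt n inp vot) (fun b => b < m ∧
          (lastSlot n (appAt n inp vot) b < d ∨ lastSlot n (appAt n inp vot) b = d ∧ b < a)) (T' 4))
      ⟨T₁, hT₁, e2, e3, e4.congr (by simp)⟩ (by
      rintro a ha mem ⟨T₂, hT₂, e2, e3, e4⟩
      simp only [sizes_false] at ha
      have hc' : IsContext n m k (Function.update (Function.update env 14 d) 15 a) :=
        (hc.update (by decide)).update (by decide)
      rw [Cmd.run, hT₂.eval_lastSlotGuard hc' hinp (e3.trans hvot) (by simpa using ha)]
      simp only [Function.update_self, Function.update_of_ne (show 14 ≠ 15 by decide)]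
      by_cases hd : lastSlot n (appAt n inp vot) a = d
      · rw [if_pos hd, if_pos one_ne_zero]
        obtain ⟨T₃, hT₃, g2, g3, g4⟩ := hT₂.run_jobCmd hc' hinp (e3.trans hvot) (by simpa using ha)
        rw [Function.update_self] at g4
        refine ⟨T₃, hT₃, g2.trans e2, g3.trans e3, g4 ▸ ((e4.step hlt hconv (a := a) (by omega)
          fun b hb => by omega).congr fun b => ⟨?_, ?_⟩)⟩
        · rintro (⟨h1, h2⟩ | rfl)
          · exact ⟨h1, by omega⟩
          · exact ⟨ha, by omega⟩
        · rintro ⟨h1, h2⟩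
          rcases eq_or_ne b a with h | h
          · exact .inr h
          · exact .inl ⟨h1, by omega⟩
      · rw [if_neg hd, if_neg (by simp)]
        refine ⟨T₂, hT₂, e2, e3, e4.congr fun b => and_congr_right fun _ => ?_⟩
        rcases eq_or_ne b a with rfl | h <;> omega)
    obtain ⟨T₂, hT₂, e2, e3, e4⟩ := hinner
    refine ⟨T₂, hT₂, e2, e3, e4.congr fun b => ?_⟩
    simp only [sizes_false]
    omega)
  obtain ⟨T', hT', e2, -, e4⟩ := hmain
  refine ⟨T', hT', e2, e4.congr fun b => ?_⟩
  have := lastSlot_le (n := n) (appAt n inp vot) b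
  simp only [sizes_true]
  omega

end RAM

namespace RAM

open Exp

/-! ## The program: decoding -/

variable {n m k : ℕ} {inp : ℕ → ℕ → ℕ} {T : ℕ → Table} {mem env : ℕ → ℕ}

/-- A quotient is the number of positive multiples of `c` up to `v`; this replaces division. -/
theorem sum_range_ite_mul_le {N c v : ℕ} (hc : 0 < c) (hv : v / c ≤ N) :
    (∑ x ∈ Finset.range N, if (x + 1) * c ≤ v then 1 else 0) = v / c := by
  rw [← mul_one (v / c), ← sum_range_ite_lt hv 1]
  refine Finset.sum_congr rfl fun x _ => if_congr ?_ rfl rfl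
  rw [← Nat.le_div_iff_mul_le hc]
  exact Nat.succ_le_iff

theorem rec_sub (e v j : ℕ) :
    Nat.rec v (fun _ v => if e ≤ v then v - e else v) j = v - min j (v / e) * e := by
  induction j with
  | zero => simp
  | succ j ih =>
    simp only [ih]
    rcases Nat.eq_zero_or_pos e with rfl | he
    · simp
    rcases lt_or_ge j (v / e) with h | h
    · have h1 : (j + 1) * e ≤ v := (Nat.le_div_iff_mul_le he).1 h
      rw [min_eq_left h.le, min_eq_left (show j + 1 ≤ v / e from h)]
      rw [add_mul, one_mul] at h1 ⊢
      rw [if_pos (by omega)]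
      omega
    · rw [min_eq_right h, min_eq_right (by omega), mul_comm, ← Nat.mod_eq_sub, if_neg]
      exact not_le.2 (Nat.mod_lt _ he)

/-- The remainder of `v` modulo `e`, provided that the quotient is small. -/
def modExp (v e : Exp) : Exp :=
  .bind 43 e (.iter true 44 45 v (.iter false 46 47 (.var 45)
    (ifLe (.var 43) (.var 47) (.sub (.var 47) (.var 43)) (.var 47))))

/-- Nested loops that ignore their indices amount to one long loop; they supply the subtractions in
`modExp`. -/
theorem rec_mul_rounds {α : Type*} (f : α → α) (v : α) (m j : ℕ) :
    Nat.rec v (fun _ w => Nat.rec w (fun _ x => f x) m) j =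
      (Nat.rec v (fun _ x => f x) (j * m) : α) := by
  have hadd : ∀ i j : ℕ, (Nat.rec (Nat.rec v (fun _ x => f x) i) (fun _ x => f x) j : α) =
      Nat.rec v (fun _ x => f x) (i + j) := by
    intro i j
    induction j with
    | zero => rfl
    | succ j ih => exact congrArg f ih
  induction j with
  | zero => simp
  | succ j ih => simp only [ih, hadd, add_mul, one_mul]

theorem eval_modExp {v e : Exp} (hv : ∀ x, v.eval (sizes n m) mem (Function.update env 43 x) =
      v.eval (sizes n m) mem env)
    (h : v.eval (sizes n m) mem env / e.eval (sizes n m) mem env ≤ (n + 1) * m) :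
    (modExp v e).eval (sizes n m) mem env =
      v.eval (sizes n m) mem env % e.eval (sizes n m) mem env := by
  set x := v.eval (sizes n m) mem env with hx
  set y := e.eval (sizes n m) mem env with hy
  have key := rec_sub y x ((n + 1) * m)
  rw [min_eq_right h, mul_comm (x / y), ← Nat.mod_eq_sub,
    ← rec_mul_rounds (fun v => if y ≤ v then v - y else v)] at key
  rw [← key, modExp, Exp.eval, Exp.eval, hv]
  simp [Exp.eval, ← hy]

/-- The remainder of the value of the dynamic program modulo `(m + 1) ^ (p + 1)`, where `p` is the
value of variable `10`. -/
def lowExp : Exp :=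
  .iter true 41 42 (.get 4 (.const 0) (.var 0) (.var 2) (.var 5))
    (ifLt (.var 10) (.sub (.var 0) (.var 41)) (modExp (.var 42) (powExp (.sub (.var 0) (.var 41))))
      (.var 42))

/-- Direct reduction modulo `(m + 1) ^ (p + 1)` by repeated subtraction could take exponentially
many rounds. So the value is reduced modulo `(m + 1) ^ n`, `(m + 1) ^ (n - 1)` and so on. The first
quotient is at most `n` by `hC`, the later ones at most `m`, and `(n + 1) * m` subtractions suffice
each time. -/
theorem Represents.eval_lowExp (h : Represents n m inp T mem) (hc : IsContext n m k env)
    (hm : 1 ≤ m) (hk : 1 ≤ k) (hkn : k ≤ n) (hlt : env 10 < n)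
    (hC : T 4 0 n k (n % k) < (n + 1) * (m + 1) ^ n) : lowExp.eval (sizes n m) mem env =
      T 4 0 n k (n % k) % (m + 1) ^ (env 10 + 1) := by
  set C := T 4 0 n k (n % k) with hCdef
  set p := env 10 with hp
  have hr : n % k ≤ n := (Nat.mod_lt n hk).le.trans hkn
  have h0 : (Exp.get 4 (.const 0) (.var 0) (.var 2) (.var 5)).eval (sizes n m) mem env = C := by
    simp [Exp.eval, hc.h0, hc.h2, hc.h3, hc.h5, h.get, hkn, hr, hCdef]
  have hbody : ∀ i v, (p < n - i → v / (m + 1) ^ (n - i) ≤ (n + 1) * m) →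
      (ifLt (.var 10) (.sub (.var 0) (.var 41))
        (modExp (.var 42) (powExp (.sub (.var 0) (.var 41)))) (.var 42)).eval (sizes n m) mem
          (Function.update (Function.update env 41 i) 42 v) =
        if p < n - i then v % (m + 1) ^ (n - i) else v := by
    intro i v hv
    have hmin : min (n - i) (n + 1) = n - i := by omega
    rw [eval_ifLt]
    refine ite_congr (by simp [Exp.eval, hc.h0, ← hp]) (fun hi => ?_) (fun _ => by simp [Exp.eval])
    rw [eval_modExp (fun x => by simp [Exp.eval])
      (by simpa [Exp.eval, hc.h0, hmin] using hv hi)]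
    simp [Exp.eval, hc.h0, hmin]
  have key : ∀ j, (Nat.rec C (fun i v => (ifLt (.var 10) (.sub (.var 0) (.var 41))
        (modExp (.var 42) (powExp (.sub (.var 0) (.var 41)))) (.var 42)).eval (sizes n m) mem
          (Function.update (Function.update env 41 i) 42 v)) (j + 1) : ℕ) =
      C % (m + 1) ^ max (n - j) (p + 1) := by
    intro j
    induction j with
    | zero =>
      refine (hbody 0 C fun _ => ?_).trans ?_
      · have := (Nat.div_lt_iff_lt_mul (by positivity)).2 hC
        rw [Nat.sub_zero]
        nlinarith
      · rw [Nat.sub_zero, if_pos hlt, max_eq_left (by omega)]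
    | succ j ih =>
      refine (hbody (j + 1) _ fun hj => ?_).trans ?_
      · rw [ih]
        refine Nat.le_of_lt_succ ((Nat.div_lt_iff_lt_mul (by positivity)).2
          ((Nat.mod_lt _ (by positivity)).trans_le ?_))
        rw [max_eq_left (by omega), show n - j = n - (j + 1) + 1 by omega, pow_succ, mul_comm]
        exact Nat.mul_le_mul_right _ (by nlinarith)
      · rw [ih]
        split_ifs with h1
        · rw [Nat.mod_mod_of_dvd _ (pow_dvd_pow _ (by omega)), max_eq_left (by omega)]
        · congr 2
          omega
  rw [lowExp, Exp.eval, h0, sizes_true, key, max_eq_right (by omega)]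

/-- The remainder modulo `m + 1` of the quotient by `(m + 1) ^ p` of the value of the dynamic
program, where `p` is the value of variable `10`. -/
def digitExp : Exp :=
  ifLt (.var 10) (.var 0) (.bind 40 lowExp (.bind 43 (powExp (.var 10)) (.sum false 48
    (ifLe (.sum false 49 (ifLe (.var 49) (.var 48) (.var 43) (.const 0))) (.var 40) (.const 1)
      (.const 0))))) (.const 0)

theorem Represents.eval_digitExp (h : Represents n m inp T mem) (hc : IsContext n m k env)
    (hm : 1 ≤ m) (hk : 1 ≤ k) (hkn : k ≤ n)
    (hC : T 4 0 n k (n % k) < (n + 1) * (m + 1) ^ n) : digitExp.eval (sizes n m) mem env =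
      if env 10 < n then T 4 0 n k (n % k) / (m + 1) ^ env 10 % (m + 1) else 0 := by
  rw [digitExp, eval_ifLt]
  refine ite_congr (by simp [Exp.eval, hc.h0]) (fun hlt => ?_) (fun _ => by simp [Exp.eval])
  have hp : env 10 < n := by simpa [Exp.eval, hc.h0] using hlt
  rw [Exp.eval, h.eval_lowExp hc hm hk hkn hp hC]
  set C := T 4 0 n k (n % k)
  rw [pow_succ, ← Nat.mod_mul_right_div_self, Exp.eval, Exp.eval, eval_powExp]
  set D := C % ((m + 1) ^ env 10 * (m + 1)) with hD
  -- The remainder `D` is below `(m + 1) ^ (p + 1)` for the position `p = env 10`, so its quotient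
  -- by `(m + 1) ^ p` is at most `m` and one loop of length `m` finds it.
  rw [← sum_range_ite_mul_le (N := m) (c := (m + 1) ^ env 10) (v := D) (by positivity) ?_]
  · refine Finset.sum_congr rfl fun x hx => ?_
    rw [eval_ifLe]
    refine if_congr ?_ rfl rfl
    rw [← sum_range_ite_le (Finset.mem_range.1 hx) ((m + 1) ^ env 10)]
    simp [Exp.eval, min_eq_left (show env 10 ≤ n + 1 by omega)]
  · refine Nat.le_of_lt_succ ((Nat.div_lt_iff_lt_mul (by positivity)).2 ?_)
    rw [mul_comm]
    exact Nat.mod_lt _ (by positivity)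

/-- Write the partial assignment encoded in the value of the dynamic program into the array `6`. -/
def decodeCmd : Cmd :=
  .seq (.fill 5 digitExp) (.fill 6 (ifLt (.var 10) (.var 0)
    (.get 5 (.get 2 (.var 10) (.const 0) (.const 0) (.const 0)) (.const 0) (.const 0) (.const 0))
    (.const 0)))

/-- The partial assignment encoded in `C`. -/
def decoded (n m : ℕ) (pos : ℕ → ℕ) (C u : ℕ) : ℕ :=
  if u < n then C / (m + 1) ^ pos u % (m + 1) else 0

theorem Represents.run_decodeCmd (hT : Represents n m inp T mem) (hc : IsContext n m k env)
    (hm : 1 ≤ m) (hk : 1 ≤ k) (hkn : k ≤ n)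
    (hC : T 4 0 n k (n % k) < (n + 1) * (m + 1) ^ n) {pos : ℕ → ℕ}
    (hpos : T 2 = fun u _ _ _ => pos u) (hlt : ∀ u < n, pos u < n) :
    ∃ T', Represents n m inp T' (decodeCmd.run (sizes n m) env mem) ∧
      T' 6 = fun u _ _ _ => decoded n m pos (T 4 0 n k (n % k)) u := by
  set C := T 4 0 n k (n % k) with hCdef
  have h1 := hT.fill (c := 5) (e := digitExp) hc.h3
    (fun p _ _ _ => if p < n then C / (m + 1) ^ p % (m + 1) else 0)
    (fun mem' T' hT' hT'T u v κ μ hu hv hκ hμ => by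
      have h4 := hT'T 4 (by decide)
      rw [hT'.eval_digitExp
        ((((hc.update (by decide)).update (by decide)).update (by decide)).update (by decide))
        hm hk hkn (by rw [h4]; exact hC), h4]
      simp [← hCdef]) (by decide)
  refine ⟨_, h1.fill (c := 6) hc.h3 (fun u _ _ _ => decoded n m pos C u) ?_ (by decide), by simp⟩
  intro mem' T' hT' hT'T u v κ μ hu hv hκ hμ
  have h2 := hT'T 2 (by decide)
  have h5 := hT'T 5 (by decide)
  rw [Function.update_of_ne (by decide), hpos] at h2
  rw [Function.update_self] at h5
  rw [eval_ifLt, decoded]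
  refine ite_congr (by simp [Exp.eval, hc.h0]) (fun hlt' => ?_) (fun _ => by simp [Exp.eval])
  have hu' : u < n := by simpa [Exp.eval, hc.h0] using hlt'
  simp [Exp.eval, hc.h3, hT'.get, h2, h5, hu, hlt u hu', (hlt u hu').le]

/-! ## The program: completion and output -/

/-- The number of voters assigned to the alternative `b`, if the voter in variable `14` is
assigned to the alternative in variable `40`. -/
def loadExp (b : Exp) : Exp :=
  .bind 50 b (.sum true 51 (ifLt (.var 51) (.var 0)
    (ifEq (ifEq (.var 51) (.var 14) (.add (.var 40) (.const 1))
      (.get 6 (.var 51) (.const 0) (.const 0) (.const 0))) (.add (.var 50) (.const 1))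
      (.const 1) (.const 0)) (.const 0)))

/-- The number of alternatives with at least `θ` voters, with the voter in variable `14`
assigned to the alternative in variable `40`. -/
def countExp (θ : Exp) : Exp :=
  .bind 52 θ (.sum false 53 (ifLe (.var 52) (loadExp (.var 53)) (.const 1) (.const 0)))

theorem Represents.eval_loadExp (h : Represents n m inp T mem) (hc : IsContext n m k env)
    {S : ℕ → ℕ} (hS : T 6 = fun u _ _ _ => S u) (b : Exp) :
    (loadExp b).eval (sizes n m) mem env =
      tabLoad n (Function.update S (env 14) (env 40 + 1)) (b.eval (sizes n m) mem env) := by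
  simp only [loadExp, Exp.eval, sizes_true, tabLoad]
  rw [Finset.sum_range_succ, eval_ifLt, if_neg (by simp [Exp.eval, hc.h0]), Exp.eval, add_zero]
  refine Finset.sum_congr rfl fun u hu => ?_
  have hu' : u < n := Finset.mem_range.1 hu
  rw [eval_ifLt, if_pos (by simpa [Exp.eval, hc.h0] using hu')]
  by_cases hv : u = env 14
  · simp [Exp.eval, hv]
  · simp [Exp.eval, hv, hc.h3, h.get, hu'.le, hS]

theorem Represents.eval_countExp (h : Represents n m inp T mem) (hc : IsContext n m k env)
    {S : ℕ → ℕ} (hS : T 6 = fun u _ _ _ => S u) (θ : Exp) :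
    (countExp θ).eval (sizes n m) mem env =
      tabCount n m (Function.update S (env 14) (env 40 + 1)) (θ.eval (sizes n m) mem env) := by
  simp only [countExp, Exp.eval, sizes_false, tabCount]
  refine Finset.sum_congr rfl fun b hb => ?_
  rw [eval_ifLe, h.eval_loadExp ((hc.update (by decide)).update (by decide)) hS]
  simp [Exp.eval]

/-- An alternative, plus one, to which the voter in variable `14` can be assigned. -/
def choiceExp : Exp :=
  .sup false 40 (ifLe (countExp (.const 1)) (.var 2)
    (ifLe (countExp (.add (.var 4) (.const 1))) (.var 5)
      (ifLe (countExp (.add (.var 4) (.const 2))) (.const 0) (.add (.var 40) (.const 1)) (.const 0))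
      (.const 0)) (.const 0))

/-- The value of `choiceExp`. -/
def choiceAt (n m k : ℕ) (S : ℕ → ℕ) (v : ℕ) : ℕ := (Finset.range m).sup fun a =>
  if tabCount n m (Function.update S v (a + 1)) 1 ≤ k then
    if tabCount n m (Function.update S v (a + 1)) (n / k + 1) ≤ n % k then
      if tabCount n m (Function.update S v (a + 1)) (n / k + 2) ≤ 0 then a + 1 else 0
    else 0
  else 0

theorem Represents.eval_choiceExp (h : Represents n m inp T mem) (hc : IsContext n m k env)
    {S : ℕ → ℕ} (hS : T 6 = fun u _ _ _ => S u) :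
    choiceExp.eval (sizes n m) mem env = choiceAt n m k S (env 14) := by
  simp only [choiceExp, Exp.eval, sizes_false]
  refine Finset.sup_congr rfl fun a ha => ?_
  have hc' : IsContext n m k (Function.update env 40 a) := hc.update (by decide)
  simp only [eval_ifLe, h.eval_countExp hc' hS, Exp.eval, hc'.h2, hc'.h4, hc'.h5,
    Function.update_self, Function.update_of_ne (show 14 ≠ 40 by decide)]

end RAM

variable {n m k : ℕ}

/-- The supremum selects the largest admissible alternative, shifted by one. It is not the default
0, because `exists_extend` provides an admissible one. -/
theorem IsPartialAssignment.choiceAt {S : ℕ → ℕ}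
    (hS : IsPartialAssignment n m k (n / k) (n % k) S) (hk : 1 ≤ k) (hkn : k ≤ n) (hkm : k ≤ m)
    {v : ℕ} (hv : v < n) (hSv : S v = 0) :
    IsPartialAssignment n m k (n / k) (n % k) (Function.update S v (RAM.choiceAt n m k S v)) ∧
      RAM.choiceAt n m k S v ≠ 0 := by
  obtain ⟨a, ha, hSa⟩ := hS.exists_extend (Nat.div_add_mod n k).symm (Nat.mod_lt n hk)
    ((Nat.one_le_div_iff hk).2 hkn) hkm hv hSv
  have hpos : 0 < RAM.choiceAt n m k S v := by
    refine Nat.lt_of_lt_of_le ?_ (le_sup_range ha)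
    rw [if_pos hSa.count_one, if_pos hSa.count_long, if_pos hSa.count_over.le]
    exact Nat.succ_pos a
  refine ⟨?_, hpos.ne'⟩
  rcases exists_eq_sup_range _ m with h0 | ⟨b, hb, hfb⟩
  · exact absurd h0 hpos.ne'
  · change RAM.choiceAt n m k S v = _ at hfb
    rw [hfb] at hpos ⊢
    split_ifs at hpos ⊢ with h1 h2 h3 <;> [skip; omega; omega; omega]
    refine ⟨fun u hu => ?_, h1, h2, Nat.le_zero.1 h3⟩
    rw [Function.update_apply]
    split_ifs
    · omega
    · exact hS.le u hu

namespace RAM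

open Exp

variable {inp : ℕ → ℕ → ℕ} {T : ℕ → Table} {mem env : ℕ → ℕ}

/-- Extend the partial assignment in the array `6` to all voters. -/
def completeCmd : Cmd :=
  .loop true 14 (.guard (ifLt (.var 14) (.var 0) (.const 1) (.const 0))
    (.seq (.fill 5 (ifEq (.var 10) (.var 14) (.cond (copyExp 6) (copyExp 6) choiceExp) (copyExp 6)))
      (.fill 6 (copyExp 5))))

theorem Represents.run_completeCmd (hT : Represents n m inp T mem) (hc : IsContext n m k env)
    {S : ℕ → ℕ} (hS : T 6 = fun u _ _ _ => S u)
    (hSm : IsPartialAssignment n m k (n / k) (n % k) S) (hk : 1 ≤ k) (hkn : k ≤ n) (hkm : k ≤ m) :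
    ∃ T' S', Represents n m inp T' (completeCmd.run (sizes n m) env mem) ∧
      (T' 6 = fun u _ _ _ => S' u) ∧ IsPartialAssignment n m k (n / k) (n % k) S' ∧
        (∀ u, S u ≠ 0 → S' u = S u) ∧ ∀ u < n, S' u ≠ 0 := by
  have hmain := Cmd.run_loop_induct (mem := mem) (env := env) (b := true) (sz := sizes n m)
    (x := 14) (c := .guard (ifLt (.var 14) (.var 0) (.const 1) (.const 0)) (.seq (.fill 5
      (ifEq (.var 10) (.var 14) (.cond (copyExp 6) (copyExp 6) choiceExp) (copyExp 6)))
        (.fill 6 (copyExp 5))))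
    (fun v mem => ∃ T' S', Represents n m inp T' mem ∧
      (T' 6 = fun u _ _ _ => S' u) ∧ IsPartialAssignment n m k (n / k) (n % k) S' ∧
        (∀ u, S u ≠ 0 → S' u = S u) ∧ ∀ u < v, u < n → S' u ≠ 0)
    ⟨T, S, hT, hS, hSm, fun _ _ => rfl, by simp⟩ (by
    rintro v - mem ⟨T₁, S₁, hT₁, e6, hS₁, hSS₁, hne⟩
    have hc' : IsContext n m k (Function.update env 14 v) := hc.update (by decide)
    rw [Cmd.run, eval_ifLt]
    simp only [Exp.eval, Function.update_self, hc'.h0]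
    by_cases hv : v < n
    swap
    · rw [if_neg hv, if_neg (by simp)]
      exact ⟨T₁, S₁, hT₁, e6, hS₁, hSS₁, fun u _ hu => hne u (by omega) hu⟩
    rw [if_pos hv, if_pos one_ne_zero]
    obtain ⟨S₂, hS₂, hSS₂, hne₂, hupd⟩ : ∃ S₂, IsPartialAssignment n m k (n / k) (n % k) S₂ ∧
        (∀ u, S₁ u ≠ 0 → S₂ u = S₁ u) ∧ S₂ v ≠ 0 ∧
        S₂ = Function.update S₁ v (if S₁ v ≠ 0 then S₁ v else choiceAt n m k S₁ v) := by
      refine ⟨_, ?_, fun u hu => ?_, ?_, rfl⟩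
      · split_ifs with h0
        · rwa [Function.update_eq_self]
        · exact (hS₁.choiceAt hk hkn hkm hv (not_not.1 h0)).1
      · rw [Function.update_apply]
        split_ifs with h0 h1
        · rw [h0]
        · exact absurd (h0 ▸ hu) h1
        · rfl
      · rw [Function.update_self]
        split_ifs with h0
        · exact h0
        · exact (hS₁.choiceAt hk hkn hkm hv (not_not.1 h0)).2
    have h1 := hT₁.fill (c := 5) (env := Function.update env 14 v)
      (e := ifEq (.var 10) (.var 14) (.cond (copyExp 6) (copyExp 6) choiceExp) (copyExp 6))
      hc'.h3 (fun u _ _ _ => S₂ u)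
      (fun mem' T' hT' hT'T u κ i μ hu hκ hi hμ => by
        have h6 := (hT'T 6 (by decide)).trans e6
        simp only [eval_ifEq, Exp.eval]
        rw [hT'.eval_choiceExp
          ((((hc'.update (by decide)).update (by decide)).update (by decide)).update (by decide))
          h6,
          hupd]
        by_cases huv : u = v
        · simp [huv, hv.le, Exp.eval, copyExp, hT'.get, h6, hc.h3, hκ, hi, hμ]
        · simp [huv, hu, Exp.eval, copyExp, hT'.get, h6, hc.h3, hκ, hi, hμ]) (by decide)
    refine ⟨_, S₂, h1.copy hc'.h3 6 5, by simp, hS₂, fun u hu => ?_, fun u hu hun => ?_⟩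
    · rw [hSS₂ u (by rwa [hSS₁ u hu]), hSS₁ u hu]
    · rcases eq_or_ne u v with rfl | huv
      · exact hne₂
      · have := hne u (by omega) hun
        rwa [hSS₂ u this])
  simpa only [sizes_true] using
    Exists.imp (fun T' => Exists.imp fun S' h => ⟨h.1, h.2.1, h.2.2.1, h.2.2.2.1, fun u hu =>
      h.2.2.2.2 u (by simp only [sizes_true]; omega) hu⟩) hmain

/-- Write the assignment in the array `6` to the beginning of the memory. -/
def outputCmd : Cmd :=
  .loop true 14 (.guard (ifLt (.var 14) (.var 0) (.const 1) (.const 0))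
    (.store (.var 14) (.sub (.get 6 (.var 14) (.const 0) (.const 0) (.const 0)) (.const 1))))

/-- The output overwrites cells below `n` of the input matrix. As `n ≤ m * n`, array 6 stays intact,
and it is the only array the loop invariant mentions. -/
theorem Represents.run_outputCmd (hT : Represents n m inp T mem) (hc : IsContext n m k env)
    (hm : 1 ≤ m) {S : ℕ → ℕ} (hS : T 6 = fun u _ _ _ => S u) :
    ∀ u < n, outputCmd.run (sizes n m) env mem u = S u - 1 := by
  have hmain := Cmd.run_loop_induct (mem := mem) (env := env) (b := true) (sz := sizes n m)
    (x := 14) (c := .guard (ifLt (.var 14) (.var 0) (.const 1) (.const 0))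
      (.store (.var 14) (.sub (.get 6 (.var 14) (.const 0) (.const 0) (.const 0)) (.const 1))))
    (fun v mem => (∀ u ≤ n, mem (cellAddr (n + 1) (m * n) 6 u 0 0 0) = S u) ∧
      ∀ u < v, u < n → mem u = S u - 1)
    ⟨fun u hu => by rw [hT.get 6 hu (by omega) (by omega) (by omega) (by decide), hS], by simp⟩ (by
    rintro v - mem ⟨h6, hout⟩
    rw [Cmd.run, eval_ifLt]
    simp only [Exp.eval, Function.update_self, Function.update_of_ne (show 0 ≠ 14 by decide), hc.h0]
    by_cases hv : v < n
    swap
    · rw [if_neg hv, if_neg (by simp)]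
      exact ⟨h6, fun u _ hu => hout u (by omega) hu⟩
    rw [if_pos hv, if_pos one_ne_zero]
    have hval : (Exp.sub (.get 6 (.var 14) (.const 0) (.const 0) (.const 0)) (.const 1)).eval
        (sizes n m) mem (Function.update env 14 v) = S v - 1 := by
      simp [Exp.eval, hc.h3, h6 v hv.le]
    rw [Cmd.run, hval, Exp.eval, Function.update_self]
    refine ⟨fun u hu => ?_, fun u hu hun => ?_⟩
    · rw [Function.update_of_ne, h6 u hu]
      have := Nat.le_mul_of_pos_left n hm
      unfold cellAddr
      omega
    · rcases eq_or_ne u v with rfl | huv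
      · rw [Function.update_self]
      · rw [Function.update_of_ne huv]
        exact hout u (by omega) hun)
  exact fun u hu => hmain.2 u (by simp only [sizes_true]; omega) hu

end RAM

/-! ## Encoding schedules in numbers -/

section Encoding

variable {n m : ℕ}

theorem sum_mul_pow_lt {f : ℕ → ℕ} (hf : ∀ i, f i ≤ m) (n : ℕ) :
    ∑ i ∈ Finset.range n, f i * (m + 1) ^ i < (m + 1) ^ n := by
  induction n with
  | zero => simp
  | succ n ih =>
    rw [Finset.sum_range_succ, pow_succ]
    have := Nat.mul_le_mul_right ((m + 1) ^ n) (hf n)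
    nlinarith

/-- The term `X * (m + 1) ^ n`, which will carry the size of a schedule, lies above all the digits
and does not disturb them. -/
theorem sum_mul_pow_div_mod {f : ℕ → ℕ} (hf : ∀ i, f i ≤ m) (X : ℕ) {n p : ℕ} (hp : p < n) :
    (X * (m + 1) ^ n + ∑ i ∈ Finset.range n, f i * (m + 1) ^ i) / (m + 1) ^ p % (m + 1) = f p := by
  obtain ⟨Y, hY⟩ : ∃ Y, X * (m + 1) ^ n + ∑ i ∈ Finset.range n, f i * (m + 1) ^ i =
      ∑ i ∈ Finset.range p, f i * (m + 1) ^ i + (m + 1) ^ p * (f p + (m + 1) * Y) := by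
    induction n, hp using Nat.le_induction generalizing X with
    | base =>
      refine ⟨X, ?_⟩
      rw [Finset.sum_range_succ, pow_succ]
      ring
    | succ n _ ih =>
      obtain ⟨Y, hY⟩ := ih (X * (m + 1) + f n)
      refine ⟨Y, hY ▸ ?_⟩
      rw [Finset.sum_range_succ, pow_succ]
      ring
  rw [hY, Nat.add_mul_div_left _ _ (by positivity), Nat.div_eq_of_lt (sum_mul_pow_lt hf p),
    zero_add, Nat.add_mul_mod_self_left, Nat.mod_eq_of_lt (Nat.lt_succ_of_le (hf p))]

/-- The digit of a schedule for the slot `p`. -/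
def slotDigit (A : Finset (ℕ × ℕ)) (p : ℕ) : ℕ := ∑ x ∈ A with x.2 = p, (x.1 + 1)

variable {A : Finset (ℕ × ℕ)}

theorem slotDigit_eq (hinj : ∀ x ∈ A, ∀ y ∈ A, x.2 = y.2 → x = y) {x : ℕ × ℕ} (hx : x ∈ A) :
    slotDigit A x.2 = x.1 + 1 := by
  rw [slotDigit, show (A.filter fun y => y.2 = x.2) = {x} from ?_, Finset.sum_singleton]
  ext y
  simp only [Finset.mem_filter, Finset.mem_singleton]
  exact ⟨fun h => hinj y h.1 x hx h.2, fun h => ⟨h.symm ▸ hx, h ▸ rfl⟩⟩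

theorem exists_mem_of_slotDigit_ne_zero {p : ℕ} (h : slotDigit A p ≠ 0) : ∃ x ∈ A, x.2 = p := by
  obtain ⟨x, hx, -⟩ := Finset.exists_ne_zero_of_sum_ne_zero h
  exact ⟨x, (Finset.mem_filter.1 hx).1, (Finset.mem_filter.1 hx).2⟩

theorem slotDigit_eq_succ_iff (hinj : ∀ x ∈ A, ∀ y ∈ A, x.2 = y.2 → x = y) {a p : ℕ} :
    slotDigit A p = a + 1 ↔ (a, p) ∈ A := by
  constructor
  · intro h
    obtain ⟨x, hx, rfl⟩ := exists_mem_of_slotDigit_ne_zero (show slotDigit A p ≠ 0 by omega)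
    rw [slotDigit_eq hinj hx] at h
    rwa [← Nat.succ_injective h]
  · exact fun h => slotDigit_eq hinj h

theorem slotDigit_le (hinj : ∀ x ∈ A, ∀ y ∈ A, x.2 = y.2 → x = y) (hA : ∀ x ∈ A, x.1 < m) (p : ℕ) :
    slotDigit A p ≤ m := by
  by_cases h : slotDigit A p = 0
  · omega
  · obtain ⟨x, hx, rfl⟩ := exists_mem_of_slotDigit_ne_zero h
    rw [slotDigit_eq hinj hx]
    exact hA x hx

theorem sum_slotWeight (hA : ∀ x ∈ A, x.2 < n) :
    ∑ x ∈ A, RAM.slotWeight n m x.1 x.2 =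
      A.card * (m + 1) ^ n + ∑ p ∈ Finset.range n, slotDigit A p * (m + 1) ^ p := by
  simp only [RAM.slotWeight, Finset.sum_add_distrib, Finset.sum_const, smul_eq_mul]
  congr 1
  rw [← Finset.sum_fiberwise_of_maps_to (g := Prod.snd) (t := Finset.range n)
    (fun x hx => Finset.mem_range.2 (hA x hx))]
  refine Finset.sum_congr rfl fun p _ => ?_
  rw [slotDigit, Finset.sum_mul]
  exact Finset.sum_congr rfl fun x hx => by rw [(Finset.mem_filter.1 hx).2]

theorem card_le_of_slots (hinj : ∀ x ∈ A, ∀ y ∈ A, x.2 = y.2 → x = y) (hA : ∀ x ∈ A, x.2 < n) :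
    A.card ≤ n := by
  rw [← Finset.card_range n]
  exact Finset.card_le_card_of_injOn Prod.snd (fun x hx => by simpa using hA x hx)
    fun x hx y hy h => hinj x hx y hy h

theorem isTableOf_decoded (hinj : ∀ x ∈ A, ∀ y ∈ A, x.2 = y.2 → x = y) (hA : ∀ x ∈ A, x.2 < n)
    (hm : ∀ x ∈ A, x.1 < m) {pos : ℕ → ℕ} (hpos : ∀ u < n, pos u < n) :
    IsTableOf n pos A (RAM.decoded n m pos (∑ x ∈ A, RAM.slotWeight n m x.1 x.2)) := by
  intro u hu a
  rw [RAM.decoded, if_pos hu, sum_slotWeight hA,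
    sum_mul_pow_div_mod (slotDigit_le hinj hm) _ (hpos u hu), slotDigit_eq_succ_iff hinj]

/-- The digits together weigh less than one unit `(m + 1) ^ n`, so a schedule of larger size always
has larger weight. -/
theorem sum_slotWeight_lt (hinj : ∀ x ∈ A, ∀ y ∈ A, x.2 = y.2 → x = y) (hA : ∀ x ∈ A, x.2 < n)
    (hm : ∀ x ∈ A, x.1 < m) :
    ∑ x ∈ A, RAM.slotWeight n m x.1 x.2 < (A.card + 1) * (m + 1) ^ n := by
  rw [sum_slotWeight hA, add_mul, one_mul]
  exact Nat.add_lt_add_left (sum_mul_pow_lt (slotDigit_le hinj hm) n) _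

end Encoding

/-! ## The program -/

namespace RAM

open Exp

variable {n m k : ℕ} {inp : ℕ → ℕ → ℕ} {T : ℕ → Table} {mem env : ℕ → ℕ}

/-- The quotient of `n` and `k`. -/
def quotExp : Exp :=
  .sum true 40 (ifLe (.sum true 41 (ifLe (.var 41) (.var 40) (.var 2) (.const 0))) (.var 0)
    (.const 1) (.const 0))

/-- The remainder of `n` modulo `k`, where variable `4` contains the quotient. -/
def remExp : Exp := .sub (.var 0) (.sum true 40 (ifLt (.var 40) (.var 4) (.var 2) (.const 0)))

theorem eval_quotExp (h0 : env 0 = n) (h2 : env 2 = k) (hk : 1 ≤ k) :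
    quotExp.eval (sizes n m) mem env = n / k := by
  have hle : n / k ≤ n + 1 := (Nat.div_le_self n k).trans (Nat.le_succ n)
  rw [← sum_range_ite_mul_le hk hle]
  simp only [quotExp, Exp.eval, sizes_true]
  refine Finset.sum_congr rfl fun x hx => ?_
  rw [eval_ifLe]
  refine if_congr ?_ rfl rfl
  rw [← sum_range_ite_le (Finset.mem_range.1 hx) k]
  simp [Exp.eval, h0, h2]

theorem eval_remExp (h0 : env 0 = n) (h2 : env 2 = k) (h4 : env 4 = n / k) :
    remExp.eval (sizes n m) mem env = n % k := by
  have hle : n / k ≤ n + 1 := (Nat.div_le_self n k).trans (Nat.le_succ n)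
  rw [Nat.mod_eq_sub, mul_comm, ← sum_range_ite_lt hle k]
  simp [remExp, Exp.eval, h0, h2, h4]

/-- The program for instances with at least `k` voters and at least `k` alternatives. -/
def mainCmd : Cmd :=
  .bind 3 (.times false (.var 0)) (.bind 4 quotExp (.bind 5 remExp (.bind 6 (powExp (.var 0))
    (.seq labCmd (.seq posCmd (.seq dpCmd (.seq decodeCmd (.seq completeCmd outputCmd))))))))

theorem isContext_mainCmd (h0 : env 0 = n) (h1 : env 1 = m) (h2 : env 2 = k) (hk : 1 ≤ k) :
    ∃ env', IsContext n m k env' ∧ mainCmd.run (sizes n m) env mem =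
      (Cmd.seq labCmd (.seq posCmd (.seq dpCmd (.seq decodeCmd (.seq completeCmd
        outputCmd))))).run (sizes n m) env' mem := by
  rw [mainCmd, Cmd.run, Cmd.run, Cmd.run, Cmd.run, eval_quotExp (by simpa using h0)
    (by simpa using h2) hk, eval_remExp (by simpa using h0) (by simpa using h2) (by simp)]
  refine ⟨_, ⟨?_, ?_, ?_, ?_, ?_, ?_, ?_⟩, rfl⟩ <;> simp [h0, h1, h2, Exp.eval]

/-- The positions computed by the program. -/
def inputPos (n m : ℕ) (inp : ℕ → ℕ → ℕ) : ℕ → ℕ :=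
  labPos n (labIter n m inp ((n + 1) * (n + 1)))

/-- The approval relation between alternatives and positions computed by the program. -/
def inputApp (n m : ℕ) (inp : ℕ → ℕ → ℕ) : ℕ → ℕ → Prop :=
  appAt n inp (voterAt n (inputPos n m inp))

theorem Represents.run_mainCmd (hT : Represents n m inp T mem)
    (hinp : ∀ u a, n ≤ u → inp u a = 0) (h0 : env 0 = n) (h1 : env 1 = m) (h2 : env 2 = k)
    (hk : 1 ≤ k) (hkn : k ≤ n) (hkm : k ≤ m) (hlt : ∀ u < n, inputPos n m inp u < n)
    (hinj : ∀ u < n, ∀ v < n, inputPos n m inp u = inputPos n m inp v → u = v)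
    (hsurj : ∀ p < n, ∃ u < n, inputPos n m inp u = p)
    (hconv : ∀ b p p' p'', inputApp n m inp b p → inputApp n m inp b p'' → p ≤ p' → p' ≤ p'' →
      inputApp n m inp b p') :
    ∃ A S, IsSchedule (n / k) (inputApp n m inp) (fun b => b < m) 0 n k (n % k) A ∧
      (∀ B, IsSchedule (n / k) (inputApp n m inp) (fun b => b < m) 0 n k (n % k) B →
        B.card ≤ A.card) ∧
      IsPartialAssignment n m k (n / k) (n % k) S ∧
      (∀ u < n, ∀ a, (a, inputPos n m inp u) ∈ A → S u = a + 1) ∧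
      (∀ u < n, S u ≠ 0) ∧ ∀ u < n, mainCmd.run (sizes n m) env mem u = S u - 1 := by
  obtain ⟨env', hc, hrun⟩ := isContext_mainCmd (mem := mem) h0 h1 h2 hk
  obtain ⟨T₁, hT₁, e₁⟩ := hT.run_labCmd hinp hc
  obtain ⟨T₂, hT₂, e₂, f₂⟩ := hT₁.run_posCmd hc e₁
  obtain ⟨T₃, hT₃, e₃, hF⟩ := hT₂.run_dpCmd hc hinp f₂ hconv
  obtain ⟨A, hA, hAF⟩ := hF.1 0 n k (n % k)
  have hr : n % k ≤ n := (Nat.mod_lt n hk).le.trans hkn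
  have hcard := card_le_of_slots hA.inj hA.lt
  have hCA := sum_slotWeight_lt hA.inj hA.lt hA.job
  have hC : T₃ 4 0 n k (n % k) < (n + 1) * (m + 1) ^ n :=
    hAF ▸ hCA.trans_le (Nat.mul_le_mul_right _ (by omega))
  obtain ⟨T₄, hT₄, e₄⟩ := hT₃.run_decodeCmd hc (hk.trans hkm) hk hkn hC (e₃.trans e₂) hlt
  have htab := isTableOf_decoded hA.inj hA.lt hA.job hlt
  rw [hAF] at htab
  obtain ⟨T₅, S, hT₅, e₅, hS, hSS, hS0⟩ := hT₄.run_completeCmd hc e₄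
    (htab.isPartialAssignment hinj hsurj le_rfl hA) hk hkn hkm
  refine ⟨A, S, hA, fun B hB => ?_, hS, fun u hu a ha => ?_, hS0, fun u hu => ?_⟩
  -- With `W = (m + 1) ^ n`, completeness and the encoding give `B.card * W ≤ F < (A.card + 1) * W`,
  -- where `F` is the table entry, the weight of `A`.
  · have := hF.2 0 n k (n % k) B (by omega) (by omega) (by omega) hB
    rw [← hAF] at this
    exact Nat.lt_succ_iff.1 (Nat.lt_of_mul_lt_mul_right (this.trans_lt hCA))
  · have := (htab u hu a).2 ha
    exact (hSS u (show decoded n m (inputPos n m inp) _ u ≠ 0 by omega)).trans this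
  · rw [hrun]
    exact hT₅.run_outputCmd hc (hk.trans hkm) e₅ u hu

end RAM

/-! ## Correctness of the program -/

namespace RAM

variable {n m : ℕ}

theorem labStep_eq (inp L : ℕ → ℕ → ℕ) (u v : ℕ) : labStep n m inp L u v = L u v ∨
    ∃ w a, inp w a ≠ 0 ∧
      (inp v a ≠ 0 ∧ inp u a = 0 ∧ labStep n m inp L u v = L u w ∨
        inp u a ≠ 0 ∧ inp v a = 0 ∧ labStep n m inp L u v = L w v) := by
  have h0 : max (L u v) 0 = L u v := max_eq_left (Nat.zero_le _)
  unfold labStep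
  rcases exists_eq_sup_range (fun w => (Finset.range m).sup fun a => if inp w a ≠ 0 then
      max (if inp v a ≠ 0 then if inp u a ≠ 0 then 0 else L u w else 0)
        (if inp u a ≠ 0 then if inp v a ≠ 0 then 0 else L w v else 0) else 0) (n + 1) with
    h | ⟨w, -, h⟩ <;> rw [h]
  · exact .inl h0
  rcases exists_eq_sup_range (fun a => if inp w a ≠ 0 then
      max (if inp v a ≠ 0 then if inp u a ≠ 0 then 0 else L u w else 0)
        (if inp u a ≠ 0 then if inp v a ≠ 0 then 0 else L w v else 0) else 0) m with
    h | ⟨a, -, h⟩ <;> rw [h]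
  · exact .inl h0
  by_cases h1 : inp w a ≠ 0
  swap
  · rw [if_neg h1]
    exact .inl h0
  rw [if_pos h1]
  by_cases h2 : inp v a ≠ 0 <;> by_cases h3 : inp u a ≠ 0
  · rw [if_pos h2, if_pos h3, if_pos h3, if_pos h2]
    exact .inl h0
  · rw [if_pos h2, if_neg h3, if_neg h3, max_eq_left (Nat.zero_le (L u w))]
    rcases le_total (L u v) (L u w) with h | h
    · exact .inr ⟨w, a, h1, .inl ⟨h2, not_not.1 h3, max_eq_right h⟩⟩
    · exact .inl (max_eq_left h)
  · rw [if_neg h2, if_pos h3, if_neg h2, max_eq_right (Nat.zero_le (L w v))]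
    rcases le_total (L u v) (L w v) with h | h
    · exact .inr ⟨w, a, h1, .inr ⟨h3, not_not.1 h2, max_eq_right h⟩⟩
    · exact .inl (max_eq_left h)
  · rw [if_neg h2, if_neg h3]
    exact .inl h0

theorem le_labStep (inp L : ℕ → ℕ → ℕ) (u v : ℕ) {w a : ℕ} (hw : w < n) (ha : a < m)
    (hwa : inp w a ≠ 0) :
    (inp v a ≠ 0 → inp u a = 0 → L u w ≤ labStep n m inp L u v) ∧
      (inp u a ≠ 0 → inp v a = 0 → L w v ≤ labStep n m inp L u v) := by
  have key := (le_sup_range (f := fun a => if inp w a ≠ 0 then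
      max (if inp v a ≠ 0 then if inp u a ≠ 0 then 0 else L u w else 0)
        (if inp u a ≠ 0 then if inp v a ≠ 0 then 0 else L w v else 0) else 0) ha).trans
    ((le_sup_range (f := fun w => (Finset.range m).sup fun a => if inp w a ≠ 0 then
      max (if inp v a ≠ 0 then if inp u a ≠ 0 then 0 else L u w else 0)
        (if inp u a ≠ 0 then if inp v a ≠ 0 then 0 else L w v else 0) else 0)
      (Nat.lt_succ_of_lt hw)).trans (le_max_right (L u v) _))
  simp only [if_pos hwa] at key
  constructor
  · intro h1 h2
    rw [if_pos h1, if_neg (not_not.2 h2)] at key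
    exact (le_max_left _ _).trans key
  · intro h1 h2
    rw [if_pos h1, if_neg (not_not.2 h2), if_neg (not_not.2 h2), if_pos h1] at key
    exact (le_max_right _ _).trans key

/-- The approval matrix of a profile. -/
def approvalMatrix (P : ApprovalProfile n m) (u a : ℕ) : ℕ :=
  if ∃ (i : Fin n) (b : Fin m), (i : ℕ) = u ∧ (b : ℕ) = a ∧ b ∈ P.approved i then 1 else 0

variable {P : ApprovalProfile n m}

theorem approvalMatrix_ne_zero {u a : ℕ} : approvalMatrix P u a ≠ 0 ↔
    ∃ (i : Fin n) (b : Fin m), (i : ℕ) = u ∧ (b : ℕ) = a ∧ b ∈ P.approved i := by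
  unfold approvalMatrix
  split_ifs with h
  · exact ⟨fun _ => h, fun _ => one_ne_zero⟩
  · exact ⟨fun h' => absurd rfl h', fun h' => absurd h' h⟩

theorem approvalMatrix_fin {u : Fin n} {a : Fin m} :
    approvalMatrix P u a ≠ 0 ↔ a ∈ P.approved u := by
  rw [approvalMatrix_ne_zero]
  constructor
  · rintro ⟨i, b, hi, hb, h⟩
    rwa [← Fin.ext hi, ← Fin.ext hb]
  · exact fun h => ⟨u, a, rfl, rfl, h⟩

theorem approvalMatrix_eq_zero {u : Fin n} {a : Fin m} :
    approvalMatrix P u a = 0 ↔ a ∉ P.approved u := by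
  rw [← approvalMatrix_fin (P := P), not_not]

theorem approvalMatrix_of_le {u a : ℕ} (hu : n ≤ u) : approvalMatrix P u a = 0 := by
  by_contra h
  obtain ⟨i, b, rfl, -, -⟩ := approvalMatrix_ne_zero.1 h
  exact absurd i.2 (not_lt.2 hu)

theorem represents_encodeInstance (P : ApprovalProfile n m) (k : ℕ) :
    ∃ T, Represents n m (approvalMatrix P) T (encodeInstance P k).mem := by
  refine ⟨fun c i j κ l => (encodeInstance P k).mem (cellAddr (n + 1) (m * n) c i j κ l),
    fun u hu a ha => ?_, fun _ _ _ _ _ _ _ _ _ _ => rfl⟩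
  unfold encodeInstance approvalMatrix
  refine if_congr ⟨?_, ?_⟩ rfl rfl
  · rintro ⟨i, b, h, hb⟩
    rw [mul_comm (i : ℕ)] at h
    obtain ⟨h1, h2⟩ := mul_add_inj ha b.2 h
    exact ⟨i, b, h1.symm, h2.symm, hb⟩
  · rintro ⟨i, b, rfl, rfl, hb⟩
    exact ⟨i, b, by rw [mul_comm], hb⟩

/-- The initial label of a pair of voters. -/
def pairCode (n : ℕ) (p : Fin n × Fin n) : ℕ := (n + 1) * p.1 + p.2

/-- The final label of a pair of voters. -/
def pairLab (P : ApprovalProfile n m) (p : Fin n × Fin n) : ℕ :=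
  labIter n m (approvalMatrix P) ((n + 1) * (n + 1)) p.1 p.2

/-- One call of `labStep` is one round of propagation along `Linked`, and `n * n` rounds would
already suffice. -/
theorem isClassMax_pairLab (P : ApprovalProfile n m) :
    IsClassMax (fun u a => a ∈ P.approved u) (pairCode n) (pairLab P) := by
  set R := Linked fun u a => a ∈ P.approved u with hR
  set L : ℕ → Fin n × Fin n → ℕ := fun i p => labIter n m (approvalMatrix P) i p.1 p.2 with hL
  have h0 : ∀ x, L 0 x = pairCode n x := fun x => rfl
  constructor
  · refine propagate_eq (R := R) (L := L) h0 ?_ _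
    rintro i ⟨u, v⟩
    rcases labStep_eq (n := n) (m := m) (approvalMatrix P) (labIter n m (approvalMatrix P) i) u v
      with h | ⟨w, a, hwa, ⟨h1, h2, h⟩ | ⟨h1, h2, h⟩⟩
    · exact ⟨(u, v), .inl rfl, h⟩
    · obtain ⟨w, a, rfl, rfl, hwa'⟩ := approvalMatrix_ne_zero.1 hwa
      exact ⟨(u, w), .inr ⟨a, .inl ⟨rfl, approvalMatrix_fin.1 h1, hwa',
        approvalMatrix_eq_zero.1 h2⟩⟩, h⟩
    · obtain ⟨w, a, rfl, rfl, hwa'⟩ := approvalMatrix_ne_zero.1 hwa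
      exact ⟨(w, v), .inr ⟨a, .inr ⟨rfl, approvalMatrix_fin.1 h1, hwa',
        approvalMatrix_eq_zero.1 h2⟩⟩, h⟩
  · intro p q h
    refine propagate_le (R := R) (L := L) h0 (fun _ _ => Linked.symm) ?_ ?_ h ?_
    · exact fun i x => le_max_left _ _
    · rintro i ⟨u, v⟩ ⟨u', v'⟩ ⟨a, ⟨h1, h2, h3, h4⟩ | ⟨h1, h2, h3, h4⟩⟩
      · obtain rfl : u = u' := h1
        exact (le_labStep (approvalMatrix P) (labIter n m (approvalMatrix P) i) u v v'.2 a.2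
          (approvalMatrix_fin.2 h3)).1 (approvalMatrix_fin.2 h2) (approvalMatrix_eq_zero.2 h4)
      · obtain rfl : v = v' := h1
        exact (le_labStep (approvalMatrix P) (labIter n m (approvalMatrix P) i) u v u'.2 a.2
          (approvalMatrix_fin.2 h3)).2 (approvalMatrix_fin.2 h2) (approvalMatrix_eq_zero.2 h4)
    · rw [Fintype.card_prod, Fintype.card_fin]
      exact Nat.mul_le_mul (Nat.le_succ n) (Nat.le_succ n)

theorem pairCode_injective (n : ℕ) : Function.Injective (pairCode n) := by
  rintro ⟨u, v⟩ ⟨u', v'⟩ h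
  obtain ⟨h1, h2⟩ := mul_add_inj (by omega) (by omega) h
  exact Prod.ext (Fin.ext h1) (Fin.ext h2)

theorem fst_le_of_pairCode_le {p q : Fin n × Fin n} (h : pairCode n q ≤ pairCode n p) :
    q.1 ≤ p.1 := by
  by_contra hlt
  have h1 : (p.1 : ℕ) + 1 ≤ q.1 := not_le.1 hlt
  have h2 := Nat.mul_le_mul_left (n + 1) h1
  have h3 := p.2.2
  unfold pairCode at h
  rw [mul_add] at h2
  omega

/-- The order of the voters computed by the program. -/
abbrev voterLT (P : ApprovalProfile n m) : Fin n → Fin n → Prop := LabLT (pairLab P)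

instance (P : ApprovalProfile n m) : DecidableRel (voterLT P) :=
  fun u v => inferInstanceAs (Decidable (pairLab P (v, u) < pairLab P (u, v)))

theorem inputPos_eq_rankOf (u : Fin n) :
    inputPos n m (approvalMatrix P) u = rankOf (voterLT P) u := by
  rw [inputPos, labPos, Finset.sum_range_succ, if_neg (lt_irrefl n), add_zero,
    Finset.sum_range, rankOf, Finset.card_filter]
  refine Finset.sum_congr rfl fun v _ => ?_
  rw [if_pos v.2]
  rfl

theorem voterAt_pos {pos : ℕ → ℕ} (hinj : ∀ u < n, ∀ v < n, pos u = pos v → u = v) {u : ℕ}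
    (hu : u < n) : voterAt n pos (pos u) = u := by
  rw [voterAt, Finset.sum_eq_single u]
  · rw [if_pos hu, if_pos rfl]
  · intro v _ hvu
    split_ifs with h1 h2
    · exact absurd (hinj v h1 u hu h2) hvu
    · rfl
    · rfl
  · intro h
    exact absurd (Finset.mem_range.2 (Nat.lt_succ_of_lt hu)) h

theorem voterLT_trans (hP : P.IsSingleCrossing) (u v w : Fin n) (huv : voterLT P u v)
    (hvw : voterLT P v w) : voterLT P u w := by
  obtain ⟨r, hr, h⟩ := hP
  exact (isClassMax_pairLab P).labLT_trans (pairCode_injective n)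
    (fun _ _ => fst_le_of_pairCode_le) h huv hvw

theorem voterLT_irrefl (u : Fin n) : ¬ voterLT P u u := lt_irrefl _

theorem voterLT_total (hP : P.IsSingleCrossing) (u v : Fin n) (huv : u ≠ v) :
    voterLT P u v ∨ voterLT P v u := by
  obtain ⟨r, hr, h⟩ := hP
  exact (isClassMax_pairLab P).labLT_total (pairCode_injective n) h huv

theorem inputPos_lt {u : ℕ} (hu : u < n) : inputPos n m (approvalMatrix P) u < n := by
  have h := rankOf_lt_card (voterLT_irrefl (P := P)) ⟨u, hu⟩
  rwa [← inputPos_eq_rankOf, Fintype.card_fin] at h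

theorem inputPos_inj (hP : P.IsSingleCrossing) {u v : ℕ} (hu : u < n) (hv : v < n)
    (h : inputPos n m (approvalMatrix P) u = inputPos n m (approvalMatrix P) v) : u = v := by
  have h1 := inputPos_eq_rankOf (P := P) ⟨u, hu⟩
  have h2 := inputPos_eq_rankOf (P := P) ⟨v, hv⟩
  exact congrArg Fin.val (rankOf_injective (voterLT_trans hP) voterLT_irrefl (voterLT_total hP)
    (h1.symm.trans (h.trans h2)))

theorem exists_inputPos_eq (hP : P.IsSingleCrossing) {p : ℕ} (hp : p < n) :
    ∃ u : Fin n, inputPos n m (approvalMatrix P) u = p := by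
  obtain ⟨u, hu⟩ := exists_rankOf_eq (voterLT_trans hP) voterLT_irrefl (voterLT_total hP)
    (p := p) (by rwa [Fintype.card_fin])
  exact ⟨u, (inputPos_eq_rankOf u).trans hu⟩

theorem inputApp_pos (hP : P.IsSingleCrossing) (u : Fin n) (a : ℕ) :
    inputApp n m (approvalMatrix P) a (inputPos n m (approvalMatrix P) u) ↔
      approvalMatrix P u a ≠ 0 := by
  rw [inputApp, appAt, slotVal, if_pos (inputPos_lt u.2),
    voterAt_pos (fun _ hu _ hv => inputPos_inj hP hu hv) u.2]

theorem lt_of_inputApp {a p : ℕ} (h : inputApp n m (approvalMatrix P) a p) : p < n := by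
  by_contra hp
  exact h (if_neg hp)

theorem inputApp_convex (hP : P.IsSingleCrossing) (a p p' p'' : ℕ)
    (h : inputApp n m (approvalMatrix P) a p) (h'' : inputApp n m (approvalMatrix P) a p'')
    (hp : p ≤ p') (hp' : p' ≤ p'') : inputApp n m (approvalMatrix P) a p' := by
  rcases hp.eq_or_lt with rfl | hlt
  · exact h
  rcases hp'.eq_or_lt with rfl | hlt'
  · exact h''
  have hn := lt_of_inputApp h''
  obtain ⟨u, rfl⟩ := exists_inputPos_eq hP (hlt.trans (hlt'.trans hn))
  obtain ⟨v, rfl⟩ := exists_inputPos_eq hP (hlt'.trans hn)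
  obtain ⟨w, rfl⟩ := exists_inputPos_eq hP hn
  rw [inputApp_pos hP] at h h'' ⊢
  obtain ⟨_, b, -, rfl, -⟩ := approvalMatrix_ne_zero.1 h
  rw [approvalMatrix_fin] at h h'' ⊢
  rw [inputPos_eq_rankOf, inputPos_eq_rankOf] at hlt hlt'
  have key := fun u v => lt_of_rankOf_lt (voterLT_trans hP) voterLT_irrefl (voterLT_total hP)
    (u := u) (v := v)
  exact (isClassMax_pairLab P).labLT_between (key _ _ hlt) (key _ _ hlt') h h''

/-- The approved pairs of `σ` include the optimal schedule `A`, and those of a competitor `τ` form a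
schedule of size at most that of `A`. Subtracting from `n` compares the misrepresentations. -/
theorem exists_isMonroeOptimal (hP : P.IsSingleCrossing) {k : ℕ} (hk : 1 ≤ k) (hkn : k ≤ n)
    (hkm : k ≤ m) {env : ℕ → ℕ} (h0 : env 0 = n) (h1 : env 1 = m) (h2 : env 2 = k) :
    ∃ σ : Fin n → Fin m, IsMonroeOptimal ApprovalProfile.sumMisrep P k σ ∧
      ∀ u : Fin n, mainCmd.run (sizes n m) env (encodeInstance P k).mem u = σ u := by
  obtain ⟨T, hT⟩ := represents_encodeInstance P k
  obtain ⟨A, S, hA, hmax, hS, hSA, hS0, hout⟩ := hT.run_mainCmd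
    (fun _ _ => approvalMatrix_of_le) h0 h1 h2 hk hkn hkm (fun _ => inputPos_lt)
    (fun _ hu _ hv => inputPos_inj hP hu hv)
    (fun p hp => by
      obtain ⟨u, hu⟩ := exists_inputPos_eq hP hp
      exact ⟨u, u.2, hu⟩) (inputApp_convex hP)
  set pos : Fin n → ℕ := fun u => inputPos n m (approvalMatrix P) u with hpos
  have hinj : Function.Injective pos := fun u v h => Fin.ext (inputPos_inj hP u.2 v.2 h)
  set σ : Fin n → Fin m := fun u => ⟨S u - 1, by
    have := hS.le u u.2
    have := hS0 u u.2
    omega⟩ with hσ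
  have hSσ : ∀ u : Fin n, S u = σ u + 1 := fun u => by
    have := hS0 u u.2
    simp only [hσ]
    omega
  refine ⟨σ, ⟨hS.isProportionalAssignment hk hkn hSσ, fun τ hτ => ?_⟩, fun u => hout u u.2⟩
  have hle := hmax _ (hτ.isSchedule hinj (fun u => inputPos_lt u.2)
    (fun u a h => (inputApp_pos hP u a).2 (approvalMatrix_fin.2 h)) hk)
  have hsub : A ⊆ schedOf P pos σ := by
    rintro ⟨a, p⟩ hx
    obtain ⟨u, rfl⟩ := exists_inputPos_eq hP (hA.lt _ hx)
    have hSu := hSA u u.2 a hx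
    obtain rfl : (σ u : ℕ) = a := by
      have := hSσ u
      omega
    exact Finset.mem_image.2 ⟨u, Finset.mem_filter.2 ⟨Finset.mem_univ u,
      approvalMatrix_fin.1 ((inputApp_pos hP u _).1 (hA.appr _ hx))⟩, rfl⟩
  have hσ' := card_schedOf (P := P) hinj σ
  have hτ' := card_schedOf (P := P) hinj τ
  have := Finset.card_le_card hsub
  change P.sumMisrep σ ≤ P.sumMisrep τ
  omega

end RAM

/-- If some competitor has maximum 0, its sum is 0, so the sum of `σ` vanishes. Otherwise the
competitor has maximum at least 1, which no misrepresentation exceeds. -/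
theorem IsMonroeOptimal.maxMisrep {n m k : ℕ} {P : ApprovalProfile n m} {σ : Fin n → Fin m}
    (h : IsMonroeOptimal ApprovalProfile.sumMisrep P k σ) :
    IsMonroeOptimal ApprovalProfile.maxMisrep P k σ := by
  refine ⟨h.1, fun τ hτ => Finset.sup_le fun v _ => ?_⟩
  by_cases h0 : P.maxMisrep τ = 0
  · have hτ0 : P.sumMisrep τ = 0 := Finset.sum_eq_zero fun u hu =>
      Nat.le_zero.1 ((Finset.le_sup (f := fun u => P.misrep u (τ u)) hu).trans h0.le)
    have hσ0 : P.sumMisrep σ = 0 := Nat.le_zero.1 ((h.2 τ hτ).trans hτ0.le)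
    rw [Finset.sum_eq_zero_iff.1 hσ0 v (Finset.mem_univ v)]
    exact Nat.zero_le _
  · refine le_trans ?_ (Nat.one_le_iff_ne_zero.2 h0)
    unfold ApprovalProfile.misrep
    split_ifs <;> decide

/-! ### The complete machine program and its running time -/

namespace RAM

/-- The registers of the variables at the start of the main program. -/
def baseReg (x : ℕ) : ℕ := if x < 3 then x else 4

/-- Prepare the registers: register `5` becomes `0` if there are at least `k` voters and at least
`k` alternatives. -/
def setupProg : Prog :=
  .seq (.const 3 1) (.seq (.add 3 0 3) (.seq (.sub 5 2 0) (.seq (.sub 6 2 1) (.add 5 5 6))))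

theorem setupProg_runs (s : State) : Runs setupProg s 5 fun s' =>
    s'.mem = s.mem ∧ s'.reg 0 = s.reg 0 ∧ s'.reg 1 = s.reg 1 ∧ s'.reg 2 = s.reg 2 ∧
      s'.reg 3 = s.reg 0 + 1 ∧ s'.reg 5 = s.reg 2 - s.reg 0 + (s.reg 2 - s.reg 1) := by
  refine Runs.mono (T := 1 + (1 + (1 + (1 + 1)))) ?_ le_rfl (fun _ h => h)
  refine Runs.seq (Q := fun s => s = _) (Runs.const rfl) ?_
  rintro _ rfl
  refine Runs.seq (Q := fun s => s = _) (Runs.add rfl) ?_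
  rintro _ rfl
  refine Runs.seq (Q := fun s => s = _) (Runs.sub rfl) ?_
  rintro _ rfl
  refine Runs.seq (Q := fun s => s = _) (Runs.sub rfl) ?_
  rintro _ rfl
  exact Runs.add (by simp)

/-- A program for both winner determination problems. -/
def monroeProg : Prog :=
  .seq setupProg (.ifNonzero 5 (.const 0 0) (.seq (mainCmd.compile baseReg 5) (.const 0 1)))

theorem monroeProg_runs {n m k : ℕ} (P : ApprovalProfile n m) (hk : 1 ≤ k)
    (hP : P.IsSingleCrossing) :
    Runs monroeProg (encodeInstance P k)
      (7 + if k ≤ n ∧ k ≤ m then mainCmd.cost (sizes n m) else 0) fun s =>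
        (∃ σ : Fin n → Fin m, IsMonroeOptimal ApprovalProfile.sumMisrep P k σ ∧
          PresentsAssignment s σ) ∨
        (s.reg 0 = 0 ∧ ¬ ∃ σ : Fin n → Fin m, IsProportionalAssignment k σ) := by
  set c := if k ≤ n ∧ k ≤ m then mainCmd.cost (sizes n m) else 0 with hc
  refine Runs.mono (T := 5 + (c + 1 + 1)) (Runs.seq (setupProg_runs _) ?_) (by omega)
    (fun _ h => h)
  rintro s ⟨hmem, h0, h1, h2, h3, h5⟩
  change s.reg 0 = n at h0
  change s.reg 1 = m at h1
  change s.reg 2 = k at h2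
  change s.reg 3 = n + 1 at h3
  change s.reg 5 = k - n + (k - m) at h5
  refine Runs.ite (fun hx => ?_) (fun hx => ?_)
  · refine Runs.mono (T := 1) (Runs.const (.inr ⟨by simp, ?_⟩)) (by omega) (fun _ h => h)
    rintro ⟨σ, hσ⟩
    have := hσ.le_left
    have := hσ.le_right
    omega
  · have hle : k ≤ n ∧ k ≤ m := by omega
    set env : ℕ → ℕ := fun x => s.reg (baseReg x) with henv
    obtain ⟨σ, hσ, hout⟩ := exists_isMonroeOptimal hP hk hle.1 hle.2 (env := env) h0 h1 h2
    rw [hc, if_pos hle]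
    -- Registers 1 and 3 hold the loop lengths `m` and `n + 1`. Only the variables 0, 1 and 2 need
    -- prescribed initial values, so all others may share register 4.
    refine Runs.seq (Cmd.compile_runs (sz := sizes n m) mainCmd baseReg env 5 s (by decide)
      (fun x => ⟨?_, rfl⟩) (fun b => ?_)) ?_
    · unfold baseReg
      split_ifs <;> omega
    · cases b
      exacts [h1, h3]
    · rintro s' ⟨hs', -⟩
      refine Runs.const (.inl ⟨σ, hσ, by simp, fun u => ?_⟩)
      rw [← hout u, ← hmem, ← hs']

theorem exists_cost_mainCmd_le : ∃ C : ℕ, ∀ n m k : ℕ, 1 ≤ k →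
    (7 + if k ≤ n ∧ k ≤ m then mainCmd.cost (sizes n m) else 0) ≤ C * (n ^ 11 * m ^ 5 + 1) := by
  -- The nesting depths of the fixed command `mainCmd` are computed by `decide`.
  obtain ⟨C, hC⟩ := (Cmd.polyBound_cost mainCmd).mono (show _ ≤ 11 by decide) (show _ ≤ 5 by decide)
  refine ⟨C * 2 ^ 11 + 7, fun n m k hk => ?_⟩
  split_ifs with h
  · have hn : 1 ≤ n := hk.trans h.1
    have hm : 1 ≤ m := hk.trans h.2
    have h1 := hC (sizes n m) (fun b => by cases b <;> simp [hm])
    -- Loops have length `n + 1`; since `1 ≤ k ≤ n` in this branch, `n + 1 ≤ 2 * n`. Instances with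
    -- `n = 0` or `m = 0` fall under the constant-time branch.
    have h2 : (n + 1) ^ 11 ≤ 2 ^ 11 * n ^ 11 := by
      rw [← mul_pow]
      exact Nat.pow_le_pow_left (by omega) 11
    simp only [sizes_true, sizes_false] at h1
    have h3 := h1.trans (Nat.mul_le_mul_left C (Nat.mul_le_mul_right (m ^ 5) h2))
    rw [show C * (2 ^ 11 * n ^ 11 * m ^ 5) = C * 2 ^ 11 * (n ^ 11 * m ^ 5) by ring] at h3
    rw [add_mul, mul_add]
    omega
  · rw [add_mul, mul_add 7]
    omega

theorem solves_of_bound {T : ℕ → ℕ → ℕ → ℕ} (hT : ∀ n m k, 1 ≤ k →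
    (7 + if k ≤ n ∧ k ≤ m then mainCmd.cost (sizes n m) else 0) ≤ T n m k) :
    SolvesMonroeOnSingleCrossing ApprovalProfile.sumMisrep monroeProg T ∧
      SolvesMonroeOnSingleCrossing ApprovalProfile.maxMisrep monroeProg T := by
  constructor <;> intro n m k P hk hP <;>
    obtain ⟨t, s, hs, ht, h⟩ := monroeProg_runs P hk hP <;>
    refine ⟨t, s, hs, ht.trans (hT n m k hk), ?_⟩
  · exact h
  · exact h.imp_left fun ⟨σ, hσ, hs⟩ => ⟨σ, hσ.maxMisrep, hs⟩

end RAM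

theorem mainTheorem1 :
    (∃ prog : RAM.Prog,
      (∃ p : Polynomial ℕ, SolvesMonroeOnSingleCrossing ApprovalProfile.sumMisrep prog
        (fun n m _ => p.eval (n + m))) ∧
      (∃ C : ℕ, SolvesMonroeOnSingleCrossing ApprovalProfile.sumMisrep prog
        (fun n m k => C * (n ^ 11 * m ^ 5 * k + 1)))) ∧
    (∃ prog : RAM.Prog,
      (∃ p : Polynomial ℕ, SolvesMonroeOnSingleCrossing ApprovalProfile.maxMisrep prog
        (fun n m _ => p.eval (n + m))) ∧
      (∃ C : ℕ, SolvesMonroeOnSingleCrossing ApprovalProfile.maxMisrep prog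
        (fun n m k => C * (n ^ 11 * m ^ 5 * k + 1)))) := by
  obtain ⟨C, hC⟩ := RAM.exists_cost_mainCmd_le
  -- The exponent is `16 = 11 + 5`, both `n` and `m` being at most `n + m`.
  have hpoly := RAM.solves_of_bound
    (T := fun n m _ => (Polynomial.C C * (Polynomial.X ^ 16 + 1)).eval (n + m))
    (fun n m k hk => (hC n m k hk).trans (by
      simp only [Polynomial.eval_mul, Polynomial.eval_C, Polynomial.eval_add, Polynomial.eval_pow,
        Polynomial.eval_X, Polynomial.eval_one]
      refine Nat.mul_le_mul_left C (Nat.add_le_add_right ?_ 1)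
      rw [show (n + m) ^ 16 = (n + m) ^ 11 * (n + m) ^ 5 from pow_add _ 11 5]
      exact Nat.mul_le_mul (Nat.pow_le_pow_left (Nat.le_add_right n m) 11)
        (Nat.pow_le_pow_left (Nat.le_add_left m n) 5)))
  have hbound := RAM.solves_of_bound (T := fun n m k => C * (n ^ 11 * m ^ 5 * k + 1))
    (fun n m k hk => (hC n m k hk).trans (Nat.mul_le_mul_left C (Nat.add_le_add_right
      (Nat.le_mul_of_pos_right _ hk) 1)))
  exact ⟨⟨RAM.monroeProg, ⟨_, hpoly.1⟩, ⟨C, hbound.1⟩⟩,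
    ⟨RAM.monroeProg, ⟨_, hpoly.2⟩, ⟨C, hbound.2⟩⟩⟩
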